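/- Let $d\ge 1$ be an integer and $\varepsilon>0$ with $e^{\varepsilon}+1\ge d$. **Setting.** A mechanism is given by a finite number $m$ of responses and a column-stochastic matrix $P\in\mathbb R^{m\times d}$, $P_{o,x}=\Pr(M(x)=o)$; it is $\varepsilon$-LDP if $P_{o,x}\le e^{\varepsilon}P_{o,x'}$ for all $o,x,x'$. For a dataset $X=(X^{(1)},\dots,X^{(n)})\in[d]^n$ with frequencies $f(x)=\frac1n\#\{i:X^{(i)}=x\}$, the independent responses $O^{(i)}\sim M(X^{(i)})$ have frequency vector $\mathbf{f_O}$, and an estimator is a function $\hat f$ producing $\hat f(\mathbf{f_O})\in\mathbb R^d$. It is unbiased at size $n$ if $\mathbb E[\hat f(x)]=f(x)$ for every $x\in[d]$ and every dataset of size $n$. Its losses are $$\mathcal L_1(\hat f,n)=\max_{X\in[d]^n}\mathbb E\sum_{x}|\hat f(x)-f(x)|,\qquad \mathcal L_2(\hat f,n)=\max_{X\in[d]^n}\mathbb E\sum_{x}(\hat f(x)-f(x))^2 .$$ Below, $\min_{\hat f}$ and $\inf_{\hat f}$ range over all $\varepsilon$-LDP mechanisms (any $m$) and all estimators using them that are unbiased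 at size $n$. An optimal symmetric configuration (OSC) with support size $k$ is an $\varepsilon$-LDP mechanism with base values $p_o$ such that $P_{o,x}\in\{p_o,e^{\varepsilon}p_o\}$ for all $o,x$, every support set $S_o=\{x:P_{o,x}=e^{\varepsilon}p_o\}$ has exactly $k$ elements, and there are constants $p^*\ne q^*$ with $\Pr(x\in S_{M(x)})=p^*$ for all $x$ and $\Pr(x\in S_{M(x')})=q^*$ for all $x\neq x'$; it is used with the estimator $\hat f(x)=\dfrac{\sum_{o:\,x\in S_o}\mathbf{f_O}(o)-q^*}{p^*-q^*}$. **Statement.** 1. For every $n\ge1$ the minimum $\mathcal L_2$ loss is attained and equals $$\min_{\hat f}\mathcal L_2(\hat f,n)=\frac{(d-1)(d+2e^{\varepsilon}-2)}{n(e^{\varepsilon}-1)^2}.$$ 2. Asymptotically, the optimal $\mathcal L_1$ loss is $\inf_{\hat f}\mathcal L_1(\hat f,n)\approx\sqrt{\dfrac{2d(d-1)(d+2e^{\varepsilon}-2)}{\pi}}\cdot\dfrac{1}{\sqrt n\,(e^{\varepsilon}-1)}$, that is, $$\lim_{n\to\infty}\sqrt n\,\inf_{\hat f}\mathcal L_1(\hat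 f,n)=\frac{1}{e^{\varepsilon}-1}\sqrt{\frac{2d(d-1)(d+2e^{\varepsilon}-2)}{\pi}} .$$ 3. The optimal support size is $k=1$: an OSC with support size $1$ exists; the estimator of every such OSC is unbiased, attains the minimum in 1 for every $n\ge1$, and its $\mathcal L_1$ loss multiplied by $\sqrt n$ converges to the limit in 2. If $d\ge2$, every OSC with support size $k\ne1$ has, for every $n\ge1$, an $\mathcal L_2$ loss strictly larger than the minimum in 1. -/

import Mathlib

open Filter Topology

namespace LDPFreq

noncomputable section

/-- `P o x = Pr(M(x) = o)`: every column is a probability vector on the responses `Fin m`. -/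
def IsMechanism {m d : ℕ} (P : Matrix (Fin m) (Fin d) ℝ) : Prop :=
  (∀ o x, 0 ≤ P o x) ∧ ∀ x, ∑ o, P o x = 1

/-- `ε`-local differential privacy of the mechanism with perturbation matrix `P`. -/
def IsLDP {m d : ℕ} (ε : ℝ) (P : Matrix (Fin m) (Fin d) ℝ) : Prop :=
  ∀ o x x', P o x ≤ Real.exp ε * P o x'

/-- The frequency vector of a sequence of `n` values in `Fin k`. Applied to a dataset it is the
true frequency vector `f`, applied to the responses it is the response frequency vector `f_O`. -/
def freq {n k : ℕ} (v : Fin n → Fin k) (a : Fin k) : ℝ :=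
  (∑ i, if v i = a then (1 : ℝ) else 0) / n

/-- Expectation of `g (O₁, …, Oₙ)`, where the responses `Oᵢ ∼ M(Xᵢ)` to the entries of the
dataset `X` are independent. -/
def expect {m d n : ℕ} (P : Matrix (Fin m) (Fin d) ℝ) (X : Fin n → Fin d)
    (g : (Fin n → Fin m) → ℝ) : ℝ :=
  ∑ o : Fin n → Fin m, (∏ i, P (o i) (X i)) * g o

/-- A frequency estimator: it maps the response frequency vector to an estimate of `f`. -/
abbrev Estimator (m d : ℕ) : Type := (Fin m → ℝ) → (Fin d → ℝ)

/-- The estimator is unbiased on all datasets of size `n`. -/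
def IsUnbiased {m d : ℕ} (P : Matrix (Fin m) (Fin d) ℝ) (fhat : Estimator m d) (n : ℕ) : Prop :=
  ∀ (X : Fin n → Fin d) (x : Fin d), expect P X (fun o => fhat (freq o) x) = freq X x

/-- Worst-case (over all datasets of size `n`) expected `L₁` error. -/
def L1loss {m d : ℕ} (P : Matrix (Fin m) (Fin d) ℝ) (fhat : Estimator m d) (n : ℕ) : ℝ :=
  ⨆ X : Fin n → Fin d, expect P X (fun o => ∑ x, |fhat (freq o) x - freq X x|)

/-- Worst-case (over all datasets of size `n`) expected squared `L₂` error. -/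
def L2loss {m d : ℕ} (P : Matrix (Fin m) (Fin d) ℝ) (fhat : Estimator m d) (n : ℕ) : ℝ :=
  ⨆ X : Fin n → Fin d, expect P X (fun o => ∑ x, (fhat (freq o) x - freq X x) ^ 2)

/-- All values of the `L₁` loss at dataset size `n`, over every `ε`-LDP mechanism on `[d]` (with
any finite number of responses) and every unbiased estimator that uses it. -/
def L1losses (d : ℕ) (ε : ℝ) (n : ℕ) : Set ℝ :=
  {L | ∃ (m : ℕ) (P : Matrix (Fin m) (Fin d) ℝ) (fhat : Estimator m d),
    IsMechanism P ∧ IsLDP ε P ∧ IsUnbiased P fhat n ∧ L = L1loss P fhat n}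

/-- All values of the `L₂` loss at dataset size `n`, over every `ε`-LDP mechanism on `[d]` (with
any finite number of responses) and every unbiased estimator that uses it. -/
def L2losses (d : ℕ) (ε : ℝ) (n : ℕ) : Set ℝ :=
  {L | ∃ (m : ℕ) (P : Matrix (Fin m) (Fin d) ℝ) (fhat : Estimator m d),
    IsMechanism P ∧ IsLDP ε P ∧ IsUnbiased P fhat n ∧ L = L2loss P fhat n}

/-- Extremal configuration with base probabilities `p`. -/
def IsExtremal {m d : ℕ} (ε : ℝ) (P : Matrix (Fin m) (Fin d) ℝ) (p : Fin m → ℝ) : Prop :=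
  ∀ o x, P o x = p o ∨ P o x = Real.exp ε * p o

/-- The support set of the response `o`. -/
def supp {m d : ℕ} (ε : ℝ) (P : Matrix (Fin m) (Fin d) ℝ) (p : Fin m → ℝ) (o : Fin m) :
    Finset (Fin d) :=
  Finset.univ.filter fun x => P o x = Real.exp ε * p o

/-- Symmetric configuration with self-support probability `ps` and cross-support
probability `qs`. -/
def IsSymmetric {m d : ℕ} (ε : ℝ) (P : Matrix (Fin m) (Fin d) ℝ) (p : Fin m → ℝ)
    (ps qs : ℝ) : Prop :=
  (∀ x, (∑ o, if x ∈ supp ε P p o then P o x else 0) = ps) ∧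
    ∀ x x', x ≠ x' → (∑ o, if x ∈ supp ε P p o then P o x' else 0) = qs

/-- The reconstruction `(Σ_o S_{o,x} f_O(o) - q*) / (p* - q*)` of symmetric configurations. -/
def symEstimator {m d : ℕ} (ε : ℝ) (P : Matrix (Fin m) (Fin d) ℝ) (p : Fin m → ℝ)
    (ps qs : ℝ) : Estimator m d :=
  fun fO x => ((∑ o, if x ∈ supp ε P p o then fO o else 0) - qs) / (ps - qs)

/-- Optimal symmetric configuration with constant support size `k`: an extremal and symmetric
`ε`-LDP mechanism each of whose responses supports exactly `k` inputs. The condition `ps ≠ qs`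
says that its estimator `symEstimator ε P p ps qs` is well defined. -/
structure IsOSC {m d : ℕ} (ε : ℝ) (P : Matrix (Fin m) (Fin d) ℝ) (p : Fin m → ℝ)
    (ps qs : ℝ) (k : ℕ) : Prop where
  mechanism : IsMechanism P
  ldp : IsLDP ε P
  extremal : IsExtremal ε P p
  symmetric : IsSymmetric ε P p ps qs
  card_supp : ∀ o, (supp ε P p o).card = k
  ne : ps ≠ qs

/-- The closed form `(d-1)(d+2e^ε-2) / (n(e^ε-1)²)`. -/
def optL2 (d : ℕ) (ε : ℝ) (n : ℕ) : ℝ :=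
  ((d : ℝ) - 1) * (d + 2 * Real.exp ε - 2) / (n * (Real.exp ε - 1) ^ 2)

/-- The closed form `√(2d(d-1)(d+2e^ε-2)/π) / (e^ε-1)`, which is `√n · √((2d/π) · optL2 d ε n)`. -/
def optL1const (d : ℕ) (ε : ℝ) : ℝ :=
  Real.sqrt (2 * d * ((d : ℝ) - 1) * (d + 2 * Real.exp ε - 2) / Real.pi) / (Real.exp ε - 1)

end

end LDPFreq

/-! ### Moments of functions of independent coordinates -/

namespace LDPFreq

/-! Write g = e^ε and let χ²_x be `chiSq P x`. In all lower bounds the mechanism enters only through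
these d divergences. For an ε-LDP mechanism with d ≤ g + 1 they satisfy ∑ χ²_x ≤ d · `chiOpt d g`.
This is proved response by response: the ratios u_x = P o x / `avgResp P o` average to 1 and lie
within a factor g of each other, and ∑ (u_x - g l)(u_x - l) ≤ 0, where g l and l are the two ratios
that occur in randomized response. The inequality has room to spare, so that weights between 1 and
some M are allowed (`sum_weighted_chiSq_le`).

L₂. Average the risk over uniformly distributed datasets. By unbiasedness, the inner product of the
error with a suitable test function does not depend on the estimator, and Cauchy-Schwarz bounds each
coordinate from below by an expression that is affine in χ²_x for a fixed parameter α
(`le_avg_sq_error`). Taking the same α for all x leaves only the sum of the divergences. For an OSC,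
double counting determines p* and q*, the L₂ loss is the same for all datasets, and comparing it
with k = 1 is algebra.

L₁, upper bound. For an OSC with k = 1 a Lindeberg estimate replaces the error in each coordinate by
a Gaussian one; Cauchy-Schwarz over x then reduces the sum of standard deviations to the known sum
of variances.

L₁, lower bound, for arbitrary estimators. Cut the dataset into N blocks of fixed size B with
independent priors: within a block the inputs are i.i.d. from a law that is itself random, at
distance of order 1/√B from the uniform law. The van Trees inequality shows that the quadratic Bayes
risk of a block frequency is at least about (1 - 1/d)/d · ((d-1)/χ²_x - 1) / B, as in the unbiased
case. Given the responses, the block frequencies are independent, so the central limit theorem turns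
the posterior variance into an absolute error, whatever the centre of the estimate. All error terms
are uniform over mechanisms, which is what a statement about infima needs.

It remains to minimise ∑ √(1/y_x - 1) for y_x = χ²_x / (d-1) under the constraint. This function is
not convex. If the optimal value y₀ = ((g-1)/(g+d-1))² is at most 1/2, the tangent at y₀ is a
supporting line; otherwise a broken line, steeper to the right of y₀, is used together with the
weighted form of the constraint (`exists_supporting_line`). -/

/-- Expectation of `F` under the product of the weights `w i` on the coordinates. -/
noncomputable def prodExp {ι α : Type*} [Fintype ι] [DecidableEq ι] [Fintype α]
    (w : ι → α → ℝ) (F : (ι → α) → ℝ) : ℝ :=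
  ∑ a : ι → α, (∏ i, w i (a i)) * F a

section prodExp

variable {ι α : Type*} [Fintype ι] [DecidableEq ι] [Fintype α] {w : ι → α → ℝ}

theorem sum_prod_apply (φ : ι → α → ℝ) : ∑ a : ι → α, ∏ i, φ i (a i) = ∏ i, ∑ b, φ i b := by
  classical
  rw [Finset.prod_univ_sum, Fintype.piFinset_univ]

theorem prodExp_prod (w φ : ι → α → ℝ) :
    prodExp w (fun a => ∏ i, φ i (a i)) = ∏ i, ∑ b, w i b * φ i b := by
  rw [← sum_prod_apply]
  simp [prodExp, Finset.prod_mul_distrib]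

theorem prodExp_pair (hw : ∀ i, ∑ b, w i b = 1) {i j : ι} (hij : i ≠ j) (φ ψ : α → ℝ) :
    prodExp w (fun a => φ (a i) * ψ (a j)) = (∑ b, w i b * φ b) * ∑ b, w j b * ψ b := by
  have h := prodExp_prod w
    (fun k b => (if k = i then φ b else 1) * (if k = j then ψ b else 1))
  have h1 : ∀ a : ι → α, (∏ k, ((if k = i then φ (a k) else 1) * (if k = j then ψ (a k) else 1)))
      = φ (a i) * ψ (a j) := fun a => by
    rw [Finset.prod_mul_distrib]; simp
  simp only [h1] at h
  rw [h, ← Finset.mul_prod_erase _ _ (Finset.mem_univ i),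
    ← Finset.mul_prod_erase _ _ (Finset.mem_erase.2 ⟨hij.symm, Finset.mem_univ j⟩)]
  rw [Finset.prod_eq_one]
  · simp [hij, hij.symm]
  · intro k hk
    simp only [Finset.mem_erase, Finset.mem_univ, and_true] at hk
    simp [hk.1, hk.2, hw]

theorem prodExp_const (hw : ∀ i, ∑ b, w i b = 1) (c : ℝ) : prodExp w (fun _ => c) = c := by
  rw [prodExp, ← Finset.sum_mul, sum_prod_apply]
  simp [hw]

theorem prodExp_coord (hw : ∀ i, ∑ b, w i b = 1) (j : ι) (φ : α → ℝ) :
    prodExp w (fun a => φ (a j)) = ∑ b, w j b * φ b := by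
  have h := prodExp_prod w (fun k b => (if k = j then φ b else 1))
  simp only [Finset.prod_ite_eq', Finset.mem_univ, if_true] at h
  rw [h, ← Finset.mul_prod_erase _ _ (Finset.mem_univ j), Finset.prod_eq_one]
  · simp
  · intro k hk
    simp [Finset.ne_of_mem_erase hk, hw]

theorem prodExp_add (w : ι → α → ℝ) (F G : (ι → α) → ℝ) :
    prodExp w (fun a => F a + G a) = prodExp w F + prodExp w G := by
  simp [prodExp, mul_add, Finset.sum_add_distrib]

theorem prodExp_sub (w : ι → α → ℝ) (F G : (ι → α) → ℝ) :
    prodExp w (fun a => F a - G a) = prodExp w F - prodExp w G := by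
  simp [prodExp, mul_sub, Finset.sum_sub_distrib]

theorem prodExp_const_mul (w : ι → α → ℝ) (c : ℝ) (F : (ι → α) → ℝ) :
    prodExp w (fun a => c * F a) = c * prodExp w F := by
  simp only [prodExp, Finset.mul_sum]
  exact Finset.sum_congr rfl fun a _ => by ring

theorem prodExp_sum (w : ι → α → ℝ) {κ : Type*} (s : Finset κ) (F : κ → (ι → α) → ℝ) :
    prodExp w (fun a => ∑ k ∈ s, F k a) = ∑ k ∈ s, prodExp w (F k) := by
  simp only [prodExp, Finset.mul_sum]
  exact Finset.sum_comm

theorem prodExp_mono (hw : ∀ i b, 0 ≤ w i b) {F G : (ι → α) → ℝ} (h : ∀ a, F a ≤ G a) :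
    prodExp w F ≤ prodExp w G :=
  Finset.sum_le_sum fun a _ => mul_le_mul_of_nonneg_left (h a) (Finset.prod_nonneg fun i _ => hw i _)

theorem prodExp_nonneg (hw : ∀ i b, 0 ≤ w i b) {F : (ι → α) → ℝ} (h : ∀ a, 0 ≤ F a) :
    0 ≤ prodExp w F :=
  Finset.sum_nonneg fun a _ => mul_nonneg (Finset.prod_nonneg fun i _ => hw i _) (h a)

/-- The mean of a sum over the coordinates. -/
theorem prodExp_sum_coord (hw : ∀ i, ∑ b, w i b = 1) (φ : ι → α → ℝ) :
    prodExp w (fun a => ∑ i, φ i (a i)) = ∑ i, ∑ b, w i b * φ i b := by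
  rw [prodExp_sum]
  exact Finset.sum_congr rfl fun i _ => prodExp_coord hw i (φ i)

/-- Only the diagonal contributes to the covariance of two sums over the coordinates. -/
theorem prodExp_sum_mul_sum (hw : ∀ i, ∑ b, w i b = 1) (φ ψ : ι → α → ℝ)
    (hψ : ∀ i, ∑ b, w i b * ψ i b = 0) :
    prodExp w (fun a => (∑ i, φ i (a i)) * ∑ i, ψ i (a i)) = ∑ i, ∑ b, w i b * (φ i b * ψ i b) := by
  simp only [Finset.sum_mul_sum]
  rw [prodExp_sum]
  refine Finset.sum_congr rfl fun i _ => ?_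
  rw [prodExp_sum, Finset.sum_eq_single i]
  · exact prodExp_coord hw i (fun b => φ i b * ψ i b)
  · intro j _ hj
    rw [prodExp_pair hw hj.symm, hψ, mul_zero]
  · simp

theorem sum_prod_mul_coord_eq_zero (v : ι → α → ℝ) (j : ι) (φ : α → ℝ)
    (h : ∑ b, v j b * φ b = 0) : ∑ a : ι → α, (∏ i, v i (a i)) * φ (a j) = 0 := by
  have h' := prodExp_prod v (fun k b => (if k = j then φ b else 1))
  simp only [Finset.prod_ite_eq', Finset.mem_univ, if_true] at h'
  rw [prodExp] at h'
  rw [h', Finset.prod_eq_zero (Finset.mem_univ j)]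
  simpa using h

/-- Cauchy-Schwarz in linearised form, from E(F - G)² ≥ 0. Each test function `G` whose inner
product with the error `F` is known gives a lower bound for the risk; both quadratic lower bounds
below arise this way. -/
theorem prodExp_cauchy (hw : ∀ i b, 0 ≤ w i b) (F G : (ι → α) → ℝ) :
    2 * prodExp w (fun a => F a * G a) - prodExp w (fun a => G a ^ 2)
      ≤ prodExp w (fun a => F a ^ 2) := by
  have : 0 ≤ prodExp w (fun a => (F a - G a) ^ 2) := prodExp_nonneg hw fun a => sq_nonneg _
  have e : prodExp w (fun a => (F a - G a) ^ 2) =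
      prodExp w (fun a => F a ^ 2) - (2 * prodExp w (fun a => F a * G a)
        - prodExp w (fun a => G a ^ 2)) := by
    rw [← prodExp_const_mul, ← prodExp_sub, ← prodExp_sub]
    congr 1; ext a; ring
  linarith

end prodExp

theorem expect_eq_prodExp {m d n : ℕ} (P : Matrix (Fin m) (Fin d) ℝ) (X : Fin n → Fin d)
    (g : (Fin n → Fin m) → ℝ) : expect P X g = prodExp (fun i o => P o (X i)) g := rfl

end LDPFreq

/-! ### An extremal inequality for the χ²-divergences under local privacy -/

namespace LDPFreq

/-- With l = d/(g+d-1), the zeros l and g l of the quadratic are the ratios of randomized response: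
one coordinate g l and d-1 coordinates l add up to d. If all u x are at least l, every term is
nonpositive. If not, the quadratic is compared with the one whose zeros are the minimum of u and g
times it, which is nonpositive on the range of u. -/
theorem sum_weighted_quadratic_nonpos {d : ℕ} (hd : 1 ≤ d) {g M : ℝ} (hg : 1 ≤ g)
    (hM : 1 ≤ M) (hMg : (M - 1) * (d - 1) * g ≤ (g - 1) * (g - d + 1))
    {u c : Fin d → ℝ} (hu : ∀ x, 0 ≤ u x) (hsum : ∑ x, u x = d) (hug : ∀ x y, u x ≤ g * u y)
    (hc1 : ∀ x, 1 ≤ c x) (hcM : ∀ x, c x ≤ M) :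
    ∑ x, c x * ((u x - g * (d / (g + d - 1))) * (u x - d / (g + d - 1))) ≤ 0 := by
  have hd' : (1 : ℝ) ≤ d := by exact_mod_cast hd
  have hD : 0 < g + d - 1 := by linarith
  have : Nonempty (Fin d) := ⟨⟨0, hd⟩⟩
  obtain ⟨l, hl⟩ : ∃ l, l = (d : ℝ) / (g + d - 1) := ⟨_, rfl⟩
  have hlD : l * (g + d - 1) = d := by rw [hl]; field_simp
  have hl0 : 0 < l := by rw [hl]; positivity
  rw [← hl]
  obtain ⟨x₀, hx₀⟩ := Finite.exists_min u
  rcases le_or_gt l (u x₀) with hcase | hcase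
  · refine Finset.sum_nonpos fun x _ => ?_
    -- Add up u x ≤ g u y over y ≠ x and use that the u y sum to d: no ratio exceeds g l.
    have h1 : u x * (g + d - 1) ≤ g * d := by
      have h2 : ∑ y ∈ Finset.univ.erase x, u x ≤ ∑ y ∈ Finset.univ.erase x, g * u y :=
        Finset.sum_le_sum fun y _ => hug x y
      have h3 : g * u x + ∑ y ∈ Finset.univ.erase x, g * u y = g * d := by
        rw [Finset.add_sum_erase _ (fun y => g * u y) (Finset.mem_univ x), ← Finset.mul_sum, hsum]
      have h4 : ((Finset.univ.erase x).card : ℝ) = d - 1 := by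
        rw [Finset.card_erase_of_mem (Finset.mem_univ x), Finset.card_univ, Fintype.card_fin,
          Nat.cast_sub hd]; simp
      rw [Finset.sum_const, nsmul_eq_mul, h4] at h2
      linarith
    have h5 : u x ≤ g * l := by
      have : u x * (g + d - 1) ≤ (g * l) * (g + d - 1) := by rw [mul_assoc, hlD]; exact h1
      exact le_of_mul_le_mul_right this hD
    have h6 := hx₀ x
    have h7 := hc1 x
    exact mul_nonpos_of_nonneg_of_nonpos (by linarith)
      (mul_nonpos_of_nonpos_of_nonneg (by linarith) (by linarith))
  -- Subtracting (u - u₀)(u - g u₀), where u₀ = u x₀ is the minimum, from (u - g l)(u - l) leaves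
  -- -(l - u₀) z. So it suffices that the weighted sum of z is nonnegative.
  · obtain ⟨z, hz⟩ : ∃ z : Fin d → ℝ, z = fun x => (g + 1) * u x - g * (l + u x₀) := ⟨_, rfl⟩
    have hzs : ∑ x, z x = (g + 1) * d - d * (g * (l + u x₀)) := by
      rw [hz]
      simp [Finset.sum_sub_distrib, ← Finset.mul_sum, hsum]
    have hkey : (d - 1 : ℝ) * (M - 1) * (g * l) ≤ (g + 1) * d - d * (g * (2 * l)) := by
      refine le_of_mul_le_mul_right (a := g + d - 1) ?_ hD
      have e1 : (d - 1 : ℝ) * (M - 1) * (g * l) * (g + d - 1) = ((M - 1) * (d - 1) * g) * d := by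
        linear_combination ((d - 1 : ℝ) * (M - 1) * g) * hlD
      have e2 : ((g + 1) * d - d * (g * (2 * l))) * (g + d - 1) = ((g - 1) * (g - d + 1)) * d := by
        linear_combination (-d * g * 2) * hlD
      rw [e1, e2]
      exact mul_le_mul_of_nonneg_right hMg (by linarith)
    have hzs' : (d - 1 : ℝ) * (M - 1) * (g * l) ≤ ∑ x, z x := by
      rw [hzs]
      have : (d : ℝ) * (g * (l + u x₀)) ≤ d * (g * (2 * l)) := by gcongr; linarith
      linarith
    have hzs0 : 0 ≤ ∑ x, z x :=
      le_trans (mul_nonneg (mul_nonneg (by linarith) (by linarith)) (by positivity)) hzs'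
    obtain ⟨x₁, -, hx₁⟩ := Finset.exists_le_of_sum_le (s := (Finset.univ : Finset (Fin d)))
      (f := fun _ => (0 : ℝ)) (g := z) Finset.univ_nonempty (by simpa using hzs0)
    have hcz : 0 ≤ ∑ x, c x * z x := by
      have h1 : ∑ x, (z x + (M - 1) * min (z x) 0) ≤ ∑ x, c x * z x := by
        refine Finset.sum_le_sum fun x _ => ?_
        have h7 := hc1 x
        have h8 := hcM x
        rcases le_total (z x) 0 with h | h
        · rw [min_eq_left h]; nlinarith
        · rw [min_eq_right h]; nlinarith
      -- Some z x₁ is nonnegative, so at most d-1 entries are negative, each at least -g l. The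
      -- extra weight M-1 on them is paid for by `hkey`, which is the hypothesis on M.
      have h2 : -((d - 1 : ℝ) * (g * l)) ≤ ∑ x, min (z x) 0 := by
        rw [← Finset.add_sum_erase _ _ (Finset.mem_univ x₁), min_eq_right hx₁, zero_add]
        have : ∑ x ∈ Finset.univ.erase x₁, -(g * l) ≤ ∑ x ∈ Finset.univ.erase x₁, min (z x) 0 := by
          refine Finset.sum_le_sum fun x _ => le_min ?_ (by nlinarith)
          rw [hz]
          have := hx₀ x
          have := hu x₀
          simp only
          nlinarith
        refine le_trans (le_of_eq ?_) this
        rw [Finset.sum_const, nsmul_eq_mul, Finset.card_erase_of_mem (Finset.mem_univ x₁),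
          Finset.card_univ, Fintype.card_fin, Nat.cast_sub hd]
        push_cast; ring
      rw [Finset.sum_add_distrib, ← Finset.mul_sum] at h1
      have h3 := mul_le_mul_of_nonneg_left h2 (sub_nonneg.2 hM)
      nlinarith
    have h2 : ∑ x, c x * ((u x - g * l) * (u x - l)) ≤ ∑ x, -((l - u x₀) * (c x * z x)) := by
      refine Finset.sum_le_sum fun x _ => ?_
      have h4 : (u x - g * l) * (u x - l) ≤ -((l - u x₀) * z x) := by
        have := mul_nonneg (sub_nonneg.2 (hx₀ x)) (sub_nonneg.2 (hug x x₀))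
        rw [hz]
        simp only
        nlinarith
      have := mul_le_mul_of_nonneg_left h4 (le_trans zero_le_one (hc1 x))
      linarith
    refine h2.trans ?_
    rw [Finset.sum_neg_distrib, ← Finset.mul_sum]
    have := mul_nonneg (sub_nonneg.2 hcase.le) hcz
    linarith

/-- The law of the response to a uniformly distributed input. -/
noncomputable def avgResp {m d : ℕ} (P : Matrix (Fin m) (Fin d) ℝ) (o : Fin m) : ℝ :=
  (∑ x, P o x) / d

/-- The `χ²`-divergence of the response to `x` from the response to a uniform input. -/
noncomputable def chiSq {m d : ℕ} (P : Matrix (Fin m) (Fin d) ℝ) (x : Fin d) : ℝ :=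
  ∑ o, P o x ^ 2 / avgResp P o - 1

/-- The common `χ²`-divergence `(d-1) ((g-1)/(g+d-1))²` of the `g`-ary randomized response. -/
noncomputable def chiOpt (d : ℕ) (g : ℝ) : ℝ := (d - 1) * ((g - 1) / (g + d - 1)) ^ 2

section
variable {m d : ℕ} {P : Matrix (Fin m) (Fin d) ℝ}

theorem avgResp_nonneg (hP : IsMechanism P) (o : Fin m) : 0 ≤ avgResp P o :=
  div_nonneg (Finset.sum_nonneg fun x _ => hP.1 o x) (Nat.cast_nonneg d)

theorem le_mul_avgResp (hd : 1 ≤ d) (hP : IsMechanism P) (o : Fin m) (x : Fin d) :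
    P o x ≤ d * avgResp P o := by
  have : (d : ℝ) ≠ 0 := by positivity
  rw [avgResp, mul_div_cancel₀ _ this]
  exact Finset.single_le_sum (f := fun x => P o x) (fun y _ => hP.1 o y) (Finset.mem_univ x)

theorem eq_zero_of_avgResp_eq_zero (hd : 1 ≤ d) (hP : IsMechanism P) {o : Fin m}
    (h : avgResp P o = 0) (x : Fin d) : P o x = 0 :=
  le_antisymm (by simpa [h] using le_mul_avgResp hd hP o x) (hP.1 o x)

theorem sum_avgResp (hd : 1 ≤ d) (hP : IsMechanism P) : ∑ o, avgResp P o = 1 := by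
  have : (d : ℝ) ≠ 0 := by positivity
  simp only [avgResp, ← Finset.sum_div]
  rw [show ∑ o, ∑ x, P o x = ∑ x, ∑ o, P o x from Finset.sum_comm]
  simp [hP.2, this]

theorem chiSq_eq (hd : 1 ≤ d) (hP : IsMechanism P) (x : Fin d) :
    chiSq P x = ∑ o, (P o x - avgResp P o) ^ 2 / avgResp P o := by
  have : ∀ o, (P o x - avgResp P o) ^ 2 / avgResp P o
      = P o x ^ 2 / avgResp P o - 2 * P o x + avgResp P o := fun o => by
    by_cases h : avgResp P o = 0
    · simp [h, eq_zero_of_avgResp_eq_zero hd hP h]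
    · field_simp; ring
  simp only [this, chiSq, Finset.sum_add_distrib, Finset.sum_sub_distrib, ← Finset.mul_sum,
    sum_avgResp hd hP, hP.2]
  ring

theorem chiSq_nonneg (hd : 1 ≤ d) (hP : IsMechanism P) (x : Fin d) : 0 ≤ chiSq P x := by
  rw [chiSq_eq hd hP]
  exact Finset.sum_nonneg fun o _ => div_nonneg (sq_nonneg _) (avgResp_nonneg hP o)

theorem chiSq_le (hd : 1 ≤ d) (hP : IsMechanism P) (x : Fin d) : chiSq P x ≤ d - 1 := by
  have : ∑ o, P o x ^ 2 / avgResp P o ≤ ∑ o, d * P o x := Finset.sum_le_sum fun o _ => by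
    by_cases h : avgResp P o = 0
    · simp [h, eq_zero_of_avgResp_eq_zero hd hP h]
    · have h0 := lt_of_le_of_ne (avgResp_nonneg hP o) (Ne.symm h)
      rw [div_le_iff₀ h0]
      have := mul_le_mul_of_nonneg_right (le_mul_avgResp hd hP o x) (hP.1 o x)
      nlinarith
  rw [← Finset.mul_sum, hP.2] at this
  rw [chiSq]
  linarith

/-- For an `ε`-LDP mechanism no weighted sum of the divergences, with weights between `1` and `M`,
exceeds the value of the `e^ε`-ary randomized response. -/
theorem sum_weighted_chiSq_le (hd : 1 ≤ d) {ε M : ℝ} (hε : 0 < ε)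
    (hM : 1 ≤ M) (hMg : (M - 1) * (d - 1) * Real.exp ε ≤ (Real.exp ε - 1) * (Real.exp ε - d + 1))
    (hP : IsMechanism P) (hL : IsLDP ε P) {c : Fin d → ℝ} (hc1 : ∀ x, 1 ≤ c x)
    (hcM : ∀ x, c x ≤ M) :
    ∑ x, c x * (chiSq P x - chiOpt d (Real.exp ε)) ≤ 0 := by
  obtain ⟨g, hg⟩ : ∃ g, g = Real.exp ε := ⟨_, rfl⟩
  have hg1 : 1 < g := by rw [hg]; exact Real.one_lt_exp_iff.2 hε
  rw [IsLDP, ← hg] at hL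
  rw [← hg] at hMg ⊢
  have hd' : (1 : ℝ) ≤ d := by exact_mod_cast hd
  have hD : 0 < g + d - 1 := by linarith
  obtain ⟨l, hl⟩ : ∃ l, l = (d : ℝ) / (g + d - 1) := ⟨_, rfl⟩
  have hopt : chiOpt d g = g * l + l - g * l * l - 1 := by
    rw [hl, chiOpt]; field_simp; ring
  -- This is `avgResp P o` times the quadratic inequality for the ratios P o x / `avgResp P o`.
  -- Summed over o it becomes an inequality between χ²-divergences, since the linear terms have
  -- total mass 1.
  have hrow : ∀ o, ∑ x, c x * (P o x ^ 2 / avgResp P o - (g * l + l) * P o x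
      + g * l * l * avgResp P o) ≤ 0 := fun o => by
    by_cases h : avgResp P o = 0
    · simp [h, eq_zero_of_avgResp_eq_zero hd hP h]
    have h0 := lt_of_le_of_ne (avgResp_nonneg hP o) (Ne.symm h)
    have := sum_weighted_quadratic_nonpos hd hg1.le hM hMg
      (u := fun x => P o x / avgResp P o) (fun x => div_nonneg (hP.1 o x) h0.le)
      (by
        rw [← Finset.sum_div, div_eq_iff h, avgResp]
        field_simp)
      (fun x y => by
        rw [← mul_div_assoc]
        exact div_le_div_of_nonneg_right (hL o x y) h0.le) hc1 hcM
    rw [← hl] at this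
    have h2 := mul_nonpos_of_nonneg_of_nonpos h0.le this
    rw [Finset.mul_sum] at h2
    refine le_trans (le_of_eq (Finset.sum_congr rfl fun x _ => ?_)) h2
    field_simp
    ring
  have hsum := Finset.sum_nonpos fun o (_ : o ∈ Finset.univ) => hrow o
  rw [Finset.sum_comm] at hsum
  refine le_trans (le_of_eq (Finset.sum_congr rfl fun x _ => ?_)) hsum
  rw [← Finset.mul_sum, Finset.sum_add_distrib, Finset.sum_sub_distrib, ← Finset.mul_sum,
    ← Finset.mul_sum, sum_avgResp hd hP, hP.2, hopt, chiSq]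
  ring

end
end LDPFreq

/-! ### Random datasets and the quadratic error of one coordinate -/

namespace LDPFreq

section joint
variable {ι α β : Type*} [Fintype ι] [DecidableEq ι] [Fintype α] [Fintype β]

theorem sum_arrow_prod (F : (ι → α) → (ι → β) → ℝ) :
    ∑ z : ι → α × β, F (fun i => (z i).1) (fun i => (z i).2) = ∑ a, ∑ b, F a b := by
  rw [← Fintype.sum_prod_type']
  exact Fintype.sum_equiv (Equiv.arrowProdEquivProdArrow ι (fun _ => α) (fun _ => β)) _ _
    fun z => rfl

theorem prodExp_joint (p : ι → α → ℝ) (Q : ι → α → β → ℝ) (F : (ι → α) → (ι → β) → ℝ) :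
    prodExp (fun i (z : α × β) => p i z.1 * Q i z.1 z.2)
        (fun z => F (fun i => (z i).1) (fun i => (z i).2))
      = prodExp p (fun a => prodExp (fun i => Q i (a i)) (F a)) := by
  have := sum_arrow_prod (fun (a : ι → α) (b : ι → β) => (∏ i, p i (a i) * Q i (a i) (b i)) * F a b)
  rw [prodExp, this]
  simp only [prodExp, Finset.mul_sum, Finset.prod_mul_distrib]
  exact Finset.sum_congr rfl fun a _ => Finset.sum_congr rfl fun b _ => by ring

/-- A sum of terms with conditional mean zero given the second components is orthogonal to all
functions of the second components. -/
theorem prodExp_mul_sum_eq_zero (w : α × β → ℝ) (φ : α × β → ℝ)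
    (h : ∀ b, ∑ a, w (a, b) * φ (a, b) = 0) (H : (ι → β) → ℝ) :
    prodExp (fun _ => w) (fun z => H (fun i => (z i).2) * ∑ i, φ (z i)) = 0 := by
  have := sum_arrow_prod (fun (a : ι → α) (b : ι → β) =>
    (∏ i, w (a i, b i)) * (H b * ∑ i, φ (a i, b i)))
  rw [prodExp, this, Finset.sum_comm]
  refine Finset.sum_eq_zero fun b _ => ?_
  have e : ∀ a : ι → α, (∏ i, w (a i, b i)) * (H b * ∑ i, φ (a i, b i))
      = H b * ∑ j, (∏ i, w (a i, b i)) * φ (a j, b j) := fun a => by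
    rw [← Finset.mul_sum]; ring
  simp only [e]
  rw [← Finset.mul_sum, Finset.sum_comm, Finset.sum_eq_zero, mul_zero]
  intro j _
  exact sum_prod_mul_coord_eq_zero (fun i a => w (a, b i)) j (fun a => φ (a, b j)) (h (b j))

end joint

section single
variable {m d : ℕ}

/-- The law of the response to an input with law `p`. -/
noncomputable def respLaw (p : Fin d → ℝ) (P : Matrix (Fin m) (Fin d) ℝ) (o : Fin m) : ℝ :=
  ∑ y, p y * P o y

theorem sum_joint_snd (p : Fin d → ℝ) (P : Matrix (Fin m) (Fin d) ℝ) (v : Fin m → ℝ) :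
    ∑ z : Fin d × Fin m, p z.1 * P z.2 z.1 * v z.2 = ∑ o, respLaw p P o * v o := by
  rw [Fintype.sum_prod_type, Finset.sum_comm]
  simp only [respLaw, Finset.sum_mul]

theorem sum_joint_ite (p : Fin d → ℝ) (P : Matrix (Fin m) (Fin d) ℝ) (x : Fin d) (v : Fin m → ℝ) :
    ∑ z : Fin d × Fin m, p z.1 * P z.2 z.1 * ((if z.1 = x then 1 else 0) * v z.2)
      = p x * ∑ o, P o x * v o := by
  rw [Fintype.sum_prod_type, Finset.sum_eq_single x]
  · simp only [if_true, one_mul, Finset.mul_sum, mul_assoc]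
  · intro y _ hy
    simp [hy]
  · simp

theorem sum_joint_one {p : Fin d → ℝ} (hp : ∑ y, p y = 1) {P : Matrix (Fin m) (Fin d) ℝ}
    (hP : IsMechanism P) : ∑ z : Fin d × Fin m, p z.1 * P z.2 z.1 = 1 := by
  rw [Fintype.sum_prod_type]
  simp [← Finset.mul_sum, hP.2, hp]

theorem respLaw_uniform (P : Matrix (Fin m) (Fin d) ℝ) (o : Fin m) :
    respLaw (fun _ => 1 / (d : ℝ)) P o = avgResp P o := by
  rw [respLaw, ← Finset.mul_sum, avgResp]; ring

theorem freq_eq {n k : ℕ} (v : Fin n → Fin k) (a : Fin k) :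
    freq v a = 1 / n * ∑ i, if v i = a then (1 : ℝ) else 0 := by
  rw [freq]; ring

/-- The optimal error of unbiased estimation of one coordinate, in terms of the divergence `b`:
`n` times the squared error, averaged over uniform datasets, is at least
`2 α (1 - 1/d) - α² b - (1 - 1/d) / d` for each `α`. -/
theorem le_avg_sq_error (hd : 1 ≤ d) {P : Matrix (Fin m) (Fin d) ℝ} (hP : IsMechanism P) {n : ℕ}
    (hn : 1 ≤ n) {fhat : Estimator m d} (hf : IsUnbiased P fhat n) (x : Fin d) (α : ℝ) :
    (2 * α * (1 - 1 / d) - α ^ 2 * chiSq P x - (1 - 1 / d) / d) / n ≤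
      prodExp (fun (_ : Fin n) (_ : Fin d) => 1 / (d : ℝ))
        (fun X => expect P X (fun o => (fhat (freq o) x - freq X x) ^ 2)) := by
  have hd0 : (d : ℝ) ≠ 0 := by positivity
  have hn0 : (n : ℝ) ≠ 0 := by positivity
  obtain ⟨w, hw⟩ : ∃ w : Fin d × Fin m → ℝ, w = fun z => 1 / (d : ℝ) * P z.2 z.1 := ⟨_, rfl⟩
  -- The likelihood ratio of the input x; for a uniform input it is d times the posterior
  -- probability of x.
  obtain ⟨u, hu⟩ : ∃ u : Fin m → ℝ, u = fun o => P o x / avgResp P o := ⟨_, rfl⟩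
  have hau : ∀ o, avgResp P o * u o = P o x := fun o => by
    by_cases h : avgResp P o = 0
    · simp [h, eq_zero_of_avgResp_eq_zero hd hP h]
    · rw [hu]; field_simp
  obtain ⟨δ, hδ⟩ : ∃ δ : Fin d → ℝ, δ = fun y => if y = x then 1 else 0 := ⟨_, rfl⟩
  have hws : ∑ z, w z = 1 := by
    rw [hw]
    exact sum_joint_one (p := fun _ => 1 / (d : ℝ)) (by simp [hd0]) hP
  have hwn : ∀ z, 0 ≤ w z := fun z => by rw [hw]; have := hP.1 z.2 z.1; positivity
  have S1 : ∀ v : Fin m → ℝ, ∑ z, w z * v z.2 = ∑ o, avgResp P o * v o := fun v => by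
    have := sum_joint_snd (fun _ => 1 / (d : ℝ)) P v
    simp only [respLaw_uniform] at this
    rw [hw, ← this]
  have S2 : ∀ v : Fin m → ℝ, ∑ z, w z * (δ z.1 * v z.2) = 1 / d * ∑ o, P o x * v o := fun v => by
    rw [hw, hδ]
    exact sum_joint_ite (fun _ => 1 / (d : ℝ)) P x v
  have hA : ∑ o, P o x * u o = chiSq P x + 1 := by
    rw [chiSq, hu, sub_add_cancel]
    exact Finset.sum_congr rfl fun o _ => by ring
  have E1 : ∑ z, w z * δ z.1 = 1 / d := by
    have := S2 (fun _ => 1); simpa [hP.2] using this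
  have Eu : ∑ z, w z * u z.2 = 1 := by
    rw [S1]; simp [hau, hP.2]
  have Eu2 : ∑ z, w z * u z.2 ^ 2 = chiSq P x + 1 := by
    rw [S1 (fun o => u o ^ 2), ← hA]
    exact Finset.sum_congr rfl fun o _ => by rw [← hau o]; ring
  have E1u : ∑ z, w z * (δ z.1 * u z.2) = 1 / d * (chiSq P x + 1) := by rw [S2, hA]
  have hδδ : ∀ y, δ y * δ y = δ y := fun y => by rw [hδ]; simp
  -- The test function is the error of the estimator averaging 1/d + α(u - 1) over the responses. Up
  -- to a function of the input alone it equals -ψ, and ψ has conditional mean zero given the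
  -- response.
  obtain ⟨χ, hχ⟩ : ∃ χ : Fin d × Fin m → ℝ, χ = fun z => 1 / d + α * (u z.2 - 1) - δ z.1 := ⟨_, rfl⟩
  obtain ⟨ψ, hψ⟩ : ∃ ψ : Fin d × Fin m → ℝ, ψ = fun z => α * (d * δ z.1 - u z.2) := ⟨_, rfl⟩
  have hχ0 : ∑ z, w z * χ z = 0 := by
    have : ∀ z, w z * χ z = (1 / d - α) * w z + α * (w z * u z.2) - w z * δ z.1 := fun z => by
      rw [hχ]; ring
    simp only [this, Finset.sum_sub_distrib, Finset.sum_add_distrib, ← Finset.mul_sum, hws, Eu, E1]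
    ring
  have hχ2 : ∑ z, w z * (χ z * χ z) = α ^ 2 * chiSq P x - 2 * α * chiSq P x / d + (1 - 1 / d) / d := by
    have : ∀ z, w z * (χ z * χ z) = (1 / d - α) ^ 2 * w z + α ^ 2 * (w z * u z.2 ^ 2)
        + (w z * δ z.1) + 2 * α * (1 / d - α) * (w z * u z.2) - 2 * (1 / d - α) * (w z * δ z.1)
        - 2 * α * (w z * (δ z.1 * u z.2)) := fun z => by
      rw [hχ]; linear_combination w z * hδδ z.1
    simp only [this, Finset.sum_sub_distrib, Finset.sum_add_distrib, ← Finset.mul_sum, hws, Eu, E1,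
      E1u, Eu2]
    field_simp
    ring
  have hψ0 : ∑ z, w z * ψ z = 0 := by
    have : ∀ z, w z * ψ z = (α * d) * (w z * δ z.1) - α * (w z * u z.2) := fun z => by
      rw [hψ]; ring
    simp only [this, Finset.sum_sub_distrib, ← Finset.mul_sum, Eu, E1]
    field_simp
    ring
  have hδψ : ∑ z, w z * (δ z.1 * ψ z) = α * (1 - 1 / d - chiSq P x / d) := by
    have : ∀ z, w z * (δ z.1 * ψ z) = (α * d) * (w z * δ z.1) - α * (w z * (δ z.1 * u z.2)) :=
      fun z => by rw [hψ]; linear_combination w z * α * d * hδδ z.1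
    simp only [this, Finset.sum_sub_distrib, ← Finset.mul_sum, E1u, E1]
    field_simp
    ring
  have horth := prodExp_mul_sum_eq_zero (ι := Fin n) w ψ (fun o => by
    have : ∀ y, w (y, o) * ψ (y, o)
        = α * (P o y * δ y) - α * u o * ((1 / d) * P o y) := fun y => by
      rw [hψ, hw]; field_simp
    simp only [this, Finset.sum_sub_distrib, ← Finset.mul_sum]
    rw [show 1 / (d : ℝ) * ∑ y, P o y = avgResp P o by rw [avgResp]; ring, mul_assoc,
      mul_comm (u o), hau, hδ]
    simp) (fun o => fhat (freq o) x)
  -- unbiasedness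
  have hunb : ∀ q : (Fin n → Fin d) → ℝ,
      prodExp (fun (_ : Fin n) => w)
        (fun z => (fhat (freq fun i => (z i).2) x - freq (fun i => (z i).1) x)
          * q (fun i => (z i).1)) = 0 := fun q => by
    rw [hw]
    refine (prodExp_joint (fun (_ : Fin n) (_ : Fin d) => 1 / (d : ℝ)) (fun _ y o => P o y)
      (fun X o => (fhat (freq o) x - freq X x) * q X)).trans ?_
    rw [prodExp]
    refine Finset.sum_eq_zero fun X _ => ?_
    have h1 := hf X x
    rw [expect_eq_prodExp] at h1
    have h2 : prodExp (fun i o => P o (X i)) (fun o => (fhat (freq o) x - freq X x) * q X) = 0 := by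
      have : (fun o : Fin n → Fin m => (fhat (freq o) x - freq X x) * q X)
          = fun o => q X * (fhat (freq o) x - freq X x) := by ext o; ring
      rw [this, prodExp_const_mul, prodExp_sub, prodExp_const (fun i => hP.2 (X i)), h1, sub_self,
        mul_zero]
    rw [h2, mul_zero]
  have hrisk : prodExp (fun (_ : Fin n) (_ : Fin d) => 1 / (d : ℝ))
        (fun X => expect P X (fun o => (fhat (freq o) x - freq X x) ^ 2))
      = prodExp (fun (_ : Fin n) => w)
        (fun z => (fhat (freq fun i => (z i).2) x - freq (fun i => (z i).1) x) ^ 2) := by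
    rw [hw]
    exact (prodExp_joint (fun (_ : Fin n) (_ : Fin d) => 1 / (d : ℝ)) (fun _ y o => P o y)
      (fun X o => (fhat (freq o) x - freq X x) ^ 2)).symm
  rw [hrisk]
  have hcs := prodExp_cauchy (w := fun (_ : Fin n) => w) (fun _ z => hwn z)
    (fun z => fhat (freq fun i => (z i).2) x - freq (fun i => (z i).1) x)
    (fun z => 1 / n * ∑ i, χ (z i))
  have hy2 : prodExp (fun (_ : Fin n) => w) (fun z => (1 / n * ∑ i, χ (z i)) ^ 2)
      = (α ^ 2 * chiSq P x - 2 * α * chiSq P x / d + (1 - 1 / d) / d) / n := by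
    have : ∀ z : Fin n → Fin d × Fin m, (1 / n * ∑ i, χ (z i)) ^ 2
        = (1 / n : ℝ) ^ 2 * ((∑ i, χ (z i)) * ∑ i, χ (z i)) := fun z => by ring
    simp only [this]
    rw [prodExp_const_mul, prodExp_sum_mul_sum (fun _ => hws) (fun _ => χ) (fun _ => χ)
      (fun _ => hχ0), hχ2]
    simp
    field_simp
  have hcross : prodExp (fun (_ : Fin n) => w)
      (fun z => (fhat (freq fun i => (z i).2) x - freq (fun i => (z i).1) x)
        * (1 / n * ∑ i, χ (z i))) = α * (1 - 1 / d - chiSq P x / d) / n := by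
    -- In the product of the error with the test function, the part depending on the dataset alone
    -- vanishes by unbiasedness, and `fhat` times the sum of ψ vanishes by conditioning on the
    -- responses. What survives is the covariance of the true frequency with ψ, free of `fhat`.
    have : ∀ z : Fin n → Fin d × Fin m,
        (fhat (freq fun i => (z i).2) x - freq (fun i => (z i).1) x) * (1 / n * ∑ i, χ (z i))
        = ((fhat (freq fun i => (z i).2) x - freq (fun i => (z i).1) x)
            * (1 / n * ∑ i, (1 / d - α + (α * d - 1) * δ (z i).1))
          - (1 / n) * (fhat (freq fun i => (z i).2) x * ∑ i, ψ (z i)))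
          + (1 / n : ℝ) ^ 2 * ((∑ i, δ (z i).1) * ∑ i, ψ (z i)) := fun z => by
      have e1 : ∑ i, χ (z i) = ∑ i, (1 / d - α + (α * d - 1) * δ (z i).1) - ∑ i, ψ (z i) := by
        rw [← Finset.sum_sub_distrib]
        refine Finset.sum_congr rfl fun i _ => ?_
        rw [hχ, hψ]; ring
      have e2 : freq (fun i => (z i).1) x = 1 / n * ∑ i, δ (z i).1 := by rw [freq_eq, hδ]
      rw [e1, e2]; ring
    simp only [this]
    rw [prodExp_add, prodExp_sub, hunb (fun X => 1 / n * ∑ i, (1 / d - α + (α * d - 1) * δ (X i))),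
      prodExp_const_mul, horth, prodExp_const_mul,
      prodExp_sum_mul_sum (fun _ => hws) (fun _ z => δ z.1) (fun _ => ψ) (fun _ => hψ0), hδψ]
    simp
    field_simp
  rw [hcross, hy2] at hcs
  refine le_trans (le_of_eq ?_) hcs
  field_simp
  ring

end single
end LDPFreq

/-! ### The lower bound for the L₂ loss -/

namespace LDPFreq

theorem prodExp_le_ciSup {ι α : Type*} [Fintype ι] [DecidableEq ι] [Fintype α] {w : ι → α → ℝ}
    (hw0 : ∀ i b, 0 ≤ w i b) (hw : ∀ i, ∑ b, w i b = 1) (F : (ι → α) → ℝ) :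
    prodExp w F ≤ ⨆ a, F a := by
  have := prodExp_mono hw0 (F := F) (G := fun _ => ⨆ a, F a)
    (fun a => le_ciSup (Set.finite_range F).bddAbove a)
  rwa [prodExp_const hw] at this

theorem expect_sum {m d n : ℕ} (P : Matrix (Fin m) (Fin d) ℝ) (X : Fin n → Fin d)
    (F : Fin d → (Fin n → Fin m) → ℝ) :
    expect P X (fun o => ∑ x, F x o) = ∑ x, expect P X (F x) :=
  prodExp_sum (fun i o => P o (X i)) Finset.univ F

theorem optL2_eq {d : ℕ} (hd : 2 ≤ d) {ε : ℝ} (hε : 0 < ε) (n : ℕ) :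
    optL2 d ε n = d * ((1 - 1 / d) ^ 2 / chiOpt d (Real.exp ε) - (1 - 1 / d) / d) / n := by
  have hg : 1 < Real.exp ε := Real.one_lt_exp_iff.2 hε
  have hd' : (2 : ℝ) ≤ d := by exact_mod_cast hd
  have h1 : Real.exp ε - 1 ≠ 0 := by linarith
  have h2 : Real.exp ε + d - 1 ≠ 0 := by linarith
  have h3 : (d : ℝ) - 1 ≠ 0 := by linarith
  have h4 : (d : ℝ) ≠ 0 := by linarith
  rw [optL2, chiOpt, div_mul_eq_div_div_swap]
  congr 1
  field_simp
  ring

theorem chiOpt_pos {d : ℕ} (hd : 2 ≤ d) {ε : ℝ} (hε : 0 < ε) : 0 < chiOpt d (Real.exp ε) := by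
  have hg : 1 < Real.exp ε := Real.one_lt_exp_iff.2 hε
  have hd' : (2 : ℝ) ≤ d := by exact_mod_cast hd
  have h1 : 0 < Real.exp ε - 1 := by linarith
  have h2 : 0 < Real.exp ε + d - 1 := by linarith
  have h3 : 0 < (d : ℝ) - 1 := by linarith
  rw [chiOpt]; positivity

theorem expect_nonneg {m d n : ℕ} {P : Matrix (Fin m) (Fin d) ℝ} (hP : IsMechanism P)
    (X : Fin n → Fin d) {F : (Fin n → Fin m) → ℝ} (hF : ∀ o, 0 ≤ F o) : 0 ≤ expect P X F :=
  prodExp_nonneg (fun i o => hP.1 o (X i)) hF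

theorem optL2_le_L2loss {d : ℕ} (hd : 1 ≤ d) {ε : ℝ} (hε : 0 < ε)
    (hdε : (d : ℝ) ≤ Real.exp ε + 1) {m : ℕ} {P : Matrix (Fin m) (Fin d) ℝ} (hP : IsMechanism P)
    (hL : IsLDP ε P) {n : ℕ} (hn : 1 ≤ n) {fhat : Estimator m d} (hf : IsUnbiased P fhat n) :
    optL2 d ε n ≤ L2loss P fhat n := by
  rcases Nat.lt_or_ge d 2 with hd2 | hd2
  · obtain rfl : d = 1 := by omega
    rw [optL2]
    simp only [Nat.cast_one, sub_self, zero_mul, zero_div]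
    exact Real.iSup_nonneg fun X =>
      expect_nonneg hP X fun o => Finset.sum_nonneg fun x _ => sq_nonneg _
  have hg : 1 < Real.exp ε := Real.one_lt_exp_iff.2 hε
  have hd0 : (0 : ℝ) < d := by positivity
  have hn0 : (0 : ℝ) < n := by positivity
  have hb0 := chiOpt_pos hd2 hε
  have havg : prodExp (fun (_ : Fin n) (_ : Fin d) => 1 / (d : ℝ))
      (fun X => expect P X (fun o => ∑ x, (fhat (freq o) x - freq X x) ^ 2)) ≤ L2loss P fhat n :=
    prodExp_le_ciSup (fun _ _ => by positivity) (fun _ => by simp [hd0.ne']) _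
  refine le_trans ?_ havg
  simp only [expect_sum]
  rw [prodExp_sum, optL2_eq hd2 hε]
  -- The optimal α for a coordinate with divergence `chiOpt`. Using it for every x keeps the bound
  -- affine in the divergences, so that their sum suffices; the case M = 1 of the constraint bounds
  -- that sum.
  obtain ⟨α, hα⟩ : ∃ α, α = (1 - 1 / (d : ℝ)) / chiOpt d (Real.exp ε) := ⟨_, rfl⟩
  refine le_trans ?_ (Finset.sum_le_sum fun x _ => le_avg_sq_error hd hP hn hf x α)
  rw [← Finset.sum_div]
  refine div_le_div_of_nonneg_right ?_ hn0.le
  have hs := sum_weighted_chiSq_le hd hε le_rfl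
    (by rw [sub_self, zero_mul, zero_mul]; exact mul_nonneg (by linarith) (by linarith)) hP hL
    (c := fun _ => 1) (fun _ => le_rfl) (fun _ => le_rfl)
  simp only [one_mul, Finset.sum_sub_distrib, Finset.sum_const, Finset.card_univ, Fintype.card_fin,
    nsmul_eq_mul] at hs
  simp only [Finset.sum_sub_distrib, Finset.sum_const, Finset.card_univ, Fintype.card_fin,
    nsmul_eq_mul, ← Finset.mul_sum]
  have h1 : α ^ 2 * ∑ x, chiSq P x ≤ α ^ 2 * (d * chiOpt d (Real.exp ε)) :=
    mul_le_mul_of_nonneg_left (by linarith) (sq_nonneg α)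
  have h2 : (1 - 1 / (d : ℝ)) ^ 2 / chiOpt d (Real.exp ε)
      = 2 * α * (1 - 1 / d) - α ^ 2 * chiOpt d (Real.exp ε) := by
    rw [hα]; field_simp; ring
  rw [h2]
  linarith

/-! ### Optimal symmetric configurations -/

section osc
variable {m d : ℕ} {P : Matrix (Fin m) (Fin d) ℝ} {p : Fin m → ℝ} {ps qs ε : ℝ} {k : ℕ}

theorem IsOSC.sum_row (h : IsOSC ε P p ps qs k) (o : Fin m) :
    ∑ x, P o x = p o * (k * Real.exp ε + d - k) := by
  have : ∀ x, P o x = p o + (if x ∈ supp ε P p o then (Real.exp ε - 1) * p o else 0) := fun x => by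
    split_ifs with hx
    · rw [(Finset.mem_filter.1 hx).2]; ring
    · rcases h.extremal o x with h1 | h1
      · rw [h1, add_zero]
      · exact absurd (Finset.mem_filter.2 ⟨Finset.mem_univ x, h1⟩) hx
  simp only [this]
  rw [Finset.sum_add_distrib, ← Finset.sum_filter]
  simp only [Finset.sum_const, Finset.filter_univ_mem, h.card_supp, Finset.card_univ,
    Fintype.card_fin, nsmul_eq_mul]
  ring

theorem IsOSC.sum_base (h : IsOSC ε P p ps qs k) : (∑ o, p o) * (k * Real.exp ε + d - k) = d := by
  rw [Finset.sum_mul]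
  simp only [← h.sum_row]
  rw [show ∑ o, ∑ x, P o x = ∑ x, ∑ o, P o x from Finset.sum_comm]
  simp [h.mechanism.2]

/-- Sum the defining identity of p* over x and exchange the summations: each response contributes k
e^ε p_o, and the total base mass is fixed by the column sums. The value of q* comes from the same
count over ordered pairs. -/
theorem IsOSC.ps_mul (h : IsOSC ε P p ps qs k) (hd : 1 ≤ d) :
    ps * (k * Real.exp ε + d - k) = k * Real.exp ε := by
  have hd0 : (d : ℝ) ≠ 0 := by positivity
  have h1 : (d : ℝ) * ps = k * Real.exp ε * ∑ o, p o := by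
    calc (d : ℝ) * ps = ∑ x : Fin d, ps := by simp
      _ = ∑ x, ∑ o, if x ∈ supp ε P p o then P o x else 0 :=
        Finset.sum_congr rfl fun x _ => (h.symmetric.1 x).symm
      _ = ∑ o, ∑ x, if x ∈ supp ε P p o then P o x else 0 := Finset.sum_comm
      _ = ∑ o, k * Real.exp ε * p o := Finset.sum_congr rfl fun o _ => by
        have : ∑ x ∈ supp ε P p o, P o x = ∑ x ∈ supp ε P p o, Real.exp ε * p o :=
          Finset.sum_congr rfl fun x hx => (Finset.mem_filter.1 hx).2
        rw [← Finset.sum_filter, Finset.filter_univ_mem, this]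
        simp [h.card_supp]; ring
      _ = _ := by rw [Finset.mul_sum]
  have h2 := h.sum_base
  refine mul_left_cancel₀ hd0 ?_
  linear_combination (k * Real.exp ε + d - k) * h1 + k * Real.exp ε * h2

theorem IsOSC.qs_mul (h : IsOSC ε P p ps qs k) (hd : 1 ≤ d) :
    (d - 1) * (qs * (k * Real.exp ε + d - k))
      = k * ((k * Real.exp ε + d - k) - Real.exp ε) := by
  have hd0 : (d : ℝ) ≠ 0 := by positivity
  have h1 : (d : ℝ) * ((d - 1) * qs)
      = k * ((k * Real.exp ε + d - k) - Real.exp ε) * ∑ o, p o := by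
    calc (d : ℝ) * ((d - 1) * qs)
        = ∑ x : Fin d, ∑ x' ∈ Finset.univ.erase x, qs := by
          simp [Finset.card_erase_of_mem, Nat.cast_sub hd]
      _ = ∑ x, ∑ x' ∈ Finset.univ.erase x, ∑ o, if x ∈ supp ε P p o then P o x' else 0 :=
        Finset.sum_congr rfl fun x _ => Finset.sum_congr rfl fun x' hx' =>
          (h.symmetric.2 x x' (Finset.ne_of_mem_erase hx').symm).symm
      _ = ∑ x, ∑ o, ∑ x' ∈ Finset.univ.erase x, if x ∈ supp ε P p o then P o x' else 0 :=
        Finset.sum_congr rfl fun x _ => Finset.sum_comm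
      _ = ∑ o, ∑ x, ∑ x' ∈ Finset.univ.erase x, if x ∈ supp ε P p o then P o x' else 0 :=
        Finset.sum_comm
      _ = ∑ o, k * ((k * Real.exp ε + d - k) - Real.exp ε) * p o :=
        Finset.sum_congr rfl fun o _ => by
          have : ∀ x, (∑ x' ∈ Finset.univ.erase x, if x ∈ supp ε P p o then P o x' else 0)
              = if x ∈ supp ε P p o then ((k * Real.exp ε + d - k) - Real.exp ε) * p o else 0 := by
            intro x
            split_ifs with hx
            · have := Finset.add_sum_erase Finset.univ (fun y => P o y) (Finset.mem_univ x)
              rw [h.sum_row, (Finset.mem_filter.1 hx).2] at this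
              linarith
            · simp
          simp only [this]
          rw [← Finset.sum_filter, Finset.filter_univ_mem]
          simp [h.card_supp]; ring
      _ = _ := by rw [Finset.mul_sum]
  have h2 := h.sum_base
  refine mul_left_cancel₀ hd0 ?_
  linear_combination (k * Real.exp ε + d - k) * h1
    + k * ((k * Real.exp ε + d - k) - Real.exp ε) * h2

/-- The error that a single response contributes to the estimate of the frequency of `x`. -/
noncomputable def symErr (ε : ℝ) (P : Matrix (Fin m) (Fin d) ℝ) (p : Fin m → ℝ) (ps qs : ℝ)
    (x y : Fin d) (o : Fin m) : ℝ :=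
  ((if x ∈ supp ε P p o then 1 else 0) - qs) / (ps - qs) - if y = x then 1 else 0

theorem symEstimator_sub_freq {n : ℕ} (hn : 1 ≤ n) (X : Fin n → Fin d) (o : Fin n → Fin m)
    (x : Fin d) : symEstimator ε P p ps qs (freq o) x - freq X x
      = 1 / n * ∑ i, symErr ε P p ps qs x (X i) (o i) := by
  have hn0 : (n : ℝ) ≠ 0 := by positivity
  have h1 : (∑ o', if x ∈ supp ε P p o' then freq o o' else 0)
      = 1 / n * ∑ i, if x ∈ supp ε P p (o i) then (1 : ℝ) else 0 := by
    simp only [freq_eq]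
    have : ∀ o', (if x ∈ supp ε P p o' then (1 / n : ℝ) * ∑ i, (if o i = o' then (1 : ℝ) else 0)
        else 0)
        = ∑ i, 1 / n * (if o i = o' then (if x ∈ supp ε P p o' then (1 : ℝ) else 0) else 0) := by
      intro o'
      split_ifs with hx
      · rw [Finset.mul_sum]
      · simp
    simp only [this]
    rw [Finset.sum_comm, Finset.mul_sum]
    refine Finset.sum_congr rfl fun i _ => ?_
    rw [← Finset.mul_sum]
    simp
  rw [symEstimator, h1, freq_eq]
  simp only [symErr, Finset.sum_sub_distrib, ← Finset.sum_div, Finset.sum_const, Finset.card_univ,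
    Fintype.card_fin, nsmul_eq_mul]
  field_simp

theorem IsOSC.sum_supp (h : IsOSC ε P p ps qs k) (x y : Fin d) :
    ∑ o, P o y * (if x ∈ supp ε P p o then 1 else 0) = if y = x then ps else qs := by
  simp only [mul_ite, mul_one, mul_zero]
  split_ifs with hxy
  · subst hxy; exact h.symmetric.1 y
  · exact h.symmetric.2 x y (Ne.symm hxy)

theorem IsOSC.mean_symErr (h : IsOSC ε P p ps qs k) (x y : Fin d) :
    ∑ o, P o y * symErr ε P p ps qs x y o = 0 := by
  have hne := sub_ne_zero.2 h.ne
  have : ∀ o, P o y * symErr ε P p ps qs x y o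
      = 1 / (ps - qs) * (P o y * (if x ∈ supp ε P p o then 1 else 0))
        - (qs / (ps - qs) + if y = x then 1 else 0) * P o y := fun o => by
    rw [symErr]; ring
  simp only [this]
  rw [Finset.sum_sub_distrib, ← Finset.mul_sum, ← Finset.mul_sum, h.sum_supp, h.mechanism.2]
  split_ifs
  · field_simp; ring
  · field_simp; ring

/-- The variance of `symErr`. -/
noncomputable def symVar (ps qs : ℝ) (x y : Fin d) : ℝ :=
  (if y = x then ps * (1 - ps) else qs * (1 - qs)) / (ps - qs) ^ 2

theorem IsOSC.var_symErr (h : IsOSC ε P p ps qs k) (x y : Fin d) :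
    ∑ o, P o y * (symErr ε P p ps qs x y o * symErr ε P p ps qs x y o) = symVar ps qs x y := by
  have hne := sub_ne_zero.2 h.ne
  have : ∀ o, P o y * (symErr ε P p ps qs x y o * symErr ε P p ps qs x y o)
      = (1 - 2 * qs - 2 * (ps - qs) * (if y = x then 1 else 0)) / (ps - qs) ^ 2
          * (P o y * (if x ∈ supp ε P p o then 1 else 0))
        + ((qs / (ps - qs)) + if y = x then 1 else 0) ^ 2 * P o y := fun o => by
    rw [symErr]
    split_ifs <;> field_simp <;> ring
  simp only [this]
  rw [Finset.sum_add_distrib, ← Finset.mul_sum, ← Finset.mul_sum, h.sum_supp, h.mechanism.2, symVar]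
  split_ifs
  · field_simp; ring
  · field_simp; ring

theorem IsOSC.isUnbiased (h : IsOSC ε P p ps qs k) {n : ℕ} (hn : 1 ≤ n) :
    IsUnbiased P (symEstimator ε P p ps qs) n := by
  intro X x
  have h1 : expect P X (fun o => symEstimator ε P p ps qs (freq o) x - freq X x) = 0 := by
    simp only [symEstimator_sub_freq hn]
    rw [expect_eq_prodExp, prodExp_const_mul,
      prodExp_sum_coord (fun i => h.mechanism.2 (X i)) (fun i o => symErr ε P p ps qs x (X i) o)]
    simp [h.mean_symErr]
  rw [expect_eq_prodExp, prodExp_sub, prodExp_const (fun i => h.mechanism.2 (X i))] at h1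
  exact sub_eq_zero.1 h1

theorem sum_symVar (ps qs : ℝ) (y : Fin d) :
    ∑ x, symVar ps qs x y = (ps * (1 - ps) + (d - 1) * (qs * (1 - qs))) / (ps - qs) ^ 2 := by
  have hd : 1 ≤ d := Nat.one_le_iff_ne_zero.2 (fun h => by subst h; exact y.elim0)
  simp only [symVar]
  rw [← Finset.sum_div]
  congr 1
  rw [← Finset.add_sum_erase _ _ (Finset.mem_univ y), if_pos rfl,
    Finset.sum_congr rfl fun x hx => if_neg (Finset.ne_of_mem_erase hx).symm]
  simp [Finset.card_erase_of_mem, Nat.cast_sub hd]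

/-- The variance contributed by one user, summed over x, does not depend on that user's input; the
supremum over datasets is therefore that of a constant. -/
theorem IsOSC.L2loss_eq (h : IsOSC ε P p ps qs k) (hd : 1 ≤ d) {n : ℕ} (hn : 1 ≤ n) :
    L2loss P (symEstimator ε P p ps qs) n
      = (ps * (1 - ps) + (d - 1) * (qs * (1 - qs))) / (ps - qs) ^ 2 / n := by
  have hn0 : (n : ℝ) ≠ 0 := by positivity
  have : Nonempty (Fin n → Fin d) := ⟨fun _ => ⟨0, hd⟩⟩
  rw [L2loss]
  have key : ∀ X : Fin n → Fin d,
      expect P X (fun o => ∑ x, (symEstimator ε P p ps qs (freq o) x - freq X x) ^ 2)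
      = (ps * (1 - ps) + (d - 1) * (qs * (1 - qs))) / (ps - qs) ^ 2 / n := by
    intro X
    have hx : ∀ x, expect P X (fun o => (symEstimator ε P p ps qs (freq o) x - freq X x) ^ 2)
        = (1 / n : ℝ) ^ 2 * ∑ i, symVar ps qs x (X i) := by
      intro x
      have e : ∀ o : Fin n → Fin m, (symEstimator ε P p ps qs (freq o) x - freq X x) ^ 2
          = (1 / n : ℝ) ^ 2 * ((∑ i, symErr ε P p ps qs x (X i) (o i))
            * ∑ i, symErr ε P p ps qs x (X i) (o i)) := fun o => by
        rw [symEstimator_sub_freq hn]; ring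
      simp only [e]
      rw [expect_eq_prodExp, prodExp_const_mul,
        prodExp_sum_mul_sum (fun i => h.mechanism.2 (X i)) (fun i o => symErr ε P p ps qs x (X i) o)
          (fun i o => symErr ε P p ps qs x (X i) o) (fun i => h.mean_symErr x (X i))]
      simp only [h.var_symErr]
    rw [expect_sum]
    simp only [hx]
    rw [← Finset.mul_sum, Finset.sum_comm]
    simp only [sum_symVar]
    simp
    field_simp
  simp only [key, ciSup_const]

/-- For d ≥ 2 the degenerate sizes are excluded by p* ≠ q*: k = 0 forces both to be 0, and k = d
forces both to be 1. -/
theorem IsOSC.two_le_and_lt (h : IsOSC ε P p ps qs k) (hd : 1 ≤ d) (hk : k ≠ 1) :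
    2 ≤ k ∧ k < d ∨ d < 2 := by
  rcases Nat.lt_or_ge d 2 with hd2 | hd2
  · exact Or.inr hd2
  have hd' : (2 : ℝ) ≤ d := by exact_mod_cast hd2
  have hg : 0 < Real.exp ε := Real.exp_pos ε
  have hps := h.ps_mul hd
  have hqs := h.qs_mul hd
  have hb := h.sum_base
  have hD : (k * Real.exp ε + d - k : ℝ) ≠ 0 := fun h0 => by
    rw [h0, mul_zero] at hb; linarith
  have hm : ∃ o : Fin m, True := by
    by_contra hcon
    push Not at hcon
    have : ∑ o, p o = 0 := Finset.sum_eq_zero fun o _ => (hcon o).elim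
    rw [this, zero_mul] at hb
    linarith
  obtain ⟨o, -⟩ := hm
  have hkd : k ≤ d := by
    rw [← h.card_supp o]
    exact (Finset.card_le_univ _).trans (by simp)
  left
  refine ⟨?_, ?_⟩
  · by_contra hlt
    obtain rfl : k = 0 := by omega
    simp only [Nat.cast_zero, zero_mul, zero_add, sub_zero, mul_eq_zero] at hps hqs
    rcases hps with h1 | h1
    · rcases hqs with h2 | h2 | h2
      · linarith
      · exact h.ne (by rw [h1, h2])
      · linarith
    · linarith
  · refine lt_of_le_of_ne hkd fun hkd' => ?_
    subst hkd'
    have hD' : (k * Real.exp ε + k - k : ℝ) = k * Real.exp ε := by ring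
    rw [hD'] at hps hqs hD
    have h1 : ps = 1 := mul_right_cancel₀ hD (by rw [hps, one_mul])
    have h2 : qs = 1 := by
      have : (k - 1 : ℝ) * (k * Real.exp ε) ≠ 0 := mul_ne_zero (by linarith) hD
      refine mul_right_cancel₀ this ?_
      linear_combination hqs
    exact h.ne (by rw [h1, h2])

/-- The `L₂` loss of an optimal symmetric configuration in terms of the support size. -/
theorem IsOSC.loss_formula (h : IsOSC ε P p ps qs k) (hε : 0 < ε) (hk : 1 ≤ k) (hkd : k < d) :
    (ps * (1 - ps) + (d - 1) * (qs * (1 - qs))) / (ps - qs) ^ 2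
      = (d - 1) / (Real.exp ε - 1) ^ 2 *
        (((k * Real.exp ε + d - k) ^ 2 - (k * Real.exp ε ^ 2 + d - k)) / (k * (d - k))) := by
  have hg : 1 < Real.exp ε := Real.one_lt_exp_iff.2 hε
  have hd : 1 ≤ d := by omega
  have hps := h.ps_mul hd
  have hqs := h.qs_mul hd
  generalize Real.exp ε = g at *
  have hk' : (1 : ℝ) ≤ k := by exact_mod_cast hk
  have hkd' : (k : ℝ) < d := by exact_mod_cast hkd
  have hD : (k * g + d - k : ℝ) ≠ 0 := by nlinarith
  have hd1 : (d - 1 : ℝ) ≠ 0 := by linarith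
  have h1 : ps = k * g / (k * g + d - k) := by rw [eq_div_iff hD, hps]
  have h2 : qs = k * ((k * g + d - k) - g) / ((d - 1) * (k * g + d - k)) := by
    rw [eq_div_iff (mul_ne_zero hd1 hD), ← hqs]; ring
  have h3 : ps - qs = k * (d - k) * (g - 1) / ((d - 1) * (k * g + d - k)) := by
    rw [h1, h2]; field_simp; ring
  have hg1 : g - 1 ≠ 0 := by linarith
  have hk0 : (k : ℝ) ≠ 0 := by linarith
  have hdk : (d - k : ℝ) ≠ 0 := by linarith
  rw [h3, h1, h2]
  field_simp
  ring

theorem IsOSC.L2loss_of_one (h : IsOSC ε P p ps qs 1) (hε : 0 < ε) (hd : 1 ≤ d) {n : ℕ}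
    (hn : 1 ≤ n) : L2loss P (symEstimator ε P p ps qs) n = optL2 d ε n := by
  rw [h.L2loss_eq hd hn]
  rcases Nat.lt_or_ge d 2 with hd2 | hd2
  · obtain rfl : d = 1 := by omega
    have h1 := h.ps_mul hd
    have : ps = 1 := mul_right_cancel₀ (Real.exp_ne_zero ε) (by simpa using h1)
    simp [optL2, this]
  · have hg : 1 < Real.exp ε := Real.one_lt_exp_iff.2 hε
    have hd' : (2 : ℝ) ≤ d := by exact_mod_cast hd2
    have h1 : Real.exp ε - 1 ≠ 0 := by linarith
    have h3 : (d : ℝ) - 1 ≠ 0 := by linarith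
    rw [h.loss_formula hε le_rfl hd2, optL2, div_mul_eq_div_div_swap _ (n : ℝ)]
    congr 1
    push_cast
    field_simp
    ring

theorem IsOSC.optL2_lt (h : IsOSC ε P p ps qs k) (hε : 0 < ε) (hdε : (d : ℝ) ≤ Real.exp ε + 1)
    (hd : 2 ≤ d) (hk : k ≠ 1) {n : ℕ} (hn : 1 ≤ n) :
    optL2 d ε n < L2loss P (symEstimator ε P p ps qs) n := by
  obtain ⟨hk2, hkd⟩ : 2 ≤ k ∧ k < d := (h.two_le_and_lt (by omega) hk).resolve_right (by omega)
  rw [h.L2loss_eq (by omega) hn, h.loss_formula hε (by omega) hkd, optL2,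
    div_mul_eq_div_div_swap _ (n : ℝ)]
  have hn0 : (0 : ℝ) < n := by positivity
  refine div_lt_div_of_pos_right ?_ hn0
  have hg : 1 < Real.exp ε := Real.one_lt_exp_iff.2 hε
  generalize Real.exp ε = g at *
  have hk' : (2 : ℝ) ≤ k := by exact_mod_cast hk2
  have hkd' : (k : ℝ) < d := by exact_mod_cast hkd
  have h1 : 0 < (d - 1 : ℝ) / (g - 1) ^ 2 := div_pos (by linarith) (pow_pos (by linarith) 2)
  rw [mul_div_right_comm]
  refine mul_lt_mul_of_pos_left ?_ h1
  have h2 : (0 : ℝ) < k * (d - k) := mul_pos (by linarith) (by linarith)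
  rw [lt_div_iff₀ h2]
  -- After clearing the denominator k(d-k), this is exactly the excess over the value for k = 1.
  -- Positivity uses g ≥ d-1 and k(d-1) > d-k.
  have h3 : (0 : ℝ) < (k - 1) * (k * g ^ 2 - (d - k) * (d - 1)) := by
    refine mul_pos (by linarith) ?_
    have h4 : (d - 1 : ℝ) ^ 2 ≤ g ^ 2 := pow_le_pow_left₀ (by linarith) (by linarith) 2
    have h5 : (k : ℝ) * (d - 1) ^ 2 ≤ k * g ^ 2 := mul_le_mul_of_nonneg_left h4 (by linarith)
    have h6 : (0 : ℝ) < (d - 1) * (k * d - d) := mul_pos (by linarith) (by nlinarith)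
    nlinarith
  nlinarith

/-- The witness is randomized response: the true input is reported with probability g/(g+d-1), each
other one with probability 1/(g+d-1). -/
theorem exists_isOSC_one (hd : 1 ≤ d) (hε : 0 < ε) :
    ∃ (m : ℕ) (P : Matrix (Fin m) (Fin d) ℝ) (p : Fin m → ℝ) (ps qs : ℝ),
      IsOSC ε P p ps qs 1 := by
  obtain ⟨g, hgdef⟩ : ∃ g, g = Real.exp ε := ⟨_, rfl⟩
  have hg : 1 < g := by rw [hgdef]; exact Real.one_lt_exp_iff.2 hε
  have hd' : (1 : ℝ) ≤ d := by exact_mod_cast hd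
  have hD : 0 < g + d - 1 := by linarith
  obtain ⟨c, hc⟩ : ∃ c, c = 1 / (g + d - 1) := ⟨_, rfl⟩
  have hc0 : 0 < c := by rw [hc]; positivity
  have hcD : c * (g + d - 1) = 1 := by rw [hc]; field_simp
  obtain ⟨P, hP⟩ : ∃ P : Matrix (Fin d) (Fin d) ℝ, P = fun o x => if o = x then g * c else c :=
    ⟨_, rfl⟩
  have hPa : ∀ o x, P o x = if o = x then g * c else c := fun o x => by rw [hP]
  have hsupp : ∀ o x, x ∈ supp ε P (fun _ => c) o ↔ o = x := fun o x => by
    rw [supp, Finset.mem_filter, ← hgdef, hPa]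
    split_ifs with h
    · simp [h]
    · simp only [Finset.mem_univ, true_and, h, iff_false]
      intro h2
      nlinarith
  refine ⟨d, P, fun _ => c, g * c, c, ⟨⟨fun o x => ?_, fun x => ?_⟩, fun o x x' => ?_, fun o x => ?_,
    ⟨fun x => ?_, fun x x' hx => ?_⟩, fun o => ?_, ?_⟩⟩
  · rw [hPa]; split_ifs <;> positivity
  · simp only [hPa]
    rw [← Finset.add_sum_erase _ _ (Finset.mem_univ x), if_pos rfl,
      Finset.sum_congr rfl fun o ho => if_neg (Finset.ne_of_mem_erase ho)]
    simp only [Finset.sum_const, Finset.card_erase_of_mem (Finset.mem_univ x), Finset.card_univ,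
      Fintype.card_fin, nsmul_eq_mul, Nat.cast_sub hd, Nat.cast_one]
    linarith
  · rw [← hgdef, hPa, hPa]
    split_ifs <;> nlinarith [mul_pos hc0 (sub_pos.2 hg)]
  · rw [← hgdef, hPa]
    split_ifs <;> simp
  · simp only [hsupp]
    simp [hPa]
  · simp only [hsupp]
    simp [hPa, hx]
  · rw [Finset.card_eq_one]
    exact ⟨o, by ext x; rw [hsupp, Finset.mem_singleton, eq_comm]⟩
  · nlinarith

end osc
end LDPFreq

namespace LDPFreq
open MeasureTheory ProbabilityTheory
open scoped NNReal

/-! ### A quantitative central limit theorem for the absolute value -/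

/-- `f` is approximated near every point by quadratic polynomials with bounded coefficients, with a
cubic error. -/
structure CubicApprox (f f₁ f₂ : ℝ → ℝ) (B M : ℝ) : Prop where
  cont : Continuous f
  cont₁ : Continuous f₁
  cont₂ : Continuous f₂
  growth : ∀ x, |f x| ≤ B + |x|
  bound₁ : ∀ x, |f₁ x| ≤ B
  bound₂ : ∀ x, |f₂ x| ≤ B
  approx : ∀ x h, |f (x + h) - f x - f₁ x * h - f₂ x * h ^ 2| ≤ M * |h| ^ 3

theorem integrable_abs_pow_gaussianReal (v : ℝ≥0) {k : ℕ} (hk : k ≠ 0) :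
    Integrable (fun x => |x| ^ k) (gaussianReal 0 v) := by
  have := (memLp_id_gaussianReal (μ := 0) (v := v) (k : ℝ≥0)).integrable_norm_pow (p := k)
  simpa using this hk

theorem integrable_id_gaussianReal (v : ℝ≥0) : Integrable (fun x : ℝ => x) (gaussianReal 0 v) := by
  have := integrable_abs_pow_gaussianReal v one_ne_zero
  simp only [pow_one] at this
  exact (integrable_norm_iff (by fun_prop)).1 this

theorem integrable_sq_gaussianReal (v : ℝ≥0) :
    Integrable (fun x : ℝ => x ^ 2) (gaussianReal 0 v) := by
  simpa using integrable_abs_pow_gaussianReal v two_ne_zero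

theorem integral_sq_gaussianReal (v : ℝ≥0) : ∫ x, x ^ 2 ∂gaussianReal 0 v = v := by
  have h := variance_eq_sub (memLp_id_gaussianReal (μ := 0) (v := v) 2)
  rw [variance_id_gaussianReal] at h
  simp [integral_id_gaussianReal] at h
  exact h.symm

/-- The third absolute moment of the standard Gaussian law. -/
noncomputable def gaussThird : ℝ := ∫ x, |x| ^ 3 ∂gaussianReal 0 1

theorem gaussThird_nonneg : 0 ≤ gaussThird := integral_nonneg fun x => by positivity

theorem integral_gaussianReal_scale (v : ℝ≥0) {f : ℝ → ℝ} (hf : Continuous f) :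
    ∫ x, f x ∂gaussianReal 0 v = ∫ x, f (√v * x) ∂gaussianReal 0 1 := by
  have h := gaussianReal_map_const_mul (μ := 0) (v := 1) (√(v : ℝ))
  rw [mul_zero, mul_one] at h
  have hv : (⟨√(v : ℝ) ^ 2, sq_nonneg _⟩ : ℝ≥0) = v := by
    ext; simp
  have h' : (gaussianReal 0 1).map (fun x => √(v : ℝ) * x) = gaussianReal 0 v := by
    rw [h]; exact congrArg _ hv
  rw [← h', integral_map (by fun_prop) hf.aestronglyMeasurable]

theorem integral_abs_cube_gaussianReal (v : ℝ≥0) :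
    ∫ x, |x| ^ 3 ∂gaussianReal 0 v = √v ^ 3 * gaussThird := by
  rw [integral_gaussianReal_scale v (by fun_prop), gaussThird, ← integral_const_mul]
  refine integral_congr_ae (ae_of_all _ fun x => ?_)
  simp only [abs_mul, mul_pow, abs_of_nonneg (Real.sqrt_nonneg _)]

theorem integral_abs_gaussianReal (v : ℝ≥0) :
    ∫ x, |x| ∂gaussianReal 0 v = √(2 * v / Real.pi) := by
  have h1 : ∫ x, |x| ∂gaussianReal 0 1 = √(2 / Real.pi) := by
    rw [integral_gaussianReal_eq_integral_smul one_ne_zero]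
    have e : ∀ x : ℝ, gaussianPDFReal 0 1 x • |x|
        = (fun y => (√(2 * Real.pi))⁻¹ * (y ^ (1 : ℝ) * Real.exp (-(1 / 2) * y ^ (2 : ℝ)))) |x| := by
      intro x
      simp only [gaussianPDFReal_def, smul_eq_mul, Real.rpow_one, Real.rpow_two, sq_abs]
      simp only [NNReal.coe_one, mul_one, sub_zero]
      rw [show -x ^ 2 / 2 = -(1 / 2) * x ^ 2 by ring]
      ring
    simp only [e]
    rw [integral_comp_abs (f := fun y => (√(2 * Real.pi))⁻¹ * (y ^ (1 : ℝ) *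
      Real.exp (-(1 / 2) * y ^ (2 : ℝ)))), integral_const_mul,
      integral_rpow_mul_exp_neg_mul_rpow (by norm_num) (by norm_num) (by norm_num)]
    norm_num
    have h2 : √(2 : ℝ) * √2 = 2 := Real.mul_self_sqrt (by norm_num)
    field_simp
    linarith
  rw [integral_gaussianReal_scale v continuous_abs]
  simp only [abs_mul, abs_of_nonneg (Real.sqrt_nonneg _)]
  rw [integral_const_mul, h1, ← Real.sqrt_mul v.coe_nonneg]
  congr 1
  ring

section
variable {f f₁ f₂ : ℝ → ℝ} {B M : ℝ}

theorem CubicApprox.integrable_shift (hf : CubicApprox f f₁ f₂ B M) (x : ℝ) (v : ℝ≥0) :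
    Integrable (fun z => f (x + z)) (gaussianReal 0 v) := by
  have hc := hf.cont
  refine Integrable.mono' (g := fun z => B + |x| + |z|) ?_ (by fun_prop) (ae_of_all _ fun z => ?_)
  · exact (integrable_const _).add (by simpa using integrable_abs_pow_gaussianReal v one_ne_zero)
  · have := hf.growth (x + z)
    have := abs_add_le x z
    rw [Real.norm_eq_abs]
    linarith

/-- Averaging over a Gaussian shift preserves the cubic error. The constant and linear coefficients
need only exist, because they have the same effect on both centred variables in the replacement
step. -/
theorem CubicApprox.integral_approx (hf : CubicApprox f f₁ f₂ B M) (x : ℝ) (v : ℝ≥0) :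
    ∃ a b : ℝ, ∀ h, |(∫ z, f (x + h + z) ∂gaussianReal 0 v) - a - b * h
      - (∫ z, f₂ (x + z) ∂gaussianReal 0 v) * h ^ 2| ≤ M * |h| ^ 3 := by
  have hc := hf.cont
  have hc1 := hf.cont₁
  have hc2 := hf.cont₂
  have i1 : Integrable (fun z => f₁ (x + z)) (gaussianReal 0 v) :=
    Integrable.mono' (integrable_const B) (by fun_prop) (ae_of_all _ fun z => hf.bound₁ _)
  have i2 : Integrable (fun z => f₂ (x + z)) (gaussianReal 0 v) :=
    Integrable.mono' (integrable_const B) (by fun_prop) (ae_of_all _ fun z => hf.bound₂ _)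
  refine ⟨∫ z, f (x + z) ∂gaussianReal 0 v, ∫ z, f₁ (x + z) ∂gaussianReal 0 v, fun h => ?_⟩
  have i0 := hf.integrable_shift x v
  have i0' := hf.integrable_shift (x + h) v
  have j1 : Integrable (fun z => f (x + h + z) - f (x + z)) (gaussianReal 0 v) := i0'.sub i0
  have j2 : Integrable (fun z => f (x + h + z) - f (x + z) - f₁ (x + z) * h) (gaussianReal 0 v) :=
    j1.sub (i1.mul_const h)
  rw [← integral_sub i0' i0, ← integral_mul_const, ← integral_mul_const,
    ← integral_sub j1 (i1.mul_const h), ← integral_sub j2 (i2.mul_const _)]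
  refine (abs_integral_le_integral_abs).trans ?_
  have : ∫ _ : ℝ, M * |h| ^ 3 ∂gaussianReal 0 v = M * |h| ^ 3 := by simp
  rw [← this]
  refine integral_mono_of_nonneg (ae_of_all _ fun z => abs_nonneg _) (integrable_const _)
    (ae_of_all _ fun z => ?_)
  have := hf.approx (x + z) h
  simp only
  rw [show x + h + z = x + z + h by ring]
  exact this

/-- One step of Lindeberg's replacement of a centred bounded variable by a Gaussian one. -/
theorem CubicApprox.step (hf : CubicApprox f f₁ f₂ B M) (hM : 0 ≤ M) {α : Type*} [Fintype α]
    {w W : α → ℝ} {σ : ℝ≥0} {c : ℝ} (hw0 : ∀ b, 0 ≤ w b) (hw1 : ∑ b, w b = 1)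
    (hW0 : ∑ b, w b * W b = 0) (hW2 : ∑ b, w b * W b ^ 2 = σ) (hWc : ∀ b, |W b| ≤ c) (hc : 0 ≤ c)
    (x : ℝ) (v : ℝ≥0) :
    |∑ b, w b * (∫ z, f (x + W b + z) ∂gaussianReal 0 v) - ∫ z, f (x + z) ∂gaussianReal 0 (σ + v)|
      ≤ M * (c ^ 3 * (1 + gaussThird)) := by
  obtain ⟨a, b₁, hab⟩ := hf.integral_approx x v
  obtain ⟨b₂, hb₂⟩ : ∃ b₂, b₂ = ∫ z, f₂ (x + z) ∂gaussianReal 0 v := ⟨_, rfl⟩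
  obtain ⟨G, hG⟩ : ∃ G : ℝ → ℝ, G = fun h => ∫ z, f (x + h + z) ∂gaussianReal 0 v := ⟨_, rfl⟩
  have hG' : ∀ h, ∫ z, f (x + h + z) ∂gaussianReal 0 v = G h := fun h => by rw [hG]
  simp only [hG', ← hb₂] at hab ⊢
  -- Both the discrete and the Gaussian average of `G` are compared with `a + b₂ * σ`, which depends
  -- only on the first two moments, shared by the two variables.
  have h1 : |∑ b, w b * G (W b) - (a + b₂ * σ)| ≤ M * c ^ 3 := by
    have e : ∑ b, w b * G (W b) - (a + b₂ * σ)
        = ∑ b, w b * (G (W b) - a - b₁ * W b - b₂ * W b ^ 2) := by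
      have : ∀ b, w b * (G (W b) - a - b₁ * W b - b₂ * W b ^ 2)
          = w b * G (W b) - a * w b - b₁ * (w b * W b) - b₂ * (w b * W b ^ 2) := fun b => by ring
      simp only [this, Finset.sum_sub_distrib, ← Finset.mul_sum, hw1, hW0, hW2]
      ring
    rw [e]
    refine (Finset.abs_sum_le_sum_abs _ _).trans ?_
    have : ∀ b, |w b * (G (W b) - a - b₁ * W b - b₂ * W b ^ 2)| ≤ w b * (M * c ^ 3) := fun b => by
      rw [abs_mul, abs_of_nonneg (hw0 b)]
      refine mul_le_mul_of_nonneg_left ((hab (W b)).trans ?_) (hw0 b)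
      exact mul_le_mul_of_nonneg_left (pow_le_pow_left₀ (abs_nonneg _) (hWc b) 3) hM
    refine (Finset.sum_le_sum fun b _ => this b).trans ?_
    rw [← Finset.sum_mul, hw1, one_mul]
  have hσ : √(σ : ℝ) ≤ c := by
    rw [Real.sqrt_le_left hc, ← hW2]
    calc ∑ b, w b * W b ^ 2 ≤ ∑ b, w b * c ^ 2 := Finset.sum_le_sum fun b _ =>
          mul_le_mul_of_nonneg_left (sq_le_sq' (abs_le.1 (hWc b)).1 (abs_le.1 (hWc b)).2) (hw0 b)
      _ = c ^ 2 := by rw [← Finset.sum_mul, hw1, one_mul]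
  have hint : Integrable (fun z => f (x + z)) (gaussianReal 0 σ ∗ gaussianReal 0 v) := by
    rw [gaussianReal_conv_gaussianReal, add_zero]
    exact hf.integrable_shift x _
  have hconv : ∫ z, f (x + z) ∂gaussianReal 0 (σ + v) = ∫ h, G h ∂gaussianReal 0 σ := by
    have := integral_conv hint
    rw [gaussianReal_conv_gaussianReal, add_zero] at this
    rw [this, hG]
    simp only [add_assoc]
  have hGi : Integrable G (gaussianReal 0 σ) := by
    have h0 := hint
    rw [Measure.conv] at h0
    have h2 := (integrable_map_measure h0.1 (by fun_prop)).1 h0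
    have h3 := h2.integral_prod_left
    rw [hG]
    simpa [add_assoc] using h3
  have h2 : |∫ h, G h ∂gaussianReal 0 σ - (a + b₂ * σ)| ≤ M * (c ^ 3 * gaussThird) := by
    have i1 : Integrable (fun h => G h - a) (gaussianReal 0 σ) := hGi.sub (integrable_const a)
    have i2 : Integrable (fun h : ℝ => b₁ * h) (gaussianReal 0 σ) :=
      (integrable_id_gaussianReal σ).const_mul b₁
    have i3 : Integrable (fun h : ℝ => b₂ * h ^ 2) (gaussianReal 0 σ) :=
      (integrable_sq_gaussianReal σ).const_mul b₂
    have e : ∫ h, G h ∂gaussianReal 0 σ - (a + b₂ * σ)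
        = ∫ h, (G h - a - b₁ * h - b₂ * h ^ 2) ∂gaussianReal 0 σ := by
      have i4 : Integrable (fun h => G h - a - b₁ * h) (gaussianReal 0 σ) := i1.sub i2
      rw [integral_sub i4 i3, integral_sub i1 i2, integral_sub hGi (integrable_const a),
        integral_const_mul, integral_const_mul, integral_id_gaussianReal, integral_sq_gaussianReal]
      simp
      ring
    rw [e]
    refine (abs_integral_le_integral_abs).trans ?_
    calc ∫ h, |G h - a - b₁ * h - b₂ * h ^ 2| ∂gaussianReal 0 σ
        ≤ ∫ h, M * |h| ^ 3 ∂gaussianReal 0 σ :=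
          integral_mono_of_nonneg (ae_of_all _ fun z => abs_nonneg _)
            ((integrable_abs_pow_gaussianReal σ three_ne_zero).const_mul M)
            (ae_of_all _ fun h => hab h)
      _ = M * (√σ ^ 3 * gaussThird) := by
          rw [integral_const_mul, integral_abs_cube_gaussianReal]
      _ ≤ M * (c ^ 3 * gaussThird) := by
          have := gaussThird_nonneg
          gcongr
  rw [hconv]
  have h3 := abs_sub_le (∑ b, w b * G (W b)) (a + b₂ * σ) (∫ h, G h ∂gaussianReal 0 σ)
  rw [abs_sub_comm (a + b₂ * (σ : ℝ))] at h3
  linarith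

theorem prodExp_fin_succ {α : Type*} [Fintype α] {N : ℕ} (w : Fin (N + 1) → α → ℝ)
    (F : (Fin (N + 1) → α) → ℝ) :
    prodExp w F = ∑ b, w 0 b * prodExp (fun i => w i.succ) (fun a => F (Fin.cons b a)) := by
  rw [prodExp, ← Fintype.sum_equiv (Fin.consEquiv (fun _ => α))
    (fun q => (∏ i, w i ((Fin.cons q.1 q.2 : Fin (N + 1) → α) i)) * F (Fin.cons q.1 q.2)) _
    (fun q => rfl), Fintype.sum_prod_type]
  refine Finset.sum_congr rfl fun b _ => ?_
  rw [prodExp, Finset.mul_sum]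
  refine Finset.sum_congr rfl fun a _ => ?_
  rw [Fin.prod_univ_succ]
  simp only [Fin.cons_zero, Fin.cons_succ]
  ring

/-- Induction on the number of variables: for each value of the first variable, the induction
hypothesis at the shifted point makes the others Gaussian; then one replacement step treats the
first. The general x is needed for this shift. -/
theorem CubicApprox.lindeberg (hf : CubicApprox f f₁ f₂ B M) (hM : 0 ≤ M) {α : Type*} [Fintype α]
    {c : ℝ} (hc : 0 ≤ c) : ∀ (N : ℕ) (w W : Fin N → α → ℝ) (v : Fin N → ℝ≥0),
    (∀ i b, 0 ≤ w i b) → (∀ i, ∑ b, w i b = 1) → (∀ i, ∑ b, w i b * W i b = 0) →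
    (∀ i, ∑ b, w i b * W i b ^ 2 = v i) → (∀ i b, |W i b| ≤ c) → ∀ x : ℝ,
    |prodExp w (fun a => f (x + ∑ i, W i (a i))) - ∫ z, f (x + z) ∂gaussianReal 0 (∑ i, v i)|
      ≤ N * (M * (c ^ 3 * (1 + gaussThird))) := by
  intro N
  induction N with
  | zero =>
    intro w W v _ _ _ _ _ x
    simp [prodExp, gaussianReal_zero_var]
  | succ N ih =>
    intro w W v hw0 hw1 hW0 hW2 hWc x
    rw [prodExp_fin_succ]
    have hstep := hf.step hM (hw0 0) (hw1 0) (hW0 0) (hW2 0) (hWc 0) hc x (∑ i : Fin N, v i.succ)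
    rw [← Fin.sum_univ_succ] at hstep
    have hrest : |∑ b, w 0 b * prodExp (fun i : Fin N => w i.succ)
          (fun a => f (x + ∑ i, W i ((Fin.cons b a : Fin (N + 1) → α) i)))
        - ∑ b, w 0 b * ∫ z, f (x + W 0 b + z) ∂gaussianReal 0 (∑ i : Fin N, v i.succ)|
        ≤ N * (M * (c ^ 3 * (1 + gaussThird))) := by
      rw [← Finset.sum_sub_distrib]
      refine (Finset.abs_sum_le_sum_abs _ _).trans ?_
      have : ∀ b, |w 0 b * prodExp (fun i : Fin N => w i.succ)
            (fun a => f (x + ∑ i, W i ((Fin.cons b a : Fin (N + 1) → α) i)))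
          - w 0 b * ∫ z, f (x + W 0 b + z) ∂gaussianReal 0 (∑ i : Fin N, v i.succ)|
          ≤ w 0 b * (N * (M * (c ^ 3 * (1 + gaussThird)))) := fun b => by
        rw [← mul_sub, abs_mul, abs_of_nonneg (hw0 0 b)]
        refine mul_le_mul_of_nonneg_left ?_ (hw0 0 b)
        have := ih (fun i => w i.succ) (fun i => W i.succ) (fun i => v i.succ) (fun i => hw0 i.succ)
          (fun i => hw1 i.succ) (fun i => hW0 i.succ) (fun i => hW2 i.succ) (fun i => hWc i.succ)
          (x + W 0 b)
        simpa only [Fin.sum_univ_succ, Fin.cons_zero, Fin.cons_succ, add_assoc] using this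
      refine (Finset.sum_le_sum fun b _ => this b).trans ?_
      rw [← Finset.sum_mul, hw1, one_mul]
    have h3 := abs_sub_le (∑ b, w 0 b * prodExp (fun i : Fin N => w i.succ)
          (fun a => f (x + ∑ i, W i ((Fin.cons b a : Fin (N + 1) → α) i))))
        (∑ b, w 0 b * ∫ z, f (x + W 0 b + z) ∂gaussianReal 0 (∑ i : Fin N, v i.succ))
        (∫ z, f (x + z) ∂gaussianReal 0 (∑ i, v i))
    push_cast
    linarith

end

/-- Three mean value inequalities on the ball of radius |h|, each gaining a factor |h|. This gives
the constant L instead of L/6, which is harmless here. -/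
theorem cubic_remainder_le {F F₁ F₂ F₃ : ℝ → ℝ} {L : ℝ} (h₀ : ∀ x, HasDerivAt F (F₁ x) x)
    (h₁ : ∀ x, HasDerivAt F₁ (F₂ x) x) (h₂ : ∀ x, HasDerivAt F₂ (F₃ x) x) (h₃ : ∀ x, |F₃ x| ≤ L)
    (x h : ℝ) : |F (x + h) - F x - F₁ x * h - F₂ x / 2 * h ^ 2| ≤ L * |h| ^ 3 := by
  have hL : 0 ≤ L := (abs_nonneg _).trans (h₃ 0)
  have hconv := convex_closedBall x |h|
  have hx : x ∈ Metric.closedBall x |h| := Metric.mem_closedBall_self (abs_nonneg h)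
  have hdist : ∀ y ∈ Metric.closedBall x |h|, ‖y - x‖ ≤ |h| := fun y hy => by
    rwa [Metric.mem_closedBall, Real.dist_eq] at hy
  have s1 : ∀ y ∈ Metric.closedBall x |h|, ‖F₂ y - F₂ x‖ ≤ L * |h| := fun y hy =>
    (hconv.norm_image_sub_le_of_norm_hasDerivWithin_le
      (fun z _ => (h₂ z).hasDerivWithinAt) (fun z _ => h₃ z) hx hy).trans
      (mul_le_mul_of_nonneg_left (hdist y hy) hL)
  have s2 : ∀ y ∈ Metric.closedBall x |h|, ‖F₁ y - F₁ x - F₂ x * (y - x)‖ ≤ L * |h| * |h| :=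
    fun y hy => by
    have hd : ∀ z, HasDerivAt (fun z => F₁ z - F₂ x * (z - x)) (F₂ z - F₂ x) z := fun z => by
      have := (h₁ z).sub (((hasDerivAt_id z).sub_const x).const_mul (F₂ x))
      exact this.congr_deriv (by simp)
    have := hconv.norm_image_sub_le_of_norm_hasDerivWithin_le
      (fun z _ => (hd z).hasDerivWithinAt) s1 hx hy
    refine le_trans (le_of_eq ?_) (this.trans
      (mul_le_mul_of_nonneg_left (hdist y hy) (by positivity)))
    congr 1; ring
  have hd : ∀ z, HasDerivAt (fun z => F z - F₁ x * (z - x) - F₂ x / 2 * (z - x) ^ 2)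
      (F₁ z - F₁ x - F₂ x * (z - x)) z := fun z => by
    have e1 := ((hasDerivAt_id z).sub_const x)
    have := ((h₀ z).sub (e1.const_mul (F₁ x))).sub ((e1.pow 2).const_mul (F₂ x / 2))
    exact this.congr_deriv (by simp; ring)
  have hy : x + h ∈ Metric.closedBall x |h| := by simp [Metric.mem_closedBall]
  have := hconv.norm_image_sub_le_of_norm_hasDerivWithin_le
    (fun z _ => (hd z).hasDerivWithinAt) s2 hx hy
  rw [Real.norm_eq_abs, Real.norm_eq_abs] at this
  have e : F (x + h) - F x - F₁ x * h - F₂ x / 2 * h ^ 2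
      = F (x + h) - F₁ x * (x + h - x) - F₂ x / 2 * (x + h - x) ^ 2
        - (F x - F₁ x * (x - x) - F₂ x / 2 * (x - x) ^ 2) := by ring
  rw [e]
  refine this.trans (le_of_eq ?_)
  rw [add_sub_cancel_left]
  ring

/-- A smooth approximation of the absolute value. -/
noncomputable def softAbs (δ x : ℝ) : ℝ := √(x ^ 2 + δ ^ 2)

theorem abs_le_softAbs (δ x : ℝ) : |x| ≤ softAbs δ x := by
  rw [softAbs]
  exact Real.abs_le_sqrt (by nlinarith [sq_nonneg δ])

theorem softAbs_le {δ : ℝ} (hδ : 0 < δ) (x : ℝ) : softAbs δ x ≤ |x| + δ := by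
  rw [softAbs, Real.sqrt_le_left (by positivity), ← sq_abs x]
  nlinarith [abs_nonneg x, mul_nonneg (abs_nonneg x) hδ.le]

/-- The third function is half the second derivative. The third derivative is bounded by 3/δ²
because `softAbs δ x` dominates both |x| and δ. -/
theorem cubicApprox_softAbs {δ : ℝ} (hδ : 0 < δ) :
    CubicApprox (softAbs δ) (fun x => x / softAbs δ x) (fun x => δ ^ 2 / softAbs δ x ^ 3 / 2)
      (1 + δ + 1 / δ) (3 / δ ^ 2) := by
  have hpos : ∀ x, 0 < x ^ 2 + δ ^ 2 := fun x => by positivity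
  have hs : ∀ x, 0 < softAbs δ x := fun x => Real.sqrt_pos.2 (hpos x)
  have hsδ : ∀ x, δ ≤ softAbs δ x := fun x => Real.le_sqrt_of_sq_le (by nlinarith [sq_nonneg x])
  have hsq : ∀ x, softAbs δ x ^ 2 = x ^ 2 + δ ^ 2 := fun x => Real.sq_sqrt (hpos x).le
  have h₀ : ∀ x, HasDerivAt (softAbs δ) (x / softAbs δ x) x := fun x => by
    have := (((hasDerivAt_id x).pow 2).add_const (δ ^ 2)).sqrt (hpos x).ne'
    refine this.congr_deriv ?_
    have := Real.sqrt_pos.2 (hpos x)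
    simp only [softAbs, Pi.pow_apply, id]
    push_cast
    field_simp
  have h₁ : ∀ x, HasDerivAt (fun x => x / softAbs δ x) (δ ^ 2 / softAbs δ x ^ 3) x := fun x => by
    have := (hasDerivAt_id x).div (h₀ x) (hs x).ne'
    refine this.congr_deriv ?_
    have := hs x
    simp only [id]
    field_simp
    linarith [hsq x]
  have h₂ : ∀ x, HasDerivAt (fun x => δ ^ 2 / softAbs δ x ^ 3)
      (-(3 * δ ^ 2 * x) / softAbs δ x ^ 5) x := fun x => by
    have := (hasDerivAt_const x (δ ^ 2)).div ((h₀ x).pow 3) (pow_ne_zero 3 (hs x).ne')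
    refine this.congr_deriv ?_
    have := hs x
    simp only [Pi.pow_apply]
    push_cast
    field_simp
    ring
  have hc : Continuous (softAbs δ) := by unfold softAbs; fun_prop
  refine ⟨hc, ?_, ?_, fun x => ?_, fun x => ?_, fun x => ?_, ?_⟩
  · exact continuous_id.div hc fun x => (hs x).ne'
  · exact (continuous_const.div (hc.pow 3) fun x => pow_ne_zero 3 (hs x).ne').div_const 2
  · rw [abs_of_pos (hs x)]
    have := softAbs_le hδ x
    have : 0 < 1 / δ := by positivity
    linarith
  · rw [abs_div, abs_of_pos (hs x), div_le_iff₀ (hs x)]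
    have := abs_le_softAbs δ x
    have : 0 ≤ (δ + 1 / δ) * softAbs δ x := mul_nonneg (by positivity) (hs x).le
    linarith
  · have h1 : 0 < softAbs δ x ^ 3 := pow_pos (hs x) 3
    rw [abs_of_pos (by positivity)]
    have h2 : δ ^ 3 ≤ softAbs δ x ^ 3 := pow_le_pow_left₀ hδ.le (hsδ x) 3
    have : δ ^ 2 / softAbs δ x ^ 3 ≤ 1 / δ := by
      rw [div_le_div_iff₀ h1 hδ]; nlinarith
    have h3 : 0 ≤ δ ^ 2 / softAbs δ x ^ 3 := by positivity
    linarith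
  · refine cubic_remainder_le h₀ h₁ h₂ fun x => ?_
    have h1 : 0 < softAbs δ x ^ 5 := pow_pos (hs x) 5
    rw [abs_div, abs_of_pos h1, abs_neg, abs_mul, abs_of_pos (by positivity),
      div_le_div_iff₀ h1 (by positivity)]
    have h2 : δ ^ 4 ≤ softAbs δ x ^ 4 := pow_le_pow_left₀ hδ.le (hsδ x) 4
    calc 3 * δ ^ 2 * |x| * δ ^ 2 = 3 * (δ ^ 4 * |x|) := by ring
      _ ≤ 3 * (softAbs δ x ^ 4 * softAbs δ x) := by
        have := abs_le_softAbs δ x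
        have := hs x
        gcongr
      _ = 3 * softAbs δ x ^ 5 := by ring

section
variable {α : Type*} [Fintype α] {N : ℕ} {w W : Fin N → α → ℝ} {c : ℝ}

theorem softAbs_lindeberg (hc : 0 ≤ c) (hw0 : ∀ i b, 0 ≤ w i b)
    (hw1 : ∀ i, ∑ b, w i b = 1) (hW0 : ∀ i, ∑ b, w i b * W i b = 0) (hWc : ∀ i b, |W i b| ≤ c)
    {v : ℝ≥0} (hv : (v : ℝ) = ∑ i, ∑ b, w i b * W i b ^ 2) {δ : ℝ} (hδ : 0 < δ) (x : ℝ) :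
    |prodExp w (fun a => softAbs δ (x + ∑ i, W i (a i)))
        - ∫ z, softAbs δ (x + z) ∂gaussianReal 0 v|
      ≤ N * (3 / δ ^ 2 * (c ^ 3 * (1 + gaussThird))) := by
  obtain ⟨vf, hvf⟩ : ∃ vf : Fin N → ℝ≥0, ∀ i, ∑ b, w i b * W i b ^ 2 = (vf i : ℝ) :=
    ⟨fun i => Real.toNNReal _, fun i => (Real.coe_toNNReal _ (Finset.sum_nonneg fun b _ =>
      mul_nonneg (hw0 i b) (sq_nonneg _))).symm⟩
  have h := (cubicApprox_softAbs hδ).lindeberg (by positivity) hc N w W vf hw0 hw1 hW0 hvf hWc x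
  have e : ∑ i, vf i = v := by
    apply NNReal.coe_injective
    rw [hv, NNReal.coe_sum]
    exact Finset.sum_congr rfl fun i _ => (hvf i).symm
  rwa [e] at h

theorem abs_clt_lower (hc : 0 ≤ c) (hw0 : ∀ i b, 0 ≤ w i b)
    (hw1 : ∀ i, ∑ b, w i b = 1) (hW0 : ∀ i, ∑ b, w i b * W i b = 0) (hWc : ∀ i b, |W i b| ≤ c)
    {δ : ℝ} (hδ : 0 < δ) (x : ℝ) :
    √(2 * (∑ i, ∑ b, w i b * W i b ^ 2) / Real.pi) - δ
        - N * (3 / δ ^ 2 * (c ^ 3 * (1 + gaussThird)))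
      ≤ prodExp w (fun a => |x + ∑ i, W i (a i)|) := by
  obtain ⟨v, hv⟩ : ∃ v : ℝ≥0, (v : ℝ) = ∑ i, ∑ b, w i b * W i b ^ 2 :=
    ⟨Real.toNNReal _, Real.coe_toNNReal _ (Finset.sum_nonneg fun i _ =>
      Finset.sum_nonneg fun b _ => mul_nonneg (hw0 i b) (sq_nonneg _))⟩
  have h := (abs_le.1 (softAbs_lindeberg hc hw0 hw1 hW0 hWc hv hδ x)).1
  have h1 : prodExp w (fun a => softAbs δ (x + ∑ i, W i (a i))) - δ
      ≤ prodExp w (fun a => |x + ∑ i, W i (a i)|) := by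
    rw [sub_le_iff_le_add, ← prodExp_const hw1 δ, ← prodExp_add, prodExp_const hw1 δ]
    exact prodExp_mono hw0 fun a => softAbs_le hδ _
  have iabs : ∀ y : ℝ, Integrable (fun z => |y + z|) (gaussianReal 0 v) := fun y =>
    ((integrable_const y).add (integrable_id_gaussianReal v)).abs
  have h2 : ∫ z, |x + z| ∂gaussianReal 0 v ≤ ∫ z, softAbs δ (x + z) ∂gaussianReal 0 v :=
    integral_mono (iabs x) ((cubicApprox_softAbs hδ).integrable_shift x v)
      fun z => abs_le_softAbs δ _
  -- A shift cannot reduce the mean absolute value of a symmetric variable: average the triangle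
  -- inequality over z and -z. This makes the lower bound independent of where an estimator is
  -- centred.
  have h3 : ∫ z, |z| ∂gaussianReal 0 v ≤ ∫ z, |x + z| ∂gaussianReal 0 v := by
    have e : ∫ z, |-x + z| ∂gaussianReal 0 v = ∫ z, |x + z| ∂gaussianReal 0 v := by
      have hm := gaussianReal_map_neg (μ := 0) (v := v)
      rw [neg_zero] at hm
      conv_lhs => rw [← hm]
      rw [integral_map (by fun_prop) (by fun_prop)]
      refine integral_congr_ae (ae_of_all _ fun z => ?_)
      simp only
      rw [show -x + -z = -(x + z) by ring, abs_neg]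
    have h4 : ∫ z, 2 * |z| ∂gaussianReal 0 v
        ≤ ∫ z, (|x + z| + |-x + z|) ∂gaussianReal 0 v := by
      refine integral_mono ?_ ((iabs x).add (iabs (-x))) fun z => ?_
      · simpa using ((integrable_id_gaussianReal v).abs.const_mul 2)
      · have := abs_add_le (x + z) (-x + z)
        rw [show x + z + (-x + z) = 2 * z by ring, abs_mul, abs_two] at this
        exact this
    rw [integral_const_mul, integral_add (iabs x) (iabs (-x)), e] at h4
    linarith
  rw [integral_abs_gaussianReal, hv] at h3
  linarith

theorem abs_clt_upper (hc : 0 ≤ c) (hw0 : ∀ i b, 0 ≤ w i b)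
    (hw1 : ∀ i, ∑ b, w i b = 1) (hW0 : ∀ i, ∑ b, w i b * W i b = 0) (hWc : ∀ i b, |W i b| ≤ c)
    {δ : ℝ} (hδ : 0 < δ) :
    prodExp w (fun a => |∑ i, W i (a i)|) ≤ √(2 * (∑ i, ∑ b, w i b * W i b ^ 2) / Real.pi) + δ
        + N * (3 / δ ^ 2 * (c ^ 3 * (1 + gaussThird))) := by
  obtain ⟨v, hv⟩ : ∃ v : ℝ≥0, (v : ℝ) = ∑ i, ∑ b, w i b * W i b ^ 2 :=
    ⟨Real.toNNReal _, Real.coe_toNNReal _ (Finset.sum_nonneg fun i _ =>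
      Finset.sum_nonneg fun b _ => mul_nonneg (hw0 i b) (sq_nonneg _))⟩
  have h := (abs_le.1 (softAbs_lindeberg hc hw0 hw1 hW0 hWc hv hδ 0)).2
  simp only [zero_add] at h
  have h1 : prodExp w (fun a => |∑ i, W i (a i)|)
      ≤ prodExp w (fun a => softAbs δ (∑ i, W i (a i))) :=
    prodExp_mono hw0 fun a => abs_le_softAbs δ _
  have h2 : ∫ z, softAbs δ z ∂gaussianReal 0 v ≤ ∫ z, (|z| + δ) ∂gaussianReal 0 v :=
    integral_mono (by simpa using (cubicApprox_softAbs hδ).integrable_shift 0 v)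
      ((integrable_id_gaussianReal v).abs.add (integrable_const δ)) fun z => softAbs_le hδ z
  rw [integral_add (integrable_id_gaussianReal v).abs (integrable_const δ),
    integral_abs_gaussianReal, hv] at h2
  simp at h2
  linarith

end
end LDPFreq

/-! ### The L₁ loss of optimal symmetric configurations with support size one -/

namespace LDPFreq

theorem optL1const_eq {d : ℕ} {ε : ℝ} (hε : 0 < ε) : optL1const d ε
    = √(2 * d * ((d : ℝ) - 1) * (d + 2 * Real.exp ε - 2) / Real.pi / (Real.exp ε - 1) ^ 2) := by
  have hg : 1 < Real.exp ε := Real.one_lt_exp_iff.2 hε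
  rw [Real.sqrt_div' _ (sq_nonneg _), Real.sqrt_sq (by linarith), optL1const]

theorem IsOSC.sqrt_mul_L1loss_le {m d : ℕ} {P : Matrix (Fin m) (Fin d) ℝ} {p : Fin m → ℝ}
    {ps qs ε : ℝ} (h : IsOSC ε P p ps qs 1) (hε : 0 < ε) (hd : 1 ≤ d) :
    ∃ κ : ℝ, ∀ n : ℕ, 1 ≤ n → ∀ η : ℝ, 0 < η →
      √(n : ℝ) * L1loss P (symEstimator ε P p ps qs) n
        ≤ optL1const d ε + d * (η + κ / (η ^ 2 * √(n : ℝ))) := by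
  obtain ⟨c, hc⟩ : ∃ c, c = (1 + |qs|) / |ps - qs| + 1 := ⟨_, rfl⟩
  have hne : 0 < |ps - qs| := abs_pos.2 (sub_ne_zero.2 h.ne)
  have hc0 : 0 ≤ c := by rw [hc]; positivity
  have hcb : ∀ x y o, |symErr ε P p ps qs x y o| ≤ c := fun x y o => by
    rw [symErr, hc]
    refine (abs_sub _ _).trans (add_le_add ?_ (by split_ifs <;> simp))
    rw [abs_div]
    refine div_le_div_of_nonneg_right ((abs_sub _ _).trans ?_) hne.le
    split_ifs <;> simp
  refine ⟨3 * (c ^ 3 * (1 + gaussThird)), fun n hn η hη => ?_⟩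
  have hn0 : (0 : ℝ) < n := by positivity
  have hsn : 0 < √(n : ℝ) := Real.sqrt_pos.2 hn0
  have hsn2 : √(n : ℝ) * √(n : ℝ) = n := Real.mul_self_sqrt hn0.le
  have hg : 1 < Real.exp ε := Real.one_lt_exp_iff.2 hε
  have : Nonempty (Fin n → Fin d) := ⟨fun _ => ⟨0, hd⟩⟩
  rw [L1loss, mul_comm, ← le_div_iff₀ hsn]
  refine ciSup_le fun X => ?_
  rw [expect_sum, le_div_iff₀ hsn]
  -- The smoothing width η√n is a small fraction of the standard deviation scale of the sum of the n
  -- errors.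
  have hx : ∀ x, expect P X (fun o => |symEstimator ε P p ps qs (freq o) x - freq X x|)
      ≤ 1 / n * (√(2 * (∑ i, symVar ps qs x (X i)) / Real.pi) + η * √(n : ℝ)
        + n * (3 / (η * √(n : ℝ)) ^ 2 * (c ^ 3 * (1 + gaussThird)))) := fun x => by
    have h1 := abs_clt_upper hc0 (w := fun i o => P o (X i)) (W := fun i o => symErr ε P p ps qs x (X i) o)
      (fun i o => h.mechanism.1 o (X i)) (fun i => h.mechanism.2 (X i))
      (fun i => h.mean_symErr x (X i)) (fun i o => hcb x (X i) o) (mul_pos hη hsn)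
    simp only [sq (symErr _ _ _ _ _ _ _ _), h.var_symErr] at h1
    simp only [symEstimator_sub_freq hn, abs_mul, abs_of_pos (one_div_pos.2 hn0)]
    rw [expect_eq_prodExp, prodExp_const_mul]
    exact mul_le_mul_of_nonneg_left h1 (one_div_pos.2 hn0).le
  have hvar : ∑ x, ∑ i, symVar ps qs x (X i) = n * (n * optL2 d ε n) := by
    have h2 := h.L2loss_of_one hε hd hn
    rw [h.L2loss_eq hd hn, div_eq_iff hn0.ne'] at h2
    rw [Finset.sum_comm]
    simp only [sum_symVar]
    rw [h2]
    simp only [Finset.sum_const, Finset.card_univ, Fintype.card_fin, nsmul_eq_mul]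
    ring
  -- Individual variances depend on the dataset, but their sum over x does not; Cauchy-Schwarz over
  -- the d coordinates needs only that sum.
  have hcs : ∑ x, √(2 * (∑ i, symVar ps qs x (X i)) / Real.pi) ≤ √(n : ℝ) * optL1const d ε := by
    have hnn : ∀ x, 0 ≤ 2 * (∑ i, symVar ps qs x (X i)) / Real.pi := fun x => by
      refine div_nonneg (mul_nonneg zero_le_two (Finset.sum_nonneg fun i _ => ?_)) Real.pi_pos.le
      rw [← h.var_symErr]
      exact Finset.sum_nonneg fun o _ => mul_nonneg (h.mechanism.1 o _) (mul_self_nonneg _)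
    have h4 : (∑ x, √(2 * (∑ i, symVar ps qs x (X i)) / Real.pi)) ^ 2
        ≤ d * ∑ x, √(2 * (∑ i, symVar ps qs x (X i)) / Real.pi) ^ 2 := by
      simpa using sq_sum_le_card_mul_sum_sq (s := (Finset.univ : Finset (Fin d)))
        (f := fun x => √(2 * (∑ i, symVar ps qs x (X i)) / Real.pi))
    simp only [Real.sq_sqrt (hnn _)] at h4
    rw [← Finset.sum_div, ← Finset.mul_sum, hvar] at h4
    refine (Real.le_sqrt_of_sq_le h4).trans (le_of_eq ?_)
    rw [optL1const_eq hε, optL2, ← Real.sqrt_mul hn0.le]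
    congr 1
    have : Real.exp ε - 1 ≠ 0 := by linarith
    field_simp
  have hsum := Finset.sum_le_sum fun x (_ : x ∈ Finset.univ) => hx x
  rw [← Finset.mul_sum, Finset.sum_add_distrib, Finset.sum_add_distrib] at hsum
  simp only [Finset.sum_const, Finset.card_univ, Fintype.card_fin, nsmul_eq_mul] at hsum
  refine (mul_le_mul_of_nonneg_right hsum hsn.le).trans ?_
  have e : (optL1const d ε + d * (η + 3 * (c ^ 3 * (1 + gaussThird)) / (η ^ 2 * √(n : ℝ))))
      = 1 / n * (√(n : ℝ) * optL1const d ε + d * (η * √(n : ℝ))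
        + d * (n * (3 / (η * √(n : ℝ)) ^ 2 * (c ^ 3 * (1 + gaussThird))))) * √(n : ℝ) := by
    generalize √(n : ℝ) = s at *
    rw [← hsn2]; field_simp; ring
  rw [e]
  gcongr

end LDPFreq

namespace LDPFreq

/-! ### A Bayesian lower bound for the absolute error -/

/-- Lets fluctuations under a square root be controlled by a variance. -/
theorem sqrt_le_add_sq_div {t δ : ℝ} (hδ : 0 < δ) : √|t| ≤ δ + t ^ 2 / δ ^ 3 := by
  have h0 : 0 ≤ t ^ 2 / δ ^ 3 := by positivity
  rcases le_total |t| (δ ^ 2) with h | h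
  · have : √|t| ≤ δ := by rw [Real.sqrt_le_left hδ.le]; exact h
    linarith
  · have h1 : √|t| ≤ t ^ 2 / δ ^ 3 := by
      rw [Real.sqrt_le_left h0, div_pow, le_div_iff₀ (by positivity), ← sq_abs t]
      calc |t| * (δ ^ 3) ^ 2 = |t| * (δ ^ 2) ^ 3 := by ring
        _ ≤ |t| * |t| ^ 3 := by gcongr
        _ = (|t| ^ 2) ^ 2 := by ring
    linarith

/-- Subadditivity of the square root, valid also for negative `a`, where `√a` is 0. Variance bounds
that have become negative are thus harmless. -/
theorem sqrt_sub_le (a b : ℝ) : √b - √|a - b| ≤ √a := by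
  have h2 : b ≤ a + |a - b| := by
    have := neg_abs_le (a - b); linarith
  rcases le_total 0 a with ha | ha
  · have : √b ≤ √a + √|a - b| := by
      rw [Real.sqrt_le_left (by positivity)]
      have h3 := Real.sq_sqrt ha
      have h4 := Real.sq_sqrt (abs_nonneg (a - b))
      have h5 := mul_nonneg (Real.sqrt_nonneg a) (Real.sqrt_nonneg |a - b|)
      nlinarith
    linarith
  · have : √b ≤ √|a - b| := by
      refine Real.sqrt_le_sqrt ?_
      rw [abs_sub_comm]
      exact le_trans (by linarith) (le_abs_self _)
    have := Real.sqrt_nonneg a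
    linarith

theorem weighted_mean_mem {α : Type*} [Fintype α] {w f : α → ℝ} (hw0 : ∀ b, 0 ≤ w b)
    (hw1 : ∑ b, w b = 1) (hf0 : ∀ b, 0 ≤ f b) (hf1 : ∀ b, f b ≤ 1) :
    0 ≤ ∑ b, w b * f b ∧ ∑ b, w b * f b ≤ 1 := by
  refine ⟨Finset.sum_nonneg fun b _ => mul_nonneg (hw0 b) (hf0 b), ?_⟩
  rw [← hw1]
  exact Finset.sum_le_sum fun b _ => mul_le_of_le_one_right (hw0 b) (hf1 b)

/-- The mean square root of a sum of independent variables with values in `[0, 1]`. -/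
theorem le_prodExp_sqrt_sum {Ω : Type*} [Fintype Ω] {p V : Ω → ℝ} (hp0 : ∀ ω, 0 ≤ p ω)
    (hp1 : ∑ ω, p ω = 1) (hV0 : ∀ ω, 0 ≤ V ω) (hV1 : ∀ ω, V ω ≤ 1) (N : ℕ) {δ : ℝ} (hδ : 0 < δ) :
    √(2 * (N * ∑ ω, p ω * V ω) / Real.pi) - (δ + N / δ ^ 3)
      ≤ prodExp (fun _ : Fin N => p) (fun ω => √(2 * (∑ i, V (ω i)) / Real.pi)) := by
  obtain ⟨r, hr⟩ : ∃ r, r = ∑ ω, p ω * V ω := ⟨_, rfl⟩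
  have hr01 : 0 ≤ r ∧ r ≤ 1 := by rw [hr]; exact weighted_mean_mem hp0 hp1 hV0 hV1
  rw [← hr]
  have hvar : prodExp (fun _ : Fin N => p) (fun ω => (∑ i, (V (ω i) - r)) ^ 2) ≤ N := by
    have h0 : ∑ ω, p ω * (V ω - r) = 0 := by
      simp only [mul_sub, Finset.sum_sub_distrib, ← Finset.sum_mul, hp1, ← hr]; ring
    simp only [sq]
    rw [prodExp_sum_mul_sum (fun _ => hp1) (fun _ ω => V ω - r) (fun _ ω => V ω - r) (fun _ => h0)]
    have : ∑ ω, p ω * ((V ω - r) * (V ω - r)) ≤ 1 :=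
      (weighted_mean_mem hp0 hp1 (fun ω => mul_self_nonneg _) fun ω => by
        have := hV0 ω; have := hV1 ω
        nlinarith [hr01.1, hr01.2]).2
    simpa using mul_le_mul_of_nonneg_left this (Nat.cast_nonneg N)
  have hpt : ∀ ω : Fin N → Ω, √(2 * (N * r) / Real.pi) - δ - 1 / δ ^ 3 * (∑ i, (V (ω i) - r)) ^ 2
      ≤ √(2 * (∑ i, V (ω i)) / Real.pi) := fun ω => by
    have h1 := sqrt_sub_le (2 * (∑ i, V (ω i)) / Real.pi) (2 * (N * r) / Real.pi)
    have h2 : √|2 * (∑ i, V (ω i)) / Real.pi - 2 * (N * r) / Real.pi| ≤ √|∑ i, (V (ω i) - r)| := by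
      refine Real.sqrt_le_sqrt ?_
      have : 2 * (∑ i, V (ω i)) / Real.pi - 2 * (N * r) / Real.pi
          = (2 / Real.pi) * ∑ i, (V (ω i) - r) := by
        simp only [Finset.sum_sub_distrib, Finset.sum_const, Finset.card_univ, Fintype.card_fin,
          nsmul_eq_mul]
        ring
      rw [this, abs_mul]
      refine mul_le_of_le_one_left (abs_nonneg _) ?_
      rw [abs_of_pos (div_pos two_pos Real.pi_pos), div_le_one Real.pi_pos]
      exact Real.two_le_pi
    have h3 := sqrt_le_add_sq_div (t := ∑ i, (V (ω i) - r)) hδ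
    rw [one_div_mul_eq_div]
    linarith
  have h4 := prodExp_mono (w := fun _ : Fin N => p) (fun _ => hp0) hpt
  rw [prodExp_sub, prodExp_const (fun _ => hp1), prodExp_const_mul] at h4
  have h5 := mul_le_mul_of_nonneg_left hvar (show 0 ≤ 1 / δ ^ 3 by positivity)
  rw [one_div_mul_eq_div, one_div_mul_eq_div] at h5
  rw [one_div_mul_eq_div] at h4
  linarith

/-- In `N` independent copies of a Bayesian experiment, with joint law `J` of the parameter and the
observation, the absolute error of estimating the sum of the parameters `θ` is asymptotically
at least that of a Gaussian law whose variance is `N` times the quadratic Bayes risk. -/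
theorem le_prodExp_abs_sub {Ξ Ω : Type*} [Fintype Ξ] [Fintype Ω] {J : Ξ × Ω → ℝ}
    (hJ0 : ∀ z, 0 ≤ J z) (hJ1 : ∑ z, J z = 1) {θ : Ξ → ℝ} (hθ0 : ∀ ξ, 0 ≤ θ ξ)
    (hθ1 : ∀ ξ, θ ξ ≤ 1) {r : ℝ} (hr : ∀ h : Ω → ℝ, r ≤ ∑ z, J z * (θ z.1 - h z.2) ^ 2) (N : ℕ)
    (H : (Fin N → Ω) → ℝ) {δ : ℝ} (hδ : 0 < δ) :
    √(2 * (N * r) / Real.pi) - (2 * δ + N / δ ^ 3 + N * (3 / δ ^ 2 * (1 + gaussThird)))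
      ≤ prodExp (fun _ : Fin N => J) (fun z => |H (fun i => (z i).2) - ∑ i, θ (z i).1|) := by
  obtain ⟨p, hp⟩ : ∃ p : Ω → ℝ, p = fun ω => ∑ ξ, J (ξ, ω) := ⟨_, rfl⟩
  obtain ⟨q, hq⟩ : ∃ q : Ω → Ξ → ℝ, q = fun ω ξ => J (ξ, ω) / p ω := ⟨_, rfl⟩
  -- Posterior mean and, next, posterior variance of the parameter. The hypothesis `hr` applied to
  -- `μ` bounds the mean posterior variance from below by r.
  obtain ⟨μ, hμ⟩ : ∃ μ : Ω → ℝ, μ = fun ω => ∑ ξ, q ω ξ * θ ξ := ⟨_, rfl⟩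
  obtain ⟨V, hV⟩ : ∃ V : Ω → ℝ, V = fun ω => ∑ ξ, q ω ξ * (μ ω - θ ξ) ^ 2 := ⟨_, rfl⟩
  have hp0 : ∀ ω, 0 ≤ p ω := fun ω => by rw [hp]; exact Finset.sum_nonneg fun ξ _ => hJ0 _
  have hp1 : ∑ ω, p ω = 1 := by
    rw [hp, ← hJ1, Fintype.sum_prod_type]; exact Finset.sum_comm
  have hJz : ∀ ω, p ω = 0 → ∀ ξ, J (ξ, ω) = 0 := fun ω h ξ => by
    rw [hp] at h
    exact (Finset.sum_eq_zero_iff_of_nonneg fun ξ _ => hJ0 _).1 h ξ (Finset.mem_univ ξ)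
  have hpq : ∀ ω ξ, J (ξ, ω) = p ω * q ω ξ := fun ω ξ => by
    by_cases h : p ω = 0
    · rw [h, hJz ω h, zero_mul]
    · rw [hq]; field_simp
  have hq0 : ∀ ω ξ, 0 ≤ q ω ξ := fun ω ξ => by rw [hq]; exact div_nonneg (hJ0 _) (hp0 ω)
  have hq1 : ∀ ω, p ω ≠ 0 → ∑ ξ, q ω ξ = 1 := fun ω h => by
    rw [hq]; simp only [← Finset.sum_div]; rw [div_eq_one_iff_eq h, hp]
  have hμ01 : ∀ ω, 0 ≤ μ ω ∧ μ ω ≤ 1 := fun ω => by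
    by_cases h : p ω = 0
    · have : μ ω = 0 := by rw [hμ, hq]; simp [h]
      rw [this]; exact ⟨le_rfl, zero_le_one⟩
    · rw [hμ]; exact weighted_mean_mem (hq0 ω) (hq1 ω h) hθ0 hθ1
  have hW : ∀ ω ξ, |μ ω - θ ξ| ≤ 1 := fun ω ξ => by
    have h1 := hμ01 ω; have h2 := hθ0 ξ; have h3 := hθ1 ξ
    rw [abs_le]; constructor <;> linarith
  have hV0 : ∀ ω, 0 ≤ V ω := fun ω => by
    rw [hV]; exact Finset.sum_nonneg fun ξ _ => mul_nonneg (hq0 ω ξ) (sq_nonneg _)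
  have hV1 : ∀ ω, V ω ≤ 1 := fun ω => by
    by_cases h : p ω = 0
    · have : V ω = 0 := by rw [hV, hq]; simp [h]
      rw [this]; exact zero_le_one
    · rw [hV]
      exact (weighted_mean_mem (hq0 ω) (hq1 ω h) (fun ξ => sq_nonneg _)
        (fun ξ => (sq_le_one_iff_abs_le_one _).2 (hW ω ξ))).2
  have hrV : r ≤ ∑ ω, p ω * V ω := by
    refine (hr μ).trans (le_of_eq ?_)
    rw [Fintype.sum_prod_type, Finset.sum_comm]
    refine Finset.sum_congr rfl fun ω _ => ?_
    rw [hV, Finset.mul_sum]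
    refine Finset.sum_congr rfl fun ξ _ => ?_
    rw [hpq]; ring
  obtain ⟨E, hE⟩ : ∃ E, E = δ + N * (3 / δ ^ 2 * (1 + gaussThird)) := ⟨_, rfl⟩
  have hcond : prodExp (fun _ : Fin N => p) (fun ω => √(2 * (∑ i, V (ω i)) / Real.pi) - E)
      ≤ prodExp (fun _ : Fin N => J) (fun z => |H (fun i => (z i).2) - ∑ i, θ (z i).1|) := by
    rw [prodExp, prodExp, sum_arrow_prod (fun (ξ : Fin N → Ξ) (ω : Fin N → Ω) =>
      (∏ i, J (ξ i, ω i)) * |H ω - ∑ i, θ (ξ i)|), Finset.sum_comm]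
    refine Finset.sum_le_sum fun ω _ => ?_
    -- Observations of probability zero have no posterior, since `q` is then 0 by division by zero;
    -- they carry no weight. Otherwise the parameters are independent given ω, and the central limit
    -- bound applies with the estimate as a shift.
    by_cases h : ∃ i, p (ω i) = 0
    · obtain ⟨i, hi⟩ := h
      rw [Finset.prod_eq_zero (Finset.mem_univ i) hi, zero_mul]
      exact Finset.sum_nonneg fun ξ _ => mul_nonneg (Finset.prod_nonneg fun i _ => hJ0 _)
        (abs_nonneg _)
    · push Not at h
      have h1 := abs_clt_lower zero_le_one (w := fun i ξ => q (ω i) ξ)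
        (W := fun i ξ => μ (ω i) - θ ξ) (fun i ξ => hq0 _ ξ) (fun i => hq1 _ (h i))
        (fun i => by
          simp only [mul_sub, Finset.sum_sub_distrib, ← Finset.sum_mul, hq1 _ (h i)]
          rw [hμ]; ring) (fun i ξ => hW _ ξ) hδ (H ω - ∑ i, μ (ω i))
      have h2 : ∑ ξ : Fin N → Ξ, (∏ i, J (ξ i, ω i)) * |H ω - ∑ i, θ (ξ i)|
          = (∏ i, p (ω i)) * prodExp (fun i ξ => q (ω i) ξ)
            (fun ξ => |H ω - ∑ i, μ (ω i) + ∑ i, (μ (ω i) - θ (ξ i))|) := by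
        rw [prodExp, Finset.mul_sum]
        refine Finset.sum_congr rfl fun ξ _ => ?_
        simp only [hpq, Finset.prod_mul_distrib, Finset.sum_sub_distrib]
        rw [mul_assoc, sub_add_sub_cancel]
      rw [h2]
      refine mul_le_mul_of_nonneg_left (le_trans (le_of_eq ?_) h1)
        (Finset.prod_nonneg fun i _ => hp0 _)
      rw [hE, hV]; ring
  have hs := le_prodExp_sqrt_sum hp0 hp1 hV0 hV1 N hδ
  rw [prodExp_sub, prodExp_const (fun _ => hp1)] at hcond
  have hm : √(2 * (N * r) / Real.pi) ≤ √(2 * (N * ∑ ω, p ω * V ω) / Real.pi) := by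
    have := Real.pi_pos
    gcongr
  linarith

end LDPFreq

namespace LDPFreq

/-! ### The van Trees inequality for a block of users -/

section single
variable {m d : ℕ} {P : Matrix (Fin m) (Fin d) ℝ} {p : Fin d → ℝ}

/-- The score of the response law in the direction of the input `x`. -/
noncomputable def respScore (p : Fin d → ℝ) (P : Matrix (Fin m) (Fin d) ℝ) (x : Fin d)
    (o : Fin m) : ℝ := (P o x - avgResp P o) / respLaw p P o

/-- The posterior probability of the input `x`. -/
noncomputable def posterior (p : Fin d → ℝ) (P : Matrix (Fin m) (Fin d) ℝ) (x : Fin d)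
    (o : Fin m) : ℝ := p x * P o x / respLaw p P o

theorem abs_respLaw_sub_le (hd : 1 ≤ d) (hP : IsMechanism P) {e : ℝ}
    (hp : ∀ y, |p y - 1 / d| ≤ e) (o : Fin m) :
    |respLaw p P o - avgResp P o| ≤ d * e * avgResp P o := by
  have hd0 : (d : ℝ) ≠ 0 := by positivity
  rw [← respLaw_uniform, respLaw, respLaw, ← Finset.sum_sub_distrib]
  refine (Finset.abs_sum_le_sum_abs _ _).trans ?_
  have h1 : ∀ y, |p y * P o y - 1 / d * P o y| ≤ e * P o y := fun y => by
    rw [← sub_mul, abs_mul, abs_of_nonneg (hP.1 o y)]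
    exact mul_le_mul_of_nonneg_right (hp y) (hP.1 o y)
  refine (Finset.sum_le_sum fun y _ => h1 y).trans (le_of_eq ?_)
  rw [← Finset.mul_sum, ← Finset.mul_sum]
  field_simp

theorem le_respLaw (hd : 1 ≤ d) (hP : IsMechanism P) {e : ℝ} (hp : ∀ y, |p y - 1 / d| ≤ e)
    (o : Fin m) : (1 - d * e) * avgResp P o ≤ respLaw p P o := by
  have := (abs_le.1 (abs_respLaw_sub_le hd hP hp o)).1
  linarith

theorem respLaw_le (hd : 1 ≤ d) (hP : IsMechanism P) {e : ℝ} (hp : ∀ y, |p y - 1 / d| ≤ e)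
    (o : Fin m) : respLaw p P o ≤ (1 + d * e) * avgResp P o := by
  have := (abs_le.1 (abs_respLaw_sub_le hd hP hp o)).2
  linarith

theorem avgResp_eq_zero_of_respLaw (hd : 1 ≤ d) (hP : IsMechanism P) {e : ℝ}
    (hp : ∀ y, |p y - 1 / d| ≤ e) (he : d * e ≤ 1 / 2) {o : Fin m} (h : respLaw p P o = 0) :
    avgResp P o = 0 := by
  have h1 := le_respLaw hd hP hp o
  have h2 := avgResp_nonneg hP o
  rw [h] at h1
  nlinarith

/-- Division by the response law costs little more than division by the uniform response law. -/
theorem div_respLaw_le (hd : 1 ≤ d) (hP : IsMechanism P) {e : ℝ} (he0 : 0 ≤ e)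
    (hp : ∀ y, |p y - 1 / d| ≤ e) (he : d * e ≤ 1 / 2) (o : Fin m) {t : ℝ} (ht : 0 ≤ t) :
    t / respLaw p P o ≤ (1 + 2 * (d * e)) * (t / avgResp P o) := by
  rcases (avgResp_nonneg hP o).eq_or_lt with h | h
  · have h1 := respLaw_le hd hP hp o
    have h2 := le_respLaw hd hP hp o
    rw [← h] at h1 h2
    have : respLaw p P o = 0 := by linarith
    rw [this, ← h]; simp
  · have h2 := le_respLaw hd hP hp o
    have hde : 0 ≤ d * e := by positivity
    have h3 : 0 < respLaw p P o := lt_of_lt_of_le (mul_pos (by linarith) h) h2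
    rw [← mul_div_assoc, div_le_div_iff₀ h3 h]
    have h4 : avgResp P o ≤ (1 + 2 * (d * e)) * respLaw p P o := by
      have h5 := mul_le_mul_of_nonneg_left h2 (show 0 ≤ 1 + 2 * (d * e) by positivity)
      nlinarith [mul_nonneg hde h.le, mul_nonneg (mul_nonneg hde (sub_nonneg.2 he)) h.le]
    nlinarith [mul_le_mul_of_nonneg_left h4 ht]

theorem sum_sq_div_respLaw_le (hd : 1 ≤ d) (hP : IsMechanism P) {e : ℝ} (he0 : 0 ≤ e)
    (hp : ∀ y, |p y - 1 / d| ≤ e) (he : d * e ≤ 1 / 2) (x : Fin d) :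
    ∑ o, P o x ^ 2 / respLaw p P o ≤ (1 + 2 * (d * e)) * (chiSq P x + 1) := by
  rw [chiSq, sub_add_cancel, Finset.mul_sum]
  exact Finset.sum_le_sum fun o _ => div_respLaw_le hd hP he0 hp he o (sq_nonneg _)

/-- For the uniform law the Fisher information is exactly `chiSq P x`. Here and in the next two
estimates the extra terms are first-order perturbations in e with constants depending only on d,
hence uniform over mechanisms. -/
theorem fisher_le (hd : 1 ≤ d) (hP : IsMechanism P) {e : ℝ} (he0 : 0 ≤ e)
    (hp : ∀ y, |p y - 1 / d| ≤ e) (he : d * e ≤ 1 / 2) (x : Fin d) :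
    ∑ o, respLaw p P o * respScore p P x o ^ 2 ≤ chiSq P x + 2 * d ^ 2 * e := by
  have h1 : ∀ o, respLaw p P o * respScore p P x o ^ 2
      = (P o x - avgResp P o) ^ 2 / respLaw p P o := fun o => by
    rw [respScore]
    by_cases h : respLaw p P o = 0
    · simp [h]
    · field_simp
  have h2 : ∑ o, respLaw p P o * respScore p P x o ^ 2 ≤ (1 + 2 * (d * e)) * chiSq P x := by
    rw [chiSq_eq hd hP, Finset.mul_sum]
    refine Finset.sum_le_sum fun o _ => ?_
    rw [h1]
    exact div_respLaw_le hd hP he0 hp he o (sq_nonneg _)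
  have h3 := chiSq_le hd hP x
  have h4 : 0 ≤ d * e := by positivity
  nlinarith [mul_le_mul_of_nonneg_left h3 h4]

theorem cross_le (hd : 1 ≤ d) (hP : IsMechanism P) {e : ℝ} (he0 : 0 ≤ e)
    (hp : ∀ y, |p y - 1 / d| ≤ e) (he : d * e ≤ 1 / 2) (x : Fin d) :
    p x * ∑ o, P o x * respScore p P x o ≤ chiSq P x / d + 6 * d * e := by
  have hd1 : (1 : ℝ) ≤ d := by exact_mod_cast hd
  have hd0 : (0 : ℝ) < d := by linarith
  have hde : 0 ≤ d * e := by positivity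
  have h1 : ∑ o, (1 - d * e) * P o x ≤ ∑ o, P o x * avgResp P o / respLaw p P o := by
    refine Finset.sum_le_sum fun o _ => ?_
    by_cases h : respLaw p P o = 0
    · rw [eq_zero_of_avgResp_eq_zero hd hP (avgResp_eq_zero_of_respLaw hd hP hp he h)]; simp
    · have h2 := respLaw_le hd hP hp o
      have h5 := le_respLaw hd hP hp o
      have h6 := avgResp_nonneg hP o
      have h3 : 0 < respLaw p P o := lt_of_le_of_ne (le_trans (mul_nonneg (by linarith) h6) h5)
        (Ne.symm h)
      rw [le_div_iff₀ h3, mul_comm (1 - d * e), mul_assoc]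
      refine mul_le_mul_of_nonneg_left ?_ (hP.1 o x)
      nlinarith [mul_le_mul_of_nonneg_left h2 (show 0 ≤ 1 - d * e by linarith),
        mul_nonneg (mul_nonneg hde hde) h6]
  rw [← Finset.mul_sum, hP.2, mul_one] at h1
  have h2 := sum_sq_div_respLaw_le hd hP he0 hp he x
  have h3 : ∑ o, P o x * respScore p P x o
      = ∑ o, P o x ^ 2 / respLaw p P o - ∑ o, P o x * avgResp P o / respLaw p P o := by
    rw [← Finset.sum_sub_distrib]
    refine Finset.sum_congr rfl fun o _ => ?_
    rw [respScore]; ring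
  have h4 := chiSq_le hd hP x
  have h0 := chiSq_nonneg hd hP x
  have h5 : ∑ o, P o x * respScore p P x o ≤ chiSq P x + 3 * (d * (d * e)) := by
    rw [h3]
    nlinarith [mul_le_mul_of_nonneg_left h4 hde, mul_le_mul_of_nonneg_left hd1 hde]
  obtain ⟨h6, h7⟩ := abs_le.1 (hp x)
  have h8 : e ≤ 1 / (2 * d) := by rw [le_div_iff₀ (by positivity)]; linarith
  have h10 : (1 : ℝ) / d = 2 * (1 / (2 * d)) := by field_simp
  have h9 : 0 ≤ p x := by
    have : 0 < 1 / (2 * (d : ℝ)) := by positivity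
    linarith
  calc p x * ∑ o, P o x * respScore p P x o ≤ p x * (chiSq P x + 3 * (d * (d * e))) :=
        mul_le_mul_of_nonneg_left h5 h9
    _ ≤ (1 / d + e) * (chiSq P x + 3 * (d * (d * e))) :=
        mul_le_mul_of_nonneg_right (by linarith) (by positivity)
    _ = chiSq P x / d + e * chiSq P x + 3 * (d * e) + 3 * (d * e) * (d * e) := by
        field_simp; ring
    _ ≤ chiSq P x / d + 6 * d * e := by
        nlinarith [mul_le_mul_of_nonneg_left h4 he0, mul_le_mul_of_nonneg_left he hde]

theorem le_postVar (hd : 1 ≤ d) (hP : IsMechanism P) {e : ℝ} (he0 : 0 ≤ e)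
    (hp : ∀ y, |p y - 1 / d| ≤ e) (he : d * e ≤ 1 / 2) (x : Fin d) :
    (1 - 1 / d) / d - chiSq P x / d ^ 2 - 8 * e ≤ p x - p x * ∑ o, P o x * posterior p P x o := by
  have hd1 : (1 : ℝ) ≤ d := by exact_mod_cast hd
  have hd0 : (0 : ℝ) < d := by linarith
  have hde : 0 ≤ d * e := by positivity
  obtain ⟨h6, h7⟩ := abs_le.1 (hp x)
  have h8 : e ≤ 1 / (2 * d) := by rw [le_div_iff₀ (by positivity)]; linarith
  have h10 : (1 : ℝ) / d = 2 * (1 / (2 * d)) := by field_simp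
  have h9 : 0 ≤ p x := by
    have : 0 < 1 / (2 * (d : ℝ)) := by positivity
    linarith
  have h2 := sum_sq_div_respLaw_le hd hP he0 hp he x
  have h4 := chiSq_le hd hP x
  have h0 := chiSq_nonneg hd hP x
  have h3 : p x * ∑ o, P o x * posterior p P x o = p x ^ 2 * ∑ o, P o x ^ 2 / respLaw p P o := by
    rw [Finset.mul_sum, Finset.mul_sum]
    refine Finset.sum_congr rfl fun o _ => ?_
    rw [posterior]; ring
  rw [h3]
  have h5 : p x ^ 2 * ∑ o, P o x ^ 2 / respLaw p P o
      ≤ (1 / d + e) ^ 2 * ((1 + 2 * (d * e)) * (chiSq P x + 1)) := by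
    refine mul_le_mul (pow_le_pow_left₀ h9 (by linarith) 2) h2 ?_ (by positivity)
    exact Finset.sum_nonneg fun o _ => div_nonneg (sq_nonneg _)
      (le_trans (mul_nonneg (by linarith) (avgResp_nonneg hP o)) (le_respLaw hd hP hp o))
  have h11 : (1 / d + e) ^ 2 * ((1 + 2 * (d * e)) * (chiSq P x + 1))
      = (chiSq P x + 1) / d ^ 2
        + e * ((chiSq P x + 1) / d) * (4 + 5 * (d * e) + 2 * (d * e) ^ 2) := by
    field_simp; ring
  have h12 : (chiSq P x + 1) / d ≤ 1 := by rw [div_le_one hd0]; linarith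
  have h13 : 4 + 5 * (d * e) + 2 * (d * e) ^ 2 ≤ 7 := by nlinarith
  have h14 : e * ((chiSq P x + 1) / d) * (4 + 5 * (d * e) + 2 * (d * e) ^ 2) ≤ e * 1 * 7 := by
    gcongr
  have h15 : (1 - 1 / d) / d - chiSq P x / d ^ 2 = 1 / d - (chiSq P x + 1) / (d : ℝ) ^ 2 := by
    field_simp; ring
  rw [h15]
  linarith

/-- The quadratic error of any function `h` of the responses, for independent inputs of law `p`,
tested against a combination of the score and the deviation from the posterior mean. -/
theorem block_test_le (hd : 1 ≤ d) (hP : IsMechanism P) (hp0 : ∀ y, 0 ≤ p y) (hp1 : ∑ y, p y = 1)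
    (hz : ∀ o, respLaw p P o = 0 → avgResp P o = 0)
    (x : Fin d) {B : ℕ} (hB : 1 ≤ B) (h : (Fin B → Fin m) → ℝ) (a a' α : ℝ) :
    2 * α * (2 * a * a' * (prodExp (fun _ : Fin B => respLaw p P) h - √(B : ℝ) * p x)
        + a ^ 2 / √(B : ℝ) * prodExp (fun _ : Fin B => respLaw p P)
          (fun ω => h ω * ∑ i, respScore p P x (ω i)))
      + a ^ 2 * (-(2 * α) * (p x * ∑ o, P o x * respScore p P x o)
        + (p x - p x * ∑ o, P o x * posterior p P x o)
        - α ^ 2 * ∑ o, respLaw p P o * respScore p P x o ^ 2) - 4 * α ^ 2 * a' ^ 2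
    ≤ a ^ 2 * prodExp (fun _ : Fin B => fun z : Fin d × Fin m => p z.1 * P z.2 z.1)
      (fun z => (√(B : ℝ) * freq (fun i => (z i).1) x - h (fun i => (z i).2)) ^ 2) := by
  have hB0 : (0 : ℝ) < B := by positivity
  obtain ⟨s, hs⟩ : ∃ s, s = √(B : ℝ) := ⟨_, rfl⟩
  have hs0 : 0 < s := by rw [hs]; exact Real.sqrt_pos.2 hB0
  have hs2 : s * s = B := by rw [hs]; exact Real.mul_self_sqrt hB0.le
  obtain ⟨w, hw⟩ : ∃ w : Fin d × Fin m → ℝ, w = fun z => p z.1 * P z.2 z.1 := ⟨_, rfl⟩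
  obtain ⟨Q, hQ⟩ : ∃ Q, Q = respLaw p P := ⟨_, rfl⟩
  obtain ⟨σ, hσ⟩ : ∃ σ, σ = respScore p P x := ⟨_, rfl⟩
  obtain ⟨ρ, hρ⟩ : ∃ ρ, ρ = posterior p P x := ⟨_, rfl⟩
  obtain ⟨δ, hδ⟩ : ∃ δ : Fin d → ℝ, δ = fun y => if y = x then 1 else 0 := ⟨_, rfl⟩
  have hws : ∑ z, w z = 1 := by rw [hw]; exact sum_joint_one hp1 hP
  have hwn : ∀ z, 0 ≤ w z := fun z => by rw [hw]; exact mul_nonneg (hp0 _) (hP.1 _ _)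
  have S1 : ∀ v : Fin m → ℝ, ∑ z, w z * v z.2 = ∑ o, Q o * v o := fun v => by
    rw [hw, hQ]; exact sum_joint_snd p P v
  have S2 : ∀ v : Fin m → ℝ, ∑ z, w z * (δ z.1 * v z.2) = p x * ∑ o, P o x * v o := fun v => by
    rw [hw, hδ]; exact sum_joint_ite p P x v
  have hQσ : ∀ o, Q o * σ o = P o x - avgResp P o := fun o => by
    rw [hσ, respScore, ← hQ]
    by_cases h0 : Q o = 0
    · have h1 := hz o (by rw [← hQ]; exact h0)
      rw [h0, h1, eq_zero_of_avgResp_eq_zero hd hP h1]; simp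
    · field_simp
  have hQρ : ∀ o, Q o * ρ o = p x * P o x := fun o => by
    rw [hρ, posterior, ← hQ]
    by_cases h0 : Q o = 0
    · have h1 := hz o (by rw [← hQ]; exact h0)
      rw [h0, eq_zero_of_avgResp_eq_zero hd hP h1]; simp
    · field_simp
  have hδδ : ∀ y, δ y * δ y = δ y := fun y => by rw [hδ]; simp
  obtain ⟨κ₁, hκ₁⟩ : ∃ κ₁, κ₁ = p x * ∑ o, P o x * σ o := ⟨_, rfl⟩
  obtain ⟨κ₂, hκ₂⟩ : ∃ κ₂, κ₂ = p x - p x * ∑ o, P o x * ρ o := ⟨_, rfl⟩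
  obtain ⟨κ₃, hκ₃⟩ : ∃ κ₃, κ₃ = ∑ o, Q o * σ o ^ 2 := ⟨_, rfl⟩
  have E1 : ∑ z, w z * δ z.1 = p x := by
    have := S2 (fun _ => 1); simpa [hP.2] using this
  have Eσ : ∑ z, w z * σ z.2 = 0 := by
    rw [S1]
    simp [hQσ, hP.2, sum_avgResp hd hP]
  have Eσ2 : ∑ z, w z * σ z.2 ^ 2 = κ₃ := by rw [S1 (fun o => σ o ^ 2), hκ₃]
  have Eρ : ∑ z, w z * ρ z.2 = p x := by
    rw [S1]; simp [hQρ, ← Finset.mul_sum, hP.2]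
  have Eδσ : ∑ z, w z * (δ z.1 * σ z.2) = κ₁ := by rw [S2, hκ₁]
  have Eδρ : ∑ z, w z * (δ z.1 * ρ z.2) = p x - κ₂ := by rw [S2, hκ₂]; ring
  have Eρ2 : ∑ z, w z * ρ z.2 ^ 2 = p x - κ₂ := by
    rw [S1 (fun o => ρ o ^ 2), hκ₂, sub_sub_cancel, Finset.mul_sum]
    exact Finset.sum_congr rfl fun o _ => by rw [sq, ← mul_assoc, hQρ]; ring
  have Eσρ : ∑ z, w z * (σ z.2 * ρ z.2) = κ₁ := by
    rw [S1 (fun o => σ o * ρ o), hκ₁, Finset.mul_sum]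
    exact Finset.sum_congr rfl fun o _ => by rw [mul_left_comm, hQρ]; ring
  -- With prior density a² in the direction of the tilt, -2αa' minus the σ-part is -α times a times
  -- the score of the joint density. The second part is the deviation of the input indicator from
  -- its posterior mean, which accounts for the randomness of the frequency given the law.
  obtain ⟨χ, hχ⟩ : ∃ χ : Fin d × Fin m → ℝ,
    χ = fun z => -(α * a) * σ z.2 + a * (δ z.1 - ρ z.2) := ⟨_, rfl⟩
  have hχ0 : ∑ z, w z * χ z = 0 := by
    have : ∀ z, w z * χ z = -(α * a) * (w z * σ z.2) + a * (w z * δ z.1) - a * (w z * ρ z.2) :=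
      fun z => by rw [hχ]; ring
    simp only [this, Finset.sum_sub_distrib, Finset.sum_add_distrib, ← Finset.mul_sum, Eσ, E1, Eρ]
    ring
  have hδχ : ∑ z, w z * (δ z.1 * χ z) = a * (-α * κ₁ + κ₂) := by
    have : ∀ z, w z * (δ z.1 * χ z) = -(α * a) * (w z * (δ z.1 * σ z.2)) + a * (w z * δ z.1)
        - a * (w z * (δ z.1 * ρ z.2)) := fun z => by
      rw [hχ]; linear_combination w z * a * hδδ z.1
    simp only [this, Finset.sum_sub_distrib, Finset.sum_add_distrib, ← Finset.mul_sum, Eδσ, E1, Eδρ]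
    ring
  have hχ2 : ∑ z, w z * (χ z * χ z) = a ^ 2 * (α ^ 2 * κ₃ + κ₂) := by
    have : ∀ z, w z * (χ z * χ z) = (α * a) ^ 2 * (w z * σ z.2 ^ 2) + a ^ 2 * (w z * δ z.1)
        + a ^ 2 * (w z * ρ z.2 ^ 2) - 2 * a ^ 2 * (w z * (δ z.1 * ρ z.2))
        - 2 * α * a ^ 2 * (w z * (δ z.1 * σ z.2)) + 2 * α * a ^ 2 * (w z * (σ z.2 * ρ z.2)) :=
      fun z => by rw [hχ]; linear_combination w z * a ^ 2 * hδδ z.1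
    simp only [this, Finset.sum_sub_distrib, Finset.sum_add_distrib, ← Finset.mul_sum, Eδσ, E1, Eδρ,
      Eσ2, Eρ2, Eσρ]
    ring
  -- The posterior deviation is orthogonal to `h`, so `h` enters only through its mean and its
  -- covariance with the score; these combine to a derivative along the line.
  have horth := prodExp_mul_sum_eq_zero (ι := Fin B) w (fun z => δ z.1 - ρ z.2) (fun o => by
    have : ∀ y, w (y, o) * (δ y - ρ o) = (p y * P o y) * δ y - ρ o * (p y * P o y) := fun y => by
      rw [hw]; ring
    simp only [this, Finset.sum_sub_distrib, ← Finset.mul_sum]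
    rw [show ∑ y, p y * P o y = Q o by rw [hQ]; rfl, mul_comm (ρ o), hQρ, hδ]
    simp) h
  have hmarg : ∀ F : (Fin B → Fin m) → ℝ,
      prodExp (fun _ : Fin B => w) (fun z => F (fun i => (z i).2)) = prodExp (fun _ : Fin B => Q) F := by
    intro F
    rw [hw]
    have := prodExp_joint (fun (_ : Fin B) y => p y) (fun _ y o => P o y) (fun _ => F)
    rw [this, hQ]
    simp only [prodExp, Finset.mul_sum]
    rw [Finset.sum_comm]
    refine Finset.sum_congr rfl fun ω _ => ?_
    simp only [respLaw]
    rw [← sum_prod_apply (fun i y => p y * P (ω i) y), Finset.sum_mul]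
    refine Finset.sum_congr rfl fun X _ => ?_
    rw [Finset.prod_mul_distrib, mul_assoc]
  have hfreq : ∀ z : Fin B → Fin d × Fin m,
      √(B : ℝ) * freq (fun i => (z i).1) x = 1 / s * ∑ i, δ (z i).1 := fun z => by
    rw [freq_eq, ← hs, ← hs2, hδ]; field_simp
  have k1 : p x * ∑ o, P o x * respScore p P x o = κ₁ := by rw [hκ₁, hσ]
  have k2 : p x - p x * ∑ o, P o x * posterior p P x o = κ₂ := by rw [hκ₂, hρ]
  have k3 : ∑ o, respLaw p P o * respScore p P x o ^ 2 = κ₃ := by rw [hκ₃, hσ, hQ]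
  rw [k1, k2, k3, ← hw, ← hσ, ← hQ]
  simp only [hfreq]
  rw [← hs]
  have hcs := prodExp_cauchy (w := fun _ : Fin B => w) (fun _ z => hwn z)
    (fun z => a * (1 / s * ∑ i, δ (z i).1 - h (fun i => (z i).2)))
    (fun z => -(2 * α * a') + 1 / s * ∑ i, χ (z i))
  have hcross : prodExp (fun _ : Fin B => w)
      (fun z => a * (1 / s * ∑ i, δ (z i).1 - h (fun i => (z i).2))
        * (-(2 * α * a') + 1 / s * ∑ i, χ (z i)))
      = -(2 * α * a * a') * (s * p x - prodExp (fun _ : Fin B => Q) h)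
        + a ^ 2 * (-α * κ₁ + κ₂)
        + α * a ^ 2 / s * prodExp (fun _ : Fin B => Q) (fun ω => h ω * ∑ i, σ (ω i)) := by
    have : ∀ z : Fin B → Fin d × Fin m, a * (1 / s * ∑ i, δ (z i).1 - h (fun i => (z i).2))
        * (-(2 * α * a') + 1 / s * ∑ i, χ (z i))
        = (((-(2 * α * a * a') / s) * ∑ i, δ (z i).1) + (2 * α * a * a') * h (fun i => (z i).2))
          + (((a * (1 / s) ^ 2) * ((∑ i, δ (z i).1) * ∑ i, χ (z i))
          + (α * a ^ 2 / s) * (h (fun i => (z i).2) * ∑ i, σ (z i).2))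
          - (a ^ 2 / s) * (h (fun i => (z i).2) * ∑ i, (δ (z i).1 - ρ (z i).2))) := fun z => by
      have e1 : ∑ i, χ (z i) = -(α * a) * ∑ i, σ (z i).2 + a * ∑ i, (δ (z i).1 - ρ (z i).2) := by
        rw [Finset.mul_sum, Finset.mul_sum, ← Finset.sum_add_distrib]
        exact Finset.sum_congr rfl fun i _ => by rw [hχ]
      generalize ∑ i, (δ (z i).1 - ρ (z i).2) = q1 at *
      generalize ∑ i, χ (z i) = q2 at *
      field_simp
      rw [e1]; ring
    simp only [this]
    rw [prodExp_add, prodExp_add, prodExp_sub, prodExp_add]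
    simp only [prodExp_const_mul]
    rw [horth, hmarg h, hmarg (fun ω => h ω * ∑ i, σ (ω i)),
      prodExp_sum_mul_sum (fun _ => hws) (fun _ z => δ z.1) (fun _ => χ) (fun _ => hχ0), hδχ,
      prodExp_sum_coord (fun _ => hws) (fun _ z => δ z.1), E1]
    simp only [Finset.sum_const, Finset.card_univ, Fintype.card_fin, nsmul_eq_mul, ← hs2]
    field_simp
    ring
  have hsq : prodExp (fun _ : Fin B => w) (fun z => (-(2 * α * a') + 1 / s * ∑ i, χ (z i)) ^ 2)
      = 4 * α ^ 2 * a' ^ 2 + a ^ 2 * (α ^ 2 * κ₃ + κ₂) := by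
    have : ∀ z : Fin B → Fin d × Fin m, (-(2 * α * a') + 1 / s * ∑ i, χ (z i)) ^ 2
        = (4 * α ^ 2 * a' ^ 2 + (-(4 * α * a') / s) * ∑ i, χ (z i))
          + (1 / s) ^ 2 * ((∑ i, χ (z i)) * ∑ i, χ (z i)) := fun z => by field_simp; ring
    simp only [this]
    rw [prodExp_add, prodExp_add, prodExp_const (fun _ => hws)]
    simp only [prodExp_const_mul]
    rw [prodExp_sum_mul_sum (fun _ => hws) (fun _ => χ) (fun _ => χ) (fun _ => hχ0), hχ2,
      prodExp_sum_coord (fun _ => hws) (fun _ => χ), hχ0]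
    simp only [Finset.sum_const, Finset.card_univ, Fintype.card_fin, nsmul_eq_mul, ← hs2]
    field_simp
    ring
  rw [hcross, hsq] at hcs
  simp only [mul_pow, prodExp_const_mul] at hcs
  refine le_trans (le_of_eq ?_) hcs
  ring

end single
end LDPFreq

/-! ### The van Trees inequality along a line of input laws -/

namespace LDPFreq
open MeasureTheory

section line
variable {m d : ℕ} {P : Matrix (Fin m) (Fin d) ℝ}

/-- The line of input laws through `β` along which the probability of `x` increases. -/
noncomputable def tiltLine (β : Fin d → ℝ) (s : ℝ) (x : Fin d) (τ : ℝ) (y : Fin d) : ℝ :=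
  β y + τ * s * ((if y = x then 1 else 0) - 1 / d)

theorem sum_tiltLine (hd : 1 ≤ d) {β : Fin d → ℝ} (hβ : ∑ y, β y = 1) (s : ℝ) (x : Fin d) (τ : ℝ) :
    ∑ y, tiltLine β s x τ y = 1 := by
  have hd0 : (d : ℝ) ≠ 0 := by positivity
  simp only [tiltLine, Finset.sum_add_distrib, hβ, ← Finset.mul_sum, Finset.sum_sub_distrib]
  simp [hd0]

theorem hasDerivAt_tiltLine (β : Fin d → ℝ) (s : ℝ) (x y : Fin d) (τ : ℝ) :
    HasDerivAt (fun τ => tiltLine β s x τ y) (s * ((if y = x then 1 else 0) - 1 / d)) τ := by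
  have := (((hasDerivAt_id τ).mul_const s).mul_const
    ((if y = x then (1 : ℝ) else 0) - 1 / d)).const_add (β y)
  simpa [tiltLine] using this

theorem hasDerivAt_respLaw_tiltLine (β : Fin d → ℝ) (s : ℝ) (x : Fin d) (o : Fin m) (τ : ℝ) :
    HasDerivAt (fun τ => respLaw (tiltLine β s x τ) P o) (s * (P o x - avgResp P o)) τ := by
  have := HasDerivAt.fun_sum (u := Finset.univ)
    (fun y _ => (hasDerivAt_tiltLine β s x y τ).mul_const (P o y))
  refine this.congr_deriv ?_
  have e : ∀ y, s * ((if y = x then (1 : ℝ) else 0) - 1 / d) * P o y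
      = s * (P o y * (if y = x then 1 else 0)) - s * (1 / d) * P o y := fun y => by ring
  simp only [e, Finset.sum_sub_distrib, ← Finset.mul_sum, avgResp]
  simp
  ring

theorem hasDerivAt_prodExp_respLaw (hd : 1 ≤ d) (hP : IsMechanism P) {β : Fin d → ℝ} {s : ℝ}
    {x : Fin d} {τ : ℝ} (hz : ∀ o, respLaw (tiltLine β s x τ) P o = 0 → avgResp P o = 0) {B : ℕ}
    (h : (Fin B → Fin m) → ℝ) :
    HasDerivAt (fun τ => prodExp (fun _ : Fin B => respLaw (tiltLine β s x τ) P) h)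
      (s * prodExp (fun _ : Fin B => respLaw (tiltLine β s x τ) P)
        (fun ω => h ω * ∑ i, respScore (tiltLine β s x τ) P x (ω i))) τ := by
  have h1 : ∀ ω : Fin B → Fin m, HasDerivAt
      (fun τ => ∏ i, respLaw (tiltLine β s x τ) P (ω i))
      ((∏ i, respLaw (tiltLine β s x τ) P (ω i))
        * (s * ∑ i, respScore (tiltLine β s x τ) P x (ω i))) τ := fun ω => by
    have := HasDerivAt.fun_finsetProd (u := Finset.univ)
      (fun (i : Fin B) _ => hasDerivAt_respLaw_tiltLine (P := P) β s x (ω i) τ)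
    refine this.congr_deriv ?_
    rw [Finset.mul_sum, Finset.mul_sum]
    refine Finset.sum_congr rfl fun i _ => ?_
    rw [smul_eq_mul, ← Finset.mul_prod_erase _ _ (Finset.mem_univ i), respScore]
    by_cases h0 : respLaw (tiltLine β s x τ) P (ω i) = 0
    · have h2 := hz _ h0
      rw [h0, h2, eq_zero_of_avgResp_eq_zero hd hP h2]; simp
    · field_simp
  have h2 := HasDerivAt.fun_sum (u := Finset.univ) (fun ω _ => (h1 ω).mul_const (h ω))
  refine h2.congr_deriv ?_
  rw [prodExp, Finset.mul_sum]
  exact Finset.sum_congr rfl fun ω _ => by ring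

theorem continuous_prodExp_tiltLine (β : Fin d → ℝ) (s : ℝ) (x : Fin d) {B : ℕ}
    (F : (Fin B → Fin d × Fin m) → ℝ) :
    Continuous fun τ => prodExp (fun _ : Fin B => fun z : Fin d × Fin m =>
      tiltLine β s x τ z.1 * P z.2 z.1) F := by
  unfold prodExp tiltLine
  fun_prop

/-- The lower bound for the quadratic risk in the van Trees inequality, with prior information `I`
and closeness `e` to the uniform law. -/
noncomputable def vanTreesBound (d : ℕ) (α b I e : ℝ) : ℝ :=
  2 * α * (1 - 1 / d - b / d) + ((1 - 1 / d) / d - b / d ^ 2) - α ^ 2 * (b + I)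
    - e * (8 + 12 * α * d + 2 * α ^ 2 * d ^ 2)

/-- Integrate the tested inequality over the line. The terms containing `h` form a total derivative
up to the known speed 1 - 1/d of the scaled probability of x, and boundary terms vanish because
a(±T) = 0. Prior information 4∫a'² is added to the Fisher information. -/
theorem vanTrees_line (hd : 1 ≤ d) (hP : IsMechanism P) (x : Fin d) {B : ℕ} (hB : 1 ≤ B)
    {β : Fin d → ℝ} (hβ : ∑ y, β y = 1) {T e : ℝ} (hT : 0 < T) (he0 : 0 ≤ e) (he : d * e ≤ 1 / 2)
    (hβe : ∀ τ ∈ Set.Icc (-T) T, ∀ y, |tiltLine β (1 / √(B : ℝ)) x τ y - 1 / d| ≤ e)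
    {a a' : ℝ → ℝ} (ha : ∀ τ, HasDerivAt a (a' τ) τ) (ha' : Continuous a') (haT : a T = 0)
    (haT' : a (-T) = 0) {I : ℝ} (ha1 : ∫ τ in -T..T, a τ ^ 2 = 1)
    (haI : ∫ τ in -T..T, 4 * a' τ ^ 2 = I) {α b : ℝ} (hα : 0 ≤ α) (hb : chiSq P x ≤ b)
    (h : (Fin B → Fin m) → ℝ) :
    vanTreesBound d α b I e ≤ ∫ τ in -T..T, a τ ^ 2 * prodExp (fun _ : Fin B =>
        fun z : Fin d × Fin m => tiltLine β (1 / √(B : ℝ)) x τ z.1 * P z.2 z.1)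
      (fun z => (√(B : ℝ) * freq (fun i => (z i).1) x - h (fun i => (z i).2)) ^ 2) := by
  have hB0 : (0 : ℝ) < B := by positivity
  have hd0 : (0 : ℝ) < d := by positivity
  have hs0 : 0 < √(B : ℝ) := Real.sqrt_pos.2 hB0
  obtain ⟨R, hR⟩ : ∃ R : ℝ → ℝ, R = fun τ => prodExp (fun _ : Fin B =>
      fun z : Fin d × Fin m => tiltLine β (1 / √(B : ℝ)) x τ z.1 * P z.2 z.1)
      (fun z => (√(B : ℝ) * freq (fun i => (z i).1) x - h (fun i => (z i).2)) ^ 2) := ⟨_, rfl⟩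
  have hRc : Continuous R := by rw [hR]; exact continuous_prodExp_tiltLine _ _ _ _
  have hac : Continuous a := continuous_iff_continuousAt.2 fun τ => (ha τ).continuousAt
  obtain ⟨c, hc⟩ : ∃ c, c = 2 * α * (1 - 1 / d - b / d) + ((1 - 1 / d) / d - b / d ^ 2)
    - α ^ 2 * b - e * (8 + 12 * α * d + 2 * α ^ 2 * d ^ 2) := ⟨_, rfl⟩
  -- The antiderivative: 2αa² times the scaled bias of `h` at the law with parameter τ.
  obtain ⟨g, hg⟩ : ∃ g : ℝ → ℝ, g = fun τ => 2 * α * (a τ ^ 2 *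
    (prodExp (fun _ : Fin B => respLaw (tiltLine β (1 / √(B : ℝ)) x τ) P) h
      - √(B : ℝ) * tiltLine β (1 / √(B : ℝ)) x τ x)) := ⟨_, rfl⟩
  have hz : ∀ τ ∈ Set.Icc (-T) T, ∀ o, respLaw (tiltLine β (1 / √(B : ℝ)) x τ) P o = 0 →
      avgResp P o = 0 := fun τ hτ o => avgResp_eq_zero_of_respLaw hd hP (hβe τ hτ) he
  have hder : ∀ τ ∈ Set.Icc (-T) T, HasDerivAt g (2 * α * (2 * a τ * a' τ *
      (prodExp (fun _ : Fin B => respLaw (tiltLine β (1 / √(B : ℝ)) x τ) P) h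
        - √(B : ℝ) * tiltLine β (1 / √(B : ℝ)) x τ x)
      + a τ ^ 2 * ((1 / √(B : ℝ)) * prodExp (fun _ : Fin B =>
          respLaw (tiltLine β (1 / √(B : ℝ)) x τ) P)
        (fun ω => h ω * ∑ i, respScore (tiltLine β (1 / √(B : ℝ)) x τ) P x (ω i))
        - (1 - 1 / d)))) τ := fun τ hτ => by
    have h1 := hasDerivAt_prodExp_respLaw hd hP (hz τ hτ) h
    have h2 := (hasDerivAt_tiltLine β (1 / √(B : ℝ)) x x τ).const_mul √(B : ℝ)
    have h3 := ((((ha τ).pow 2).mul (h1.sub h2)).const_mul (2 * α))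
    rw [hg]
    refine h3.congr_deriv ?_
    simp only [Pi.pow_apply, Pi.sub_apply, if_true]
    push_cast
    field_simp
  have hle : g T - g (-T) ≤ ∫ τ in -T..T, (a τ ^ 2 * R τ - c * a τ ^ 2 + α ^ 2 * (4 * a' τ ^ 2)) := by
    refine intervalIntegral.sub_le_integral_of_hasDeriv_right_of_le (by linarith)
      (fun τ hτ => (hder τ hτ).continuousAt.continuousWithinAt)
      (fun τ hτ => (hder τ (Set.Ioo_subset_Icc_self hτ)).hasDerivWithinAt) ?_ ?_
    · exact Continuous.integrableOn_Icc (by fun_prop)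
    · intro τ hτ
      have hτ' := Set.Ioo_subset_Icc_self hτ
      have hp : ∀ y, |tiltLine β (1 / √(B : ℝ)) x τ y - 1 / d| ≤ e := hβe τ hτ'
      have hp0 : ∀ y, 0 ≤ tiltLine β (1 / √(B : ℝ)) x τ y := fun y => by
        have h1 := (abs_le.1 (hp y)).1
        have h2 : e ≤ 1 / d := by rw [le_div_iff₀ hd0]; linarith
        linarith
      have ht := block_test_le hd hP hp0 (sum_tiltLine hd hβ _ _ _) (hz τ hτ') x hB h (a τ) (a' τ) α
      have k1 := cross_le hd hP he0 hp he x
      have k2 := le_postVar hd hP he0 hp he x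
      have k3 := fisher_le hd hP he0 hp he x
      have hbd : chiSq P x / d ≤ b / d := by gcongr
      have hbd2 : chiSq P x / d ^ 2 ≤ b / d ^ 2 := by gcongr
      have k4 := mul_le_mul_of_nonneg_left (k1.trans (add_le_add_left hbd _)) hα
      have k5 := mul_le_mul_of_nonneg_left (k3.trans (add_le_add_left hb _)) (sq_nonneg α)
      have k6 : c - 2 * α * (1 - 1 / d) ≤ -(2 * α) * (tiltLine β (1 / √(B : ℝ)) x τ x *
          ∑ o, P o x * respScore (tiltLine β (1 / √(B : ℝ)) x τ) P x o)
          + (tiltLine β (1 / √(B : ℝ)) x τ x - tiltLine β (1 / √(B : ℝ)) x τ x *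
            ∑ o, P o x * posterior (tiltLine β (1 / √(B : ℝ)) x τ) P x o)
          - α ^ 2 * ∑ o, respLaw (tiltLine β (1 / √(B : ℝ)) x τ) P o *
            respScore (tiltLine β (1 / √(B : ℝ)) x τ) P x o ^ 2 := by
        rw [hc]
        linarith
      have k7 := mul_le_mul_of_nonneg_left k6 (sq_nonneg (a τ))
      have hRτ : R τ = prodExp (fun _ : Fin B =>
        fun z : Fin d × Fin m => tiltLine β (1 / √(B : ℝ)) x τ z.1 * P z.2 z.1)
        (fun z => (√(B : ℝ) * freq (fun i => (z i).1) x - h (fun i => (z i).2)) ^ 2) := by rw [hR]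
      rw [← hRτ] at ht
      have e1 : ∀ S : ℝ, a τ ^ 2 / √(B : ℝ) * S = a τ ^ 2 * ((1 / √(B : ℝ)) * S) :=
        fun S => by ring
      rw [e1] at ht
      linarith [ht, k7]
  have hgT : g T - g (-T) = 0 := by rw [hg]; simp [haT, haT']
  rw [hgT, intervalIntegral.integral_add, intervalIntegral.integral_sub,
    intervalIntegral.integral_const_mul, intervalIntegral.integral_const_mul, ha1, haI] at hle
  · rw [hR] at hle
    rw [vanTreesBound]
    rw [hc] at hle
    linarith
  all_goals exact Continuous.intervalIntegrable (by fun_prop) _ _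

end line
end LDPFreq

/-! ### A prior on datasets from a box of input laws -/

namespace LDPFreq
open MeasureTheory

section prior

/-- Fubini with coordinate x integrated first. It lets a single product prior on the box serve for
every x, although the line in question depends on x. -/
theorem integral_box_nonneg {k : ℕ} {T : ℝ} (hT : 0 < T) (x : Fin (k + 1))
    {F : (Fin (k + 1) → ℝ) → ℝ} (hF : Continuous F)
    (h : ∀ t : Fin k → ℝ, (∀ j, t j ∈ Set.Icc (-T) T) → 0 ≤ ∫ τ in -T..T, F (x.insertNth τ t)) :
    0 ≤ ∫ t, F t ∂(Measure.pi fun _ : Fin (k + 1) => volume.restrict (Set.Icc (-T) T)) := by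
  have hFi : Integrable F
      (Measure.pi fun _ : Fin (k + 1) => volume.restrict (Set.Icc (-T) T)) := by
    rw [← Measure.restrict_pi_pi]
    exact hF.continuousOn.integrableOn_compact (isCompact_univ_pi fun _ => isCompact_Icc)
  have hmp := measurePreserving_piFinSuccAbove
    (fun _ : Fin (k + 1) => (volume : Measure ℝ).restrict (Set.Icc (-T) T)) x
  have hmps := hmp.symm
  rw [← hmps.integral_comp', integral_prod_symm]
  · refine integral_nonneg_of_ae ?_
    have hae : ∀ᵐ t ∂(Measure.pi fun _ : Fin k => (volume : Measure ℝ).restrict (Set.Icc (-T) T)),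
        t ∈ Set.univ.pi fun _ : Fin k => Set.Icc (-T) T := by
      rw [← Measure.restrict_pi_pi]
      exact ae_restrict_mem (MeasurableSet.univ_pi fun _ => measurableSet_Icc)
    filter_upwards [hae] with t ht
    have h1 := h t fun j => ht j (Set.mem_univ j)
    rw [intervalIntegral.integral_of_le (by linarith), ← integral_Icc_eq_integral_Ioc] at h1
    exact h1
  · exact (hmps.integrable_comp_emb (MeasurableEquiv.measurableEmbedding _)).2 hFi

/-- The input law at the position `t` of a box around the uniform law. -/
noncomputable def boxLaw {d : ℕ} (s : ℝ) (t : Fin d → ℝ) (y : Fin d) : ℝ :=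
  1 / d + s * (t y - (∑ z, t z) / d)

theorem sum_boxLaw {d : ℕ} (hd : 1 ≤ d) (s : ℝ) (t : Fin d → ℝ) : ∑ y, boxLaw s t y = 1 := by
  have hd0 : (d : ℝ) ≠ 0 := by positivity
  simp only [boxLaw, Finset.sum_add_distrib, ← Finset.mul_sum, Finset.sum_sub_distrib]
  simp only [Finset.sum_const, Finset.card_univ, Fintype.card_fin, nsmul_eq_mul]
  field_simp
  ring

theorem abs_boxLaw_sub_le {d : ℕ} (hd : 1 ≤ d) {s T : ℝ} (hs : 0 ≤ s) {t : Fin d → ℝ}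
    (ht : ∀ y, t y ∈ Set.Icc (-T) T) (y : Fin d) : |boxLaw s t y - 1 / d| ≤ 2 * T * s := by
  have hd0 : (0 : ℝ) < d := by positivity
  have h1 : (∑ z, t z) ≤ d * T := by
    have := Finset.sum_le_sum fun z (_ : z ∈ Finset.univ) => (ht z).2
    simpa using this
  have h2 : d * (-T) ≤ ∑ z, t z := by
    have := Finset.sum_le_sum fun z (_ : z ∈ Finset.univ) => (ht z).1
    simpa using this
  have h3 : (∑ z, t z) / d ≤ T := by rw [div_le_iff₀ hd0]; linarith
  have h4 : -T ≤ (∑ z, t z) / d := by rw [le_div_iff₀ hd0]; linarith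
  have h5 := (ht y).1
  have h6 := (ht y).2
  rw [boxLaw, add_sub_cancel_left, abs_mul, abs_of_nonneg hs, mul_comm]
  refine mul_le_mul_of_nonneg_right ?_ hs
  rw [abs_le]
  constructor <;> linarith

/-- Changing one coordinate of the box, followed by recentring to total mass 1, is a tilt towards x,
so the one-dimensional inequality applies on every coordinate line. -/
theorem boxLaw_insertNth {k : ℕ} (s : ℝ) (x : Fin (k + 1)) (τ : ℝ) (t : Fin k → ℝ) :
    boxLaw s (x.insertNth τ t) = tiltLine (boxLaw s (x.insertNth 0 t)) s x τ := by
  funext y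
  simp only [tiltLine, boxLaw, Fin.sum_univ_succAbove _ x, Fin.insertNth_apply_same,
    Fin.insertNth_apply_succAbove]
  rcases eq_or_ne y x with rfl | hy
  · simp only [Fin.insertNth_apply_same, if_true]
    ring
  · obtain ⟨j, rfl⟩ := Fin.exists_succAbove_eq hy
    simp only [Fin.insertNth_apply_succAbove, if_neg hy]
    ring

theorem continuous_boxLaw {d : ℕ} (s : ℝ) (y : Fin d) :
    Continuous fun t : Fin d → ℝ => boxLaw s t y := by
  unfold boxLaw
  fun_prop

theorem exists_amplitude {T : ℝ} (hT : 0 < T) : ∃ a a' : ℝ → ℝ,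
    (∀ τ, HasDerivAt a (a' τ) τ) ∧ Continuous a' ∧ a T = 0 ∧ a (-T) = 0 ∧
    (∫ τ in -T..T, a τ ^ 2 = 1) ∧ ∫ τ in -T..T, 4 * a' τ ^ 2 = 10 / T ^ 2 := by
  -- K normalises the parabola K(T² - τ²) in L², since ∫(T² - τ²)² = 16T⁵/15 over [-T, T].
  obtain ⟨K, hK⟩ : ∃ K : ℝ, K = √(15 / (16 * T ^ 5)) := ⟨_, rfl⟩
  have hK2 : K ^ 2 = 15 / (16 * T ^ 5) := by rw [hK, Real.sq_sqrt (by positivity)]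
  refine ⟨fun τ => K * (T ^ 2 - τ ^ 2), fun τ => K * (-(2 * τ)), fun τ => ?_, by fun_prop,
    by simp, by simp, ?_, ?_⟩
  · have := ((hasDerivAt_pow 2 τ).const_sub (T ^ 2)).const_mul K
    simpa using this
  · have e : ∀ τ : ℝ, (K * (T ^ 2 - τ ^ 2)) ^ 2
        = K ^ 2 * T ^ 4 - 2 * K ^ 2 * T ^ 2 * τ ^ 2 + K ^ 2 * τ ^ 4 := fun τ => by ring
    simp only [e]
    rw [intervalIntegral.integral_add, intervalIntegral.integral_sub,
      intervalIntegral.integral_const_mul, intervalIntegral.integral_const_mul,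
      intervalIntegral.integral_const_mul, integral_pow,
      integral_pow, intervalIntegral.integral_const, hK2]
    · simp only [smul_eq_mul]
      push_cast
      field_simp
      ring
    all_goals exact Continuous.intervalIntegrable (by fun_prop) _ _
  · have e : ∀ τ : ℝ, 4 * (K * (-(2 * τ))) ^ 2 = 16 * K ^ 2 * τ ^ 2 := fun τ => by ring
    simp only [e]
    rw [intervalIntegral.integral_const_mul, integral_pow, hK2]
    push_cast
    field_simp
    ring

/-- A prior on the datasets of size `B` for which the quadratic risk of estimating a frequency from
the responses of any mechanism is at least the van Trees bound. -/
theorem exists_prior {d : ℕ} (hd : 1 ≤ d) {B : ℕ} (hB : 1 ≤ B) {T : ℝ} (hT : 0 < T)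
    (hTB : d * (2 * T * (1 / √(B : ℝ))) ≤ 1 / 2) :
    ∃ μ : (Fin B → Fin d) → ℝ, (∀ ξ, 0 ≤ μ ξ) ∧ ∑ ξ, μ ξ = 1 ∧
      ∀ (m : ℕ) (P : Matrix (Fin m) (Fin d) ℝ), IsMechanism P → ∀ (x : Fin d) (α b : ℝ), 0 ≤ α →
        chiSq P x ≤ b → ∀ h : (Fin B → Fin m) → ℝ,
        vanTreesBound d α b (10 / T ^ 2) (2 * T * (1 / √(B : ℝ))) / B ≤
          ∑ ξ, ∑ ω : Fin B → Fin m, μ ξ * (∏ i, P (ω i) (ξ i)) * (freq ξ x - h ω) ^ 2 := by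
  obtain ⟨k, rfl⟩ : ∃ k, d = k + 1 := ⟨d - 1, by omega⟩
  obtain ⟨a, a', ha, ha', haT, haT', ha1, haI⟩ := exists_amplitude hT
  have hac : Continuous a := continuous_iff_continuousAt.2 fun τ => (ha τ).continuousAt
  have hB0 : (0 : ℝ) < B := by positivity
  have hs0 : 0 < √(B : ℝ) := Real.sqrt_pos.2 hB0
  have hs1 : 0 ≤ 1 / √(B : ℝ) := by positivity
  obtain ⟨s, hs⟩ : ∃ s, s = 1 / √(B : ℝ) := ⟨_, rfl⟩
  rw [← hs] at hTB hs1 ⊢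
  obtain ⟨ν, hν⟩ : ∃ ν : Measure (Fin (k + 1) → ℝ),
    ν = Measure.pi fun _ : Fin (k + 1) => volume.restrict (Set.Icc (-T) T) := ⟨_, rfl⟩
  have hint : ∀ F : (Fin (k + 1) → ℝ) → ℝ, Continuous F → Integrable F ν := fun F hF => by
    rw [hν, ← Measure.restrict_pi_pi]
    exact hF.continuousOn.integrableOn_compact (isCompact_univ_pi fun _ => isCompact_Icc)
  have hae : ∀ᵐ t ∂ν, t ∈ Set.univ.pi fun _ : Fin (k + 1) => Set.Icc (-T) T := by
    rw [hν, ← Measure.restrict_pi_pi]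
    exact ae_restrict_mem (MeasurableSet.univ_pi fun _ => measurableSet_Icc)
  have hc : ∀ y, Continuous fun t : Fin (k + 1) → ℝ => boxLaw s t y := continuous_boxLaw s
  obtain ⟨w, hw⟩ : ∃ w : (Fin (k + 1) → ℝ) → ℝ, w = fun t => ∏ y, a (t y) ^ 2 := ⟨_, rfl⟩
  have hwc : Continuous w := by rw [hw]; fun_prop
  have hw1 : ∫ t, w t ∂ν = 1 := by
    rw [hw, hν, integral_fintype_prod_eq_pow (fun τ => a τ ^ 2), integral_Icc_eq_integral_Ioc,
      ← intervalIntegral.integral_of_le (by linarith), ha1, one_pow]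
  have hde : 2 * T * s ≤ 1 / (k + 1 : ℕ) := by
    rw [le_div_iff₀ (by positivity)]; linarith
  -- The mixture of i.i.d. input laws with density w on the box. It is chosen before the mechanism
  -- and the coordinate x.
  refine ⟨fun ξ => ∫ t, w t * ∏ i, boxLaw s t (ξ i) ∂ν, fun ξ => ?_, ?_, ?_⟩
  · refine integral_nonneg_of_ae ?_
    filter_upwards [hae] with t ht
    refine mul_nonneg ?_ (Finset.prod_nonneg fun i _ => ?_)
    · rw [hw]; exact Finset.prod_nonneg fun y _ => sq_nonneg _
    · have := (abs_le.1 (abs_boxLaw_sub_le hd hs1 (fun y => ht y (Set.mem_univ y)) (ξ i))).1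
      linarith
  · rw [← integral_finsetSum _ fun ξ _ => hint _ (by fun_prop)]
    rw [← hw1]
    congr 1
    funext t
    rw [← Finset.mul_sum, sum_prod_apply]
    simp only [sum_boxLaw hd, Finset.prod_const_one, mul_one]
  · intro m P hP x α b hα hb h
    obtain ⟨R, hR⟩ : ∃ R : (Fin (k + 1) → ℝ) → ℝ, R = fun t => prodExp (fun _ : Fin B =>
      fun z : Fin (k + 1) × Fin m => boxLaw s t z.1 * P z.2 z.1)
      (fun z => (√(B : ℝ) * freq (fun i => (z i).1) x
        - √(B : ℝ) * h (fun i => (z i).2)) ^ 2) := ⟨_, rfl⟩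
    have hRc : Continuous R := by
      rw [hR]; unfold prodExp; fun_prop
    obtain ⟨v, hv⟩ : ∃ v, v = vanTreesBound (k + 1) α b (10 / T ^ 2) (2 * T * s) := ⟨_, rfl⟩
    have h1 : 0 ≤ ∫ t, w t * (R t - v) ∂ν := by
      rw [hν]
      refine integral_box_nonneg hT x (by fun_prop) fun t ht => ?_
      have h2 := vanTrees_line hd hP x hB (β := boxLaw s (x.insertNth 0 t)) (sum_boxLaw hd _ _) hT
        (e := 2 * T * s) (by positivity) hTB (fun τ hτ y => by
          rw [← hs, ← boxLaw_insertNth]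
          refine abs_boxLaw_sub_le hd hs1 (fun z => ?_) y
          rcases eq_or_ne z x with rfl | hz
          · simpa using hτ
          · obtain ⟨j, rfl⟩ := Fin.exists_succAbove_eq hz
            simpa using ht j) ha ha' haT haT' ha1 haI hα hb (fun ω => √(B : ℝ) * h ω)
      rw [← hv, ← hs] at h2
      have e : ∀ τ, w (x.insertNth τ t) * (R (x.insertNth τ t) - v)
          = (∏ j, a (t j) ^ 2) * (a τ ^ 2 * R (x.insertNth τ t) - v * a τ ^ 2) := fun τ => by
        rw [hw]
        simp only [Fin.prod_univ_succAbove _ x, Fin.insertNth_apply_same,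
          Fin.insertNth_apply_succAbove]
        ring
      simp only [e]
      have hRx : Continuous fun τ : ℝ => R (x.insertNth τ t) := by
        refine hRc.comp (continuous_pi fun y => ?_)
        rcases eq_or_ne y x with rfl | hy
        · simpa using continuous_id'
        · obtain ⟨j, rfl⟩ := Fin.exists_succAbove_eq hy
          simpa using continuous_const
      rw [intervalIntegral.integral_const_mul, intervalIntegral.integral_sub,
        intervalIntegral.integral_const_mul, ha1]
      · refine mul_nonneg (Finset.prod_nonneg fun j _ => sq_nonneg _) ?_
        have e2 : ∀ τ, R (x.insertNth τ t) = prodExp (fun _ : Fin B =>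
            fun z : Fin (k + 1) × Fin m =>
              tiltLine (boxLaw s (x.insertNth 0 t)) s x τ z.1 * P z.2 z.1)
            (fun z => (√(B : ℝ) * freq (fun i => (z i).1) x
              - √(B : ℝ) * h (fun i => (z i).2)) ^ 2) := fun τ => by
          simp only [hR, ← boxLaw_insertNth]
        simp only [e2]
        linarith
      all_goals exact Continuous.intervalIntegrable (by fun_prop) _ _
    have h3 : v ≤ ∫ t, w t * R t ∂ν := by
      simp only [mul_sub] at h1
      rw [integral_sub (hint _ (by fun_prop)) (hint _ (by fun_prop)), integral_mul_const, hw1] at h1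
      linarith
    rw [← hv, div_le_iff₀ hB0]
    refine h3.trans (le_of_eq ?_)
    have e : ∀ t, w t * R t = ∑ ξ : Fin B → Fin (k + 1), ∑ ω : Fin B → Fin m,
        w t * (∏ i, boxLaw s t (ξ i)) * ((∏ i, P (ω i) (ξ i)) * (freq ξ x - h ω) ^ 2 * B) :=
      fun t => by
      have h4 := sum_arrow_prod (fun (ξ : Fin B → Fin (k + 1)) (ω : Fin B → Fin m) =>
        (∏ i, boxLaw s t (ξ i) * P (ω i) (ξ i)) * (√(B : ℝ) * freq ξ x - √(B : ℝ) * h ω) ^ 2)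
      rw [hR]
      simp only [prodExp]
      rw [h4, Finset.mul_sum]
      refine Finset.sum_congr rfl fun ξ _ => ?_
      rw [Finset.mul_sum]
      refine Finset.sum_congr rfl fun ω _ => ?_
      rw [Finset.prod_mul_distrib, ← mul_sub, mul_pow, Real.sq_sqrt hB0.le]
      ring
    simp only [e]
    rw [integral_finsetSum _ fun ξ _ => hint _ (by fun_prop), Finset.sum_mul]
    refine Finset.sum_congr rfl fun ξ _ => ?_
    rw [integral_finsetSum _ fun ω _ => hint _ (by fun_prop), Finset.sum_mul]
    refine Finset.sum_congr rfl fun ω _ => ?_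
    rw [integral_mul_const]
    ring

end prior
end LDPFreq

/-! ### Cutting a dataset into independent blocks -/

namespace LDPFreq

section blocks
variable {κ β ρ ι α : Type*}

/-- The sequence consisting of the blocks `ω` and the remainder `r`. -/
def glue (φ : (κ × β) ⊕ ρ ≃ ι) (ω : κ → β → α) (r : ρ → α) (i : ι) : α :=
  Sum.elim (fun p => ω p.1 p.2) r (φ.symm i)

theorem prod_glue {M γ : Type*} [CommMonoid M] [Fintype κ] [Fintype β] [Fintype ρ]
    [Fintype ι] (φ : (κ × β) ⊕ ρ ≃ ι) (ω : κ → β → α) (r : ρ → α)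
    (ω' : κ → β → γ) (r' : ρ → γ) (f : α → γ → M) :
    ∏ i, f (glue φ ω r i) (glue φ ω' r' i)
      = (∏ j, ∏ l, f (ω j l) (ω' j l)) * ∏ l, f (r l) (r' l) := by
  rw [← φ.prod_comp, Fintype.prod_sum_type, Fintype.prod_prod_type]
  simp [glue]

theorem sum_glue {γ : Type*} [AddCommMonoid γ] [Fintype κ] [Fintype β] [Fintype ρ]
    [Fintype ι] [Fintype α] [DecidableEq κ] [DecidableEq β] [DecidableEq ρ] [DecidableEq ι] (φ : (κ × β) ⊕ ρ ≃ ι) (F : (ι → α) → γ) :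
    ∑ o, F o = ∑ r : ρ → α, ∑ ω : κ → β → α, F (glue φ ω r) := by
  rw [Finset.sum_comm, ← Fintype.sum_prod_type']
  refine (Fintype.sum_equiv (((Equiv.curry κ β α).symm.prodCongr (Equiv.refl _)).trans
    ((Equiv.sumArrowEquivProdArrow (κ × β) ρ α).symm.trans
      (φ.arrowCongr (Equiv.refl α)))) _ _ fun z => ?_).symm
  congr 1

end blocks

theorem freq_glue {N B n k : ℕ} {ρ : Type*} [Fintype ρ] (hB : 1 ≤ B)
    (φ : (Fin N × Fin B) ⊕ ρ ≃ Fin n)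
    (ξ : Fin N → Fin B → Fin k) (r : ρ → Fin k) (x : Fin k) :
    freq (glue φ ξ r) x
      = B / n * (∑ j, freq (ξ j) x) + (∑ l, if r l = x then (1 : ℝ) else 0) / n := by
  have hB0 : (B : ℝ) ≠ 0 := by positivity
  rw [freq, ← φ.sum_comp, Fintype.sum_sum_type, Fintype.sum_prod_type]
  simp only [glue, Equiv.symm_apply_apply, Sum.elim_inl, Sum.elim_inr, freq]
  rw [← Finset.sum_div]
  field_simp

/-- The supremum over datasets dominates the average over N independent blocks from the prior, the R
remaining users having a fixed input. For fixed remaining responses the estimator is a function of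
the block responses, and the Bayesian bound for N independent copies applies to each coordinate. -/
theorem le_L1loss {m d : ℕ} (hd : 1 ≤ d) {P : Matrix (Fin m) (Fin d) ℝ} (hP : IsMechanism P)
    {N B R n : ℕ} (hB : 1 ≤ B) (hn : n = N * B + R) (hn0 : 1 ≤ n) {μ : (Fin B → Fin d) → ℝ}
    (hμ0 : ∀ ξ, 0 ≤ μ ξ) (hμ1 : ∑ ξ, μ ξ = 1) {r : Fin d → ℝ}
    (hr : ∀ (x : Fin d) (h : (Fin B → Fin m) → ℝ), r x ≤
      ∑ ξ, ∑ ω : Fin B → Fin m, μ ξ * (∏ i, P (ω i) (ξ i)) * (freq ξ x - h ω) ^ 2)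
    (fhat : Estimator m d) {δ : ℝ} (hδ : 0 < δ) :
    B / n * ∑ x, (√(2 * (N * r x) / Real.pi)
        - (2 * δ + N / δ ^ 3 + N * (3 / δ ^ 2 * (1 + gaussThird)))) ≤ L1loss P fhat n := by
  have hn1 : (0 : ℝ) < n := by positivity
  have hB0 : (0 : ℝ) < B := by positivity
  obtain ⟨φ⟩ : Nonempty ((Fin N × Fin B) ⊕ Fin R ≃ Fin n) := by
    rw [hn]
    exact ⟨(finProdFinEquiv.sumCongr (Equiv.refl _)).trans finSumFinEquiv⟩
  obtain ⟨x0⟩ : Nonempty (Fin d) := ⟨⟨0, hd⟩⟩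
  obtain ⟨J, hJ⟩ : ∃ J : (Fin B → Fin d) × (Fin B → Fin m) → ℝ,
    J = fun z => μ z.1 * ∏ i, P (z.2 i) (z.1 i) := ⟨_, rfl⟩
  have hsum : ∀ ξ : Fin B → Fin d, ∑ ω : Fin B → Fin m, ∏ i, P (ω i) (ξ i) = 1 := fun ξ => by
    rw [sum_prod_apply (fun i o => P o (ξ i))]
    simp [hP.2]
  have hJ0 : ∀ z, 0 ≤ J z := fun z => by
    rw [hJ]; exact mul_nonneg (hμ0 _) (Finset.prod_nonneg fun i _ => hP.1 _ _)
  have hJ1 : ∑ z, J z = 1 := by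
    rw [hJ, Fintype.sum_prod_type]
    simp [← Finset.mul_sum, hsum, hμ1]
  have hfreq0 : ∀ (x : Fin d) (ξ : Fin B → Fin d), 0 ≤ freq ξ x := fun x ξ => by
    rw [freq]
    exact div_nonneg (Finset.sum_nonneg fun i _ => by split_ifs <;> norm_num) hB0.le
  have hfreq1 : ∀ (x : Fin d) (ξ : Fin B → Fin d), freq ξ x ≤ 1 := fun x ξ => by
    rw [freq, div_le_one hB0]
    refine (Finset.sum_le_sum fun i _ => (?_ : _ ≤ (1 : ℝ))).trans (by simp)
    split_ifs <;> norm_num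
  obtain ⟨E, hE⟩ : ∃ E, E = 2 * δ + N / δ ^ 3 + N * (3 / δ ^ 2 * (1 + gaussThird)) := ⟨_, rfl⟩
  have hmain : ∀ (x : Fin d) (H : (Fin N → Fin B → Fin m) → ℝ) (c : ℝ),
      B / n * (√(2 * (N * r x) / Real.pi) - E) ≤ ∑ ξ : Fin N → Fin B → Fin d,
        ∑ ω : Fin N → Fin B → Fin m, (∏ j, μ (ξ j)) * (∏ j, ∏ i, P (ω j i) (ξ j i))
          * |H ω - (B / n * (∑ j, freq (ξ j) x) + c)| := fun x H c => by
    have h1 := le_prodExp_abs_sub hJ0 hJ1 (hfreq0 x) (hfreq1 x) (r := r x) (fun h => by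
      rw [Fintype.sum_prod_type, hJ]; exact hr x h) N (fun ω => n / B * (H ω - c)) hδ
    rw [← hE] at h1
    refine (mul_le_mul_of_nonneg_left h1 (by positivity)).trans (le_of_eq ?_)
    have h2 := sum_arrow_prod (fun (ξ : Fin N → Fin B → Fin d) (ω : Fin N → Fin B → Fin m) =>
      (∏ j, J (ξ j, ω j)) * |n / B * (H ω - c) - ∑ j, freq (ξ j) x|)
    rw [prodExp, h2, Finset.mul_sum]
    refine Finset.sum_congr rfl fun ξ _ => ?_
    rw [Finset.mul_sum]
    refine Finset.sum_congr rfl fun ω _ => ?_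
    have h3 : H ω - (B / n * (∑ j, freq (ξ j) x) + c)
        = B / n * (n / B * (H ω - c) - ∑ j, freq (ξ j) x) := by
      field_simp
      ring
    rw [h3, abs_mul, abs_of_nonneg (show (0 : ℝ) ≤ B / n by positivity), hJ,
      Finset.prod_mul_distrib]
    ring
  have hle : ∀ X : Fin n → Fin d, expect P X (fun o => ∑ x, |fhat (freq o) x - freq X x|)
      ≤ L1loss P fhat n := fun X => le_ciSup (f := fun X : Fin n → Fin d =>
        expect P X (fun o => ∑ x, |fhat (freq o) x - freq X x|)) (Set.finite_range _).bddAbove X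
  have havg : ∑ ξ : Fin N → Fin B → Fin d, (∏ j, μ (ξ j)) *
      expect P (glue φ ξ fun _ => x0)
        (fun o => ∑ x, |fhat (freq o) x - freq (glue φ ξ fun _ => x0) x|) ≤ L1loss P fhat n := by
    refine (Finset.sum_le_sum fun ξ _ => mul_le_mul_of_nonneg_left (hle _)
      (Finset.prod_nonneg fun j _ => hμ0 _)).trans (le_of_eq ?_)
    rw [← Finset.sum_mul, sum_prod_apply (fun _ => μ)]
    simp [hμ1]
  refine le_trans ?_ havg
  have hexp : ∀ ξ : Fin N → Fin B → Fin d, (∏ j, μ (ξ j)) *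
      expect P (glue φ ξ fun _ => x0)
        (fun o => ∑ x, |fhat (freq o) x - freq (glue φ ξ fun _ => x0) x|)
      = ∑ x, ∑ s : Fin R → Fin m, (∏ l, P (s l) x0) * ∑ ω : Fin N → Fin B → Fin m,
          (∏ j, μ (ξ j)) * (∏ j, ∏ i, P (ω j i) (ξ j i)) *
            |fhat (freq (glue φ ω s)) x - (B / n * (∑ j, freq (ξ j) x)
              + (∑ _l : Fin R, if x0 = x then (1 : ℝ) else 0) / n)| := fun ξ => by
    rw [expect_sum, Finset.mul_sum]
    refine Finset.sum_congr rfl fun x _ => ?_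
    rw [expect, sum_glue φ, Finset.mul_sum]
    refine Finset.sum_congr rfl fun s _ => ?_
    rw [Finset.mul_sum, Finset.mul_sum]
    refine Finset.sum_congr rfl fun ω _ => ?_
    rw [prod_glue φ ω s ξ (fun _ => x0) (fun o x => P o x), freq_glue hB]
    ring
  simp only [hexp]
  rw [Finset.sum_comm, Finset.mul_sum]
  refine Finset.sum_le_sum fun x _ => ?_
  rw [Finset.sum_comm, ← hE]
  have hs1 : ∑ s : Fin R → Fin m, ∏ l, P (s l) x0 = 1 := by
    rw [sum_prod_apply (fun _ o => P o x0)]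
    simp [hP.2]
  calc B / n * (√(2 * (N * r x) / Real.pi) - E)
      = ∑ s : Fin R → Fin m, (∏ l, P (s l) x0) * (B / n * (√(2 * (N * r x) / Real.pi) - E)) := by
        rw [← Finset.sum_mul, hs1, one_mul]
    _ ≤ _ := Finset.sum_le_sum fun s _ => by
        rw [← Finset.mul_sum]
        exact mul_le_mul_of_nonneg_left (hmain x _ _) (Finset.prod_nonneg fun l _ => hP.1 _ _)

end LDPFreq

namespace LDPFreq

/-! ### Supporting lines of the function `y ↦ √(1/y - 1)` -/

theorem le_sqrt_inv_sub_one {y A K : ℝ} (hy : 0 < y) (hK : 0 < K)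
    (h : A ≤ 0 ∨ y * A ^ 2 ≤ (1 - y) * K ^ 2) : A / K ≤ √(1 / y - 1) := by
  rcases h with h | h
  · exact (div_nonpos_of_nonpos_of_nonneg h hK.le).trans (Real.sqrt_nonneg _)
  · refine Real.le_sqrt_of_sq_le ?_
    rw [div_pow, div_le_iff₀ (by positivity)]
    have e : (1 / y - 1) * K ^ 2 = (1 - y) * K ^ 2 / y := by field_simp
    rw [e, le_div_iff₀ hy]
    linarith

section lines
variable {u v : ℝ}

theorem sqrt_inv_sq_sub_one (hu : 0 < u) (hv : 0 < v) (huv : u ^ 2 + v ^ 2 = 1) :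
    √(1 / u ^ 2 - 1) = v / u := by
  rw [Real.sqrt_eq_iff_mul_self_eq_of_pos (by positivity)]
  field_simp
  linarith

/-- The tangent at `u²` when `u² ≤ 1/2`. -/
theorem tangent_le_sqrt (hu : 0 < u) (hv : 0 < v) (huv : u ^ 2 + v ^ 2 = 1) (hu2 : u ^ 2 ≤ 1 / 2)
    {y : ℝ} (hy : 0 < y) :
    v / u + 1 / (2 * u ^ 3 * v) * (u ^ 2 - y) ≤ √(1 / y - 1) := by
  have e : v / u + 1 / (2 * u ^ 3 * v) * (u ^ 2 - y)
      = (3 * u ^ 2 - 2 * u ^ 4 - y) / (2 * u ^ 3 * v) := by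
    have hv2 : v ^ 2 = 1 - u ^ 2 := by linarith
    field_simp
    rw [hv2]
    ring
  rw [e]
  refine le_sqrt_inv_sub_one hy (by positivity) ?_
  rcases le_total (3 * u ^ 2 - 2 * u ^ 4 - y) 0 with h | h
  · exact Or.inl h
  · right
    have h1 : y ≤ 4 * u ^ 2 * (1 - u ^ 2) := by nlinarith [sq_nonneg u]
    have hv2 : v ^ 2 = 1 - u ^ 2 := by linarith
    -- Tangency gives a double zero at u². The remaining factor is nonnegative wherever the line is,
    -- given u² ≤ 1/2.
    have e2 : (1 - y) * (2 * u ^ 3 * v) ^ 2 - y * (3 * u ^ 2 - 2 * u ^ 4 - y) ^ 2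
        = (y - u ^ 2) ^ 2 * (4 * u ^ 2 * (1 - u ^ 2) - y) := by
      have : (2 * u ^ 3 * v) ^ 2 = 4 * u ^ 6 * (1 - u ^ 2) := by rw [← hv2]; ring
      rw [this]; ring
    have := mul_nonneg (sq_nonneg (y - u ^ 2)) (sub_nonneg.2 h1)
    linarith

/-- Since u v ≤ 1/2, this slope is at most that of the tangent, so the line can stay below the curve
to the left of u². The slope is chosen so that its ratio to the one on the right is 1 + 1/(2uv). -/
theorem left_line_le_sqrt (hu : 0 < u) (hv : 0 < v) (huv : u ^ 2 + v ^ 2 = 1)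
    {y : ℝ} (hy : 0 < y) (hyu : y ≤ u ^ 2) :
    v / u + 1 / (u ^ 2 * (1 / 2 + u * v)) * (u ^ 2 - y) ≤ √(1 / y - 1) := by
  have hv2 : v ^ 2 = 1 - u ^ 2 := by linarith
  have huv0 : 0 < u * v := mul_pos hu hv
  have e : v / u + 1 / (u ^ 2 * (1 / 2 + u * v)) * (u ^ 2 - y)
      = (u * v / 2 + 2 * u ^ 2 - u ^ 4 - y) / (u ^ 2 * (1 / 2 + u * v)) := by
    have : (1 : ℝ) / 2 + u * v ≠ 0 := by positivity
    field_simp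
    have : u * v * (1 + 2 * (u * v)) = u * v + 2 * u ^ 2 * v ^ 2 := by ring
    rw [hv2] at this
    linarith
  rw [e]
  refine le_sqrt_inv_sub_one hy (by positivity) (Or.inr ?_)
  obtain ⟨q, hq⟩ : ∃ q, q = y ^ 2 + (2 * u ^ 4 - 3 * u ^ 2 - u * v) * y
    + u ^ 2 * (1 / 2 + u * v) ^ 2 := ⟨_, rfl⟩
  have hq0 : 0 ≤ q := by
    rw [hq]
    have huv2 : (u * v) ^ 2 = u ^ 2 - u ^ 4 := by rw [mul_pow, hv2]; ring
    rcases le_total v (1 / 2) with hv3 | hv3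
    · have hu1 : 1 - v ^ 2 ≤ u := by nlinarith
      have h1 : 0 ≤ 1 + 2 * u * v - u - v - 2 * u * v ^ 2 := by
        have k1 : v ^ 2 / 2 ≤ 1 - u := by nlinarith
        have k2 : 1 - v / 2 ≤ 2 * u * (1 - v) := by
          have : 0 ≤ (1 - 2 * v) * (1 + v / 2 - v ^ 2) :=
            mul_nonneg (by linarith) (by nlinarith)
          nlinarith
        nlinarith
      have h2 : 3 * u ^ 2 - 2 * u ^ 4 + u * v ≤ u * (1 + 2 * u * v) := by
        have := mul_nonneg hu.le h1
        have e3 : u * (2 * u * v ^ 2) = 2 * u ^ 2 - 2 * u ^ 4 := by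
          have : u * (2 * u * v ^ 2) = 2 * u ^ 2 * v ^ 2 := by ring
          rw [this, hv2]; ring
        linarith
      have h3 : 0 ≤ (y - u * (1 / 2 + u * v)) ^ 2 := sq_nonneg _
      have h4 := mul_le_mul_of_nonneg_right h2 hy.le
      linarith
    · have hu34 : u ^ 2 ≤ 3 / 4 := by nlinarith
      have h1 : 0 ≤ u * v + u ^ 2 - 2 * u ^ 4 := by
        have : u * (2 * u ^ 2 - 1) ≤ v := by nlinarith
        have := mul_nonneg hu.le (sub_nonneg.2 this)
        linarith
      have h2 : 0 ≤ 1 / 4 - (u * v) ^ 2 := by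
        rw [huv2]; nlinarith [sq_nonneg (u ^ 2 - 1 / 2)]
      have h3 : 0 ≤ (u ^ 2 - y) * (u * v + u ^ 2 - 2 * u ^ 4) :=
        mul_nonneg (by linarith) h1
      have h4 : 0 ≤ u ^ 2 * (1 / 4 - (u * v) ^ 2) := mul_nonneg (by positivity) h2
      have h5 : 0 ≤ (u ^ 2 - y) ^ 2 := sq_nonneg _
      have e4 : y ^ 2 + (2 * u ^ 4 - 3 * u ^ 2 - u * v) * y + u ^ 2 * (1 / 2 + u * v) ^ 2
          = (u ^ 2 - y) ^ 2 + (u ^ 2 - y) * (u * v + u ^ 2 - 2 * u ^ 4)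
            + u ^ 2 * (1 / 4 - (u * v) ^ 2)
            + 2 * u ^ 2 * ((u * v) ^ 2 - (u ^ 2 - u ^ 4)) := by ring
      rw [e4, huv2, sub_self, mul_zero, add_zero]
      rw [huv2] at h4
      linarith
  have e2 : (1 - y) * (u ^ 2 * (1 / 2 + u * v)) ^ 2
      - y * (u * v / 2 + 2 * u ^ 2 - u ^ 4 - y) ^ 2 = (u ^ 2 - y) * q := by
    rw [hq]
    have h8 : (u * v) ^ 2 = u ^ 2 - u ^ 4 := by rw [mul_pow, hv2]; ring
    obtain ⟨t, ht⟩ : ∃ t, t = u * v := ⟨_, rfl⟩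
    rw [← ht] at h8 ⊢
    linear_combination (-(u ^ 4) * y + y * (u ^ 2 - 1 / 4)) * h8
  have := mul_nonneg (sub_nonneg.2 hyu) hq0
  linarith

/-- Twice the slope of the tangent at u²; steep enough to lie below the curve to the right also
where the tangent fails. -/
theorem right_line_le_sqrt (hu : 0 < u) (hv : 0 < v) (huv : u ^ 2 + v ^ 2 = 1)
    {y : ℝ} (hyu : u ^ 2 ≤ y) :
    v / u + 1 / (u ^ 2 * (u * v)) * (u ^ 2 - y) ≤ √(1 / y - 1) := by
  have hv2 : v ^ 2 = 1 - u ^ 2 := by linarith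
  have hy : 0 < y := lt_of_lt_of_le (by positivity) hyu
  have e : v / u + 1 / (u ^ 2 * (u * v)) * (u ^ 2 - y)
      = (2 * u ^ 2 - u ^ 4 - y) / (u ^ 2 * (u * v)) := by
    field_simp
    rw [hv2]; ring
  rw [e]
  refine le_sqrt_inv_sub_one hy (by positivity) ?_
  rcases le_total (2 * u ^ 2 - u ^ 4 - y) 0 with h | h
  · exact Or.inl h
  right
  have hu1 : u ^ 2 ≤ 1 := by nlinarith
  have h1 : 0 ≤ (y - u ^ 2) * (2 * u ^ 2 - u ^ 4 - y) := mul_nonneg (by linarith) h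
  have h2 : 0 ≤ (1 - u ^ 2) * u ^ 2 * y := by
    have : 0 ≤ 1 - u ^ 2 := by linarith
    positivity
  have e2 : (1 - y) * (u ^ 2 * (u * v)) ^ 2 - y * (2 * u ^ 2 - u ^ 4 - y) ^ 2
      = (y - u ^ 2) * -(y ^ 2 + (2 * u ^ 4 - 3 * u ^ 2) * y + u ^ 4 * (1 - u ^ 2)) := by
    have : (u ^ 2 * (u * v)) ^ 2 = u ^ 6 * (1 - u ^ 2) := by rw [← hv2]; ring
    rw [this]; ring
  have h3 : 0 ≤ -(y ^ 2 + (2 * u ^ 4 - 3 * u ^ 2) * y + u ^ 4 * (1 - u ^ 2)) := by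
    have h4 : 0 ≤ (1 - u ^ 2) * (y - u ^ 2 * (1 - u ^ 2)) := by
      refine mul_nonneg (by linarith) ?_
      nlinarith [sq_nonneg (u ^ 2)]
    nlinarith
  have := mul_nonneg (sub_nonneg.2 hyu) h3
  linarith

end lines

/-- A supporting line of `√(1/y - 1)` at the optimal divergence, whose slope may be steeper to the
right by a factor `M` for which `sum_weighted_chiSq_le` is available. -/
theorem exists_supporting_line {d g : ℝ} (hd : 2 ≤ d) (hg : 1 < g) (hdg : d ≤ g + 1) :
    ∃ M κ : ℝ, 1 ≤ M ∧ 0 ≤ κ ∧ (M - 1) * (d - 1) * g ≤ (g - 1) * (g - d + 1) ∧ ∀ y, 0 < y →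
      √(1 / ((g - 1) / (g + d - 1)) ^ 2 - 1)
        + κ * ((if y ≤ ((g - 1) / (g + d - 1)) ^ 2 then 1 else M)
          * (((g - 1) / (g + d - 1)) ^ 2 - y)) ≤ √(1 / y - 1) := by
  obtain ⟨u, hu⟩ : ∃ u, u = (g - 1) / (g + d - 1) := ⟨_, rfl⟩
  have hgd : 0 < g + d - 1 := by linarith
  have hu0 : 0 < u := by rw [hu]; exact div_pos (by linarith) hgd
  have hu1 : u < 1 := by rw [hu, div_lt_one hgd]; linarith
  have hu2 : u ^ 2 < 1 := by nlinarith
  obtain ⟨v, hv⟩ : ∃ v, v = √(1 - u ^ 2) := ⟨_, rfl⟩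
  have hv0 : 0 < v := by rw [hv]; exact Real.sqrt_pos.2 (by linarith)
  have huv : u ^ 2 + v ^ 2 = 1 := by rw [hv, Real.sq_sqrt (by linarith)]; ring
  rw [← hu, sqrt_inv_sq_sub_one hu0 hv0 huv]
  rcases le_total (u ^ 2) (1 / 2) with h | h
  · refine ⟨1, 1 / (2 * u ^ 3 * v), le_rfl, by positivity, ?_, fun y hy => ?_⟩
    · have : 0 ≤ (g - 1) * (g - d + 1) := mul_nonneg (by linarith) (by linarith)
      linarith
    · rw [ite_self, one_mul]
      exact tangent_le_sqrt hu0 hv0 huv h hy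
  · have hv1 : v ^ 2 ≤ 1 / 2 := by linarith
    have hu7 : 7 / 10 ≤ u := by nlinarith
    have hv8 : v ≤ 8 / 10 := by nlinarith
    -- The required extra slope 1/(2uv) must fit into the M - 1 permitted by the weighted
    -- constraint; (g-1)/d - 1 is an intermediate quantity, equal to (2u-1)/(1-u).
    have hkey : 1 / (2 * (u * v)) ≤ (g - 1) / d - 1 := by
      have hz : (g - 1) / d = u / (1 - u) := by
        have h1 : (0 : ℝ) < 1 - u := by linarith
        rw [div_eq_div_iff (by positivity) h1.ne', hu]
        field_simp
        ring
      have h1 : (0 : ℝ) < 1 - u := by linarith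
      have e : u / (1 - u) - 1 = (2 * u - 1) / (1 - u) := by field_simp; ring
      rw [hz, e, div_le_div_iff₀ (by positivity) h1]
      have h2 : 8 / 10 ≤ 2 * u * (2 * u - 1) * (1 + u) := by
        have k1 : (28 : ℝ) / 50 ≤ 2 * u * (2 * u - 1) := by nlinarith
        nlinarith
      have h3 : v * v ≤ (2 * u * (2 * u - 1) * (1 + u)) * v :=
        mul_le_mul_of_nonneg_right (hv8.trans h2) hv0.le
      have h4 : (1 - u) * (1 + u) = v * v := by nlinarith
      have h5 : (1 - u) * (1 + u) ≤ (2 * u * (2 * u - 1) * v) * (1 + u) := by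
        rw [h4]; linarith
      have h6 := le_of_mul_le_mul_right h5 (by linarith)
      linarith
    have hM : (g - 1) / d - 1 ≤ (g - 1) * (g - d + 1) / ((d - 1) * g) := by
      rw [div_sub_one (by linarith), div_le_div_iff₀ (by linarith)
        (mul_pos (by linarith) (by linarith))]
      obtain ⟨a, rfl⟩ : ∃ a, g = a + 1 := ⟨g - 1, by ring⟩
      nlinarith [sq_nonneg a, mul_pos (show 0 < a by linarith) (show 0 < d by linarith)]
    have hM0 : 0 ≤ (g - 1) * (g - d + 1) / ((d - 1) * g) :=
      div_nonneg (mul_nonneg (by linarith) (by linarith))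
        (mul_nonneg (by linarith) (by linarith))
    refine ⟨1 + (g - 1) * (g - d + 1) / ((d - 1) * g), 1 / (u ^ 2 * (1 / 2 + u * v)),
      by linarith, by positivity, ?_, fun y hy => ?_⟩
    · have : d - 1 ≠ 0 := by linarith
      have : g ≠ 0 := by linarith
      refine le_of_eq ?_
      field_simp
      ring
    · split_ifs with hyu
      · rw [one_mul]
        exact left_line_le_sqrt hu0 hv0 huv hy hyu
      · push Not at hyu
        refine le_trans ?_ (right_line_le_sqrt hu0 hv0 huv hyu.le)
        rw [← mul_assoc]
        refine add_le_add le_rfl (mul_le_mul_of_nonpos_right ?_ (by linarith))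
        have e : 1 / (u ^ 2 * (u * v))
            = 1 / (u ^ 2 * (1 / 2 + u * v)) * (1 + 1 / (2 * (u * v))) := by
          field_simp
          ring
        rw [e]
        exact mul_le_mul_of_nonneg_left (by linarith) (by positivity)

end LDPFreq

namespace LDPFreq

/-! ### The asymptotic lower bound for the absolute error -/

/-- Take α = (1 - 1/d - b/d)/b, the maximiser when I = e = 0. The floor b ≥ η gives α ≤ 1/η, so the
error terms are uniform over mechanisms. -/
theorem le_vanTreesBound {d : ℕ} (hd : 2 ≤ d) {b η : ℝ} (hη : 0 < η) (hηb : η ≤ b)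
    (hb : b ≤ d - 1) {I e : ℝ} (hI : 0 ≤ I) (he : 0 ≤ e) :
    ∃ α, 0 ≤ α ∧ (1 - 1 / d) / d * ((d - 1) / b - 1)
      - (I * (1 / η) ^ 2 + e * (8 + 12 * (1 / η) * d + 2 * (1 / η) ^ 2 * d ^ 2))
      ≤ vanTreesBound d α b I e := by
  have hd2 : (2 : ℝ) ≤ d := by exact_mod_cast hd
  have hd0 : (0 : ℝ) < d := by linarith
  have hb0 : 0 < b := by linarith
  obtain ⟨α, hα⟩ : ∃ α, α = (1 - 1 / d - b / d) / b := ⟨_, rfl⟩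
  have hK : 0 ≤ 1 - 1 / d - b / d := by
    have : 1 - 1 / d - b / d = (d - 1 - b) / d := by field_simp
    rw [this]; exact div_nonneg (by linarith) hd0.le
  have hα0 : 0 ≤ α := by rw [hα]; exact div_nonneg hK hb0.le
  have hα1 : α ≤ 1 / η := by
    rw [hα]
    refine div_le_div₀ zero_le_one ?_ hη hηb
    have : 0 ≤ 1 / (d : ℝ) := by positivity
    have : 0 ≤ b / d := by positivity
    linarith
  have hα2 : α ^ 2 ≤ (1 / η) ^ 2 := by gcongr
  refine ⟨α, hα0, ?_⟩
  rw [vanTreesBound]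
  have h1 : 2 * α * (1 - 1 / d - b / d) + ((1 - 1 / d) / d - b / d ^ 2) - α ^ 2 * b
      = (1 - 1 / d) / d * ((d - 1) / b - 1) := by
    rw [hα]; field_simp; ring
  have h2 : α ^ 2 * I ≤ I * (1 / η) ^ 2 := by
    rw [mul_comm]; exact mul_le_mul_of_nonneg_left hα2 hI
  have h3 : e * (8 + 12 * α * d + 2 * α ^ 2 * d ^ 2)
      ≤ e * (8 + 12 * (1 / η) * d + 2 * (1 / η) ^ 2 * d ^ 2) := by
    gcongr
  linarith

/-- Sum the supporting line over x: its linear part is nonnegative by the weighted constraint with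
weights 1 or M according to the side of y₀. Flooring the divergences costs at most κη per
coordinate. -/
theorem exists_le_sum_sqrt {d : ℕ} (hd : 2 ≤ d) {ε : ℝ} (hε : 0 < ε)
    (hdε : (d : ℝ) ≤ Real.exp ε + 1) : ∃ κ : ℝ, 0 ≤ κ ∧ ∀ η, 0 < η →
      η ≤ ((Real.exp ε - 1) / (Real.exp ε + d - 1)) ^ 2 →
      ∀ (m : ℕ) (P : Matrix (Fin m) (Fin d) ℝ), IsMechanism P → IsLDP ε P →
        d * (√(1 / ((Real.exp ε - 1) / (Real.exp ε + d - 1)) ^ 2 - 1) - κ * η)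
          ≤ ∑ x, √((d - 1) / max (chiSq P x) ((d - 1) * η) - 1) := by
  have hd2 : (2 : ℝ) ≤ d := by exact_mod_cast hd
  have hd1 : (0 : ℝ) < d - 1 := by linarith
  have hg : 1 < Real.exp ε := Real.one_lt_exp_iff.2 hε
  obtain ⟨M, κ, hM, hκ, hMg, hline⟩ := exists_supporting_line hd2 hg hdε
  obtain ⟨y₀, hy₀⟩ : ∃ y₀, y₀ = ((Real.exp ε - 1) / (Real.exp ε + d - 1)) ^ 2 := ⟨_, rfl⟩
  rw [← hy₀] at hline ⊢
  refine ⟨κ, hκ, fun η hη hηy m P hP hL => ?_⟩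
  obtain ⟨y, hy⟩ : ∃ y : Fin d → ℝ, y = fun x => chiSq P x / (d - 1) := ⟨_, rfl⟩
  obtain ⟨c, hc⟩ : ∃ c : Fin d → ℝ, c = fun x => if y x ≤ y₀ then 1 else M := ⟨_, rfl⟩
  have hsum := sum_weighted_chiSq_le (by omega) hε hM hMg hP hL (c := c)
    (fun x => by rw [hc]; dsimp only; split_ifs; exacts [le_rfl, hM])
    (fun x => by rw [hc]; dsimp only; split_ifs; exacts [hM, le_rfl])
  have hterm : ∀ x, √(1 / y₀ - 1) + κ / (d - 1) * -(c x * (chiSq P x - chiOpt d (Real.exp ε)))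
      - κ * η ≤ √((d - 1) / max (chiSq P x) ((d - 1) * η) - 1) := fun x => by
    have e1 : κ / (d - 1) * -(c x * (chiSq P x - chiOpt d (Real.exp ε)))
        = κ * (c x * (y₀ - y x)) := by
      rw [hy, chiOpt, ← hy₀]; field_simp; ring
    have e2 : (d - 1) / max (chiSq P x) ((d - 1) * η) = 1 / max (y x) η := by
      have : max (chiSq P x) ((d - 1) * η) = (d - 1) * max (y x) η := by
        rw [mul_max_of_nonneg _ _ hd1.le, hy]
        congr 1
        field_simp
      rw [this, one_div, div_mul_eq_div_div, div_self hd1.ne', one_div]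
    rw [e1, e2]
    rcases le_total η (y x) with h | h
    · rw [max_eq_left h, hc]
      have := hline (y x) (by linarith)
      have := mul_nonneg hκ hη.le
      linarith
    · rw [max_eq_right h, hc]
      have h1 := hline η hη
      rw [if_pos hηy, one_mul] at h1
      dsimp only
      rw [if_pos (h.trans hηy), one_mul]
      have hy0 : 0 ≤ y x := by
        rw [hy]; exact div_nonneg (chiSq_nonneg (by omega) hP x) hd1.le
      have := mul_nonneg hκ hy0
      linarith
  refine le_trans ?_ (Finset.sum_le_sum fun x _ => hterm x)
  rw [Finset.sum_sub_distrib, Finset.sum_add_distrib, ← Finset.mul_sum, Finset.sum_neg_distrib]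
  have : 0 ≤ κ / (d - 1) * -∑ x, c x * (chiSq P x - chiOpt d (Real.exp ε)) :=
    mul_nonneg (by positivity) (by linarith)
  simp only [Finset.sum_const, Finset.card_univ, Fintype.card_fin, nsmul_eq_mul]
  linarith

theorem optL1const_eq_sqrt {d : ℕ} (hd : 2 ≤ d) {ε : ℝ} (hε : 0 < ε) :
    optL1const d ε = √(2 / Real.pi) * (√((1 - 1 / d) / d) *
      (d * √(1 / ((Real.exp ε - 1) / (Real.exp ε + d - 1)) ^ 2 - 1))) := by
  have hd2 : (2 : ℝ) ≤ d := by exact_mod_cast hd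
  have hg : 1 < Real.exp ε := Real.one_lt_exp_iff.2 hε
  have hπ := Real.pi_pos
  have hC : 0 ≤ (1 - 1 / (d : ℝ)) / d := by
    have : 1 / (d : ℝ) ≤ 1 := by rw [div_le_one (by linarith)]; linarith
    exact div_nonneg (by linarith) (by linarith)
  have hd0 : (d : ℝ) = √((d : ℝ) ^ 2) := (Real.sqrt_sq (by linarith)).symm
  rw [optL1const_eq hε]
  conv_rhs => rw [show (d : ℝ) * √(1 / ((Real.exp ε - 1) / (Real.exp ε + d - 1)) ^ 2 - 1)
    = √((d : ℝ) ^ 2 * (1 / ((Real.exp ε - 1) / (Real.exp ε + d - 1)) ^ 2 - 1)) by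
      rw [Real.sqrt_mul (by positivity), ← hd0]]
  rw [← Real.sqrt_mul hC, ← Real.sqrt_mul (by positivity)]
  congr 1
  have h1 : Real.exp ε - 1 ≠ 0 := by linarith
  have h2 : Real.exp ε + d - 1 ≠ 0 := by linarith
  field_simp
  ring

theorem exists_pos_le_mul_le {K r y : ℝ} (hK : 0 ≤ K) (hr : 0 < r) (hy : 0 < y) :
    ∃ η, 0 < η ∧ η ≤ y ∧ K * η ≤ r := by
  refine ⟨min y (r / (K + 1)), lt_min hy (by positivity), min_le_left _ _, ?_⟩
  calc K * min y (r / (K + 1)) ≤ (K + 1) * (r / (K + 1)) :=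
        mul_le_mul (by linarith) (min_le_right _ _)
          (le_min hy.le (by positivity)) (by linarith)
    _ = r := by field_simp

/-- There are arbitrarily good priors for a fixed block size. -/
theorem exists_good_prior {d : ℕ} (hd : 2 ≤ d) {ζ η : ℝ} (hζ : 0 < ζ) (hη : 0 < η)
    (hη1 : η ≤ d - 1) :
    ∃ B : ℕ, 1 ≤ B ∧ ∃ μ : (Fin B → Fin d) → ℝ, (∀ ξ, 0 ≤ μ ξ) ∧ ∑ ξ, μ ξ = 1 ∧
      ∀ (m : ℕ) (P : Matrix (Fin m) (Fin d) ℝ), IsMechanism P → ∀ (x : Fin d)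
        (h : (Fin B → Fin m) → ℝ),
        ((1 - 1 / d) / d * ((d - 1) / max (chiSq P x) η - 1) - ζ) / B ≤
          ∑ ξ, ∑ ω : Fin B → Fin m, μ ξ * (∏ i, P (ω i) (ξ i)) * (freq ξ x - h ω) ^ 2 := by
  -- First the box is made wide, T = 1/√t, so that the prior information 10/T² is negligible; only
  -- then is B taken large enough that the laws in the box are nearly uniform.
  obtain ⟨t, ht0, -, ht⟩ := exists_pos_le_mul_le (K := 10 * (1 / η) ^ 2) (r := ζ / 2) (y := 1)
    (by positivity) (by positivity) one_pos
  obtain ⟨T, hT⟩ : ∃ T, T = 1 / √t := ⟨_, rfl⟩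
  have hT0 : 0 < T := by rw [hT]; have := Real.sqrt_pos.2 ht0; positivity
  have hTt : 10 / T ^ 2 = 10 * t := by
    rw [hT, div_pow, Real.sq_sqrt ht0.le]; field_simp
  have hlim : Tendsto (fun B : ℕ => 2 * T * (1 / √(B : ℝ))) atTop (𝓝 0) := by
    have h1 : Tendsto (fun B : ℕ => √(B : ℝ)) atTop atTop :=
      Real.tendsto_sqrt_atTop.comp tendsto_natCast_atTop_atTop
    have h2 := (tendsto_inv_atTop_zero.comp h1).const_mul (2 * T)
    simpa [Function.comp_def] using h2
  have hlim1 := hlim.const_mul (d : ℝ)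
  have hlim2 := hlim.mul_const (8 + 12 * (1 / η) * d + 2 * (1 / η) ^ 2 * d ^ 2)
  rw [mul_zero] at hlim1
  rw [zero_mul] at hlim2
  obtain ⟨B, hB, hB1, hB2⟩ := ((eventually_ge_atTop 1).and
    ((hlim1.eventually_le_const (show (0 : ℝ) < 1 / 2 by norm_num)).and
      (hlim2.eventually_le_const (show 0 < ζ / 2 by positivity)))).exists
  obtain ⟨μ, hμ0, hμ1, hμ⟩ := exists_prior (show 1 ≤ d by omega) hB hT0 hB1
  refine ⟨B, hB, μ, hμ0, hμ1, fun m P hP x h => ?_⟩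
  obtain ⟨α, hα, hv⟩ := le_vanTreesBound hd hη (le_max_right (chiSq P x) η)
    (max_le (chiSq_le (by omega) hP x) hη1) (show 0 ≤ 10 / T ^ 2 by positivity)
    (show 0 ≤ 2 * T * (1 / √(B : ℝ)) by positivity)
  refine le_trans ?_ (hμ m P hP x α _ hα (le_max_left _ η) h)
  refine div_le_div_of_nonneg_right ?_ (Nat.cast_nonneg B)
  rw [hTt] at hv ⊢
  linarith

/-- Smoothing at width θ√N costs 2θ√N, while the other errors stay bounded in N. -/
theorem block_error_le {N θ : ℝ} (hN : 1 ≤ N) (hθ : 0 < θ) :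
    2 * (θ * √N) + N / (θ * √N) ^ 3 + N * (3 / (θ * √N) ^ 2 * (1 + gaussThird))
      ≤ 2 * θ * √N + (1 / θ ^ 3 + 3 / θ ^ 2 * (1 + gaussThird)) := by
  have hN0 : 0 < N := by linarith
  have hsN : 0 < √N := Real.sqrt_pos.2 hN0
  have h1 : √N ^ 2 = N := Real.sq_sqrt hN0.le
  have h2 : N / (θ * √N) ^ 3 ≤ 1 / θ ^ 3 := by
    have : N / (θ * √N) ^ 3 = 1 / θ ^ 3 / √N := by
      rw [mul_pow, show √N ^ 3 = √N ^ 2 * √N by ring, h1]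
      field_simp
    rw [this]
    refine div_le_self (by positivity) ?_
    rwa [Real.one_le_sqrt]
  have h3 : N * (3 / (θ * √N) ^ 2 * (1 + gaussThird)) = 3 / θ ^ 2 * (1 + gaussThird) := by
    rw [mul_pow, h1]; field_simp
  rw [h3]
  linarith

theorem le_sqrt_mul_L1loss {m d : ℕ} (hd : 1 ≤ d) {P : Matrix (Fin m) (Fin d) ℝ}
    (hP : IsMechanism P) {B n : ℕ} (hB : 1 ≤ B) (hnB : B ≤ n) {μ : (Fin B → Fin d) → ℝ}
    (hμ0 : ∀ ξ, 0 ≤ μ ξ) (hμ1 : ∑ ξ, μ ξ = 1) {W : Fin d → ℝ}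
    (hr : ∀ (x : Fin d) (h : (Fin B → Fin m) → ℝ), W x / B ≤
      ∑ ξ, ∑ ω : Fin B → Fin m, μ ξ * (∏ i, P (ω i) (ξ i)) * (freq ξ x - h ω) ^ 2)
    (fhat : Estimator m d) {θ : ℝ} (hθ : 0 < θ) {A e : ℝ} (hA : 0 ≤ A) (he : 0 ≤ e)
    (hS : A - e ≤ ∑ x, √(2 / Real.pi) * √(W x)) :
    A - e - B * A / n - 2 * B * d * θ
      - B * d * (1 / θ ^ 3 + 3 / θ ^ 2 * (1 + gaussThird)) / √(n : ℝ) ≤ √n * L1loss P fhat n := by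
  have hπ := Real.pi_pos
  have hB0 : (0 : ℝ) < B := by positivity
  have hn1 : 1 ≤ n := hB.trans hnB
  have hn0 : (0 : ℝ) < n := by positivity
  obtain ⟨N, hN⟩ : ∃ N, N = n / B := ⟨_, rfl⟩
  have hN1 : 1 ≤ N := by rw [hN]; exact (Nat.one_le_div_iff hB).2 hnB
  have hN0 : (0 : ℝ) < N := by positivity
  have hnN : n = N * B + n % B := by rw [hN]; exact (Nat.div_add_mod' n B).symm
  have hNle : (N : ℝ) * B ≤ n := by
    have : N * B ≤ n := by omega
    exact_mod_cast this
  have hNge : (n : ℝ) - B ≤ N * B := by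
    have h1 := Nat.mod_lt n hB
    have : n ≤ N * B + B := by omega
    have : (n : ℝ) ≤ N * B + B := by exact_mod_cast this
    linarith
  have hNn : (N : ℝ) ≤ n := by
    have : (1 : ℝ) ≤ B := by exact_mod_cast hB
    nlinarith
  have hsN : 0 < √(N : ℝ) := Real.sqrt_pos.2 hN0
  have hsn : 0 < √(n : ℝ) := Real.sqrt_pos.2 hn0
  have hnsq : √(n : ℝ) ^ 2 = n := Real.sq_sqrt hn0.le
  have hnB' : √(n : ℝ) * (B / n) = B / √(n : ℝ) := by
    field_simp
    linarith
  have hmain := le_L1loss hd hP hB hnN hn1 hμ0 hμ1 hr fhat (δ := θ * √(N : ℝ)) (by positivity)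
  have hE1 := block_error_le (N := N) (by exact_mod_cast hN1) hθ
  obtain ⟨E, hE⟩ : ∃ E, E = 2 * (θ * √(N : ℝ)) + N / (θ * √(N : ℝ)) ^ 3
    + N * (3 / (θ * √(N : ℝ)) ^ 2 * (1 + gaussThird)) := ⟨_, rfl⟩
  obtain ⟨K, hK⟩ : ∃ K, K = 1 / θ ^ 3 + 3 / θ ^ 2 * (1 + gaussThird) := ⟨_, rfl⟩
  rw [← hE] at hmain
  rw [← hE, ← hK] at hE1
  rw [← hK]
  obtain ⟨q, hq⟩ : ∃ q, q = N * B / (n : ℝ) := ⟨_, rfl⟩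
  have hq0 : 0 ≤ q := by rw [hq]; positivity
  have hq1 : q ≤ 1 := by rw [hq, div_le_one hn0]; exact hNle
  have hq2 : 1 - q ≤ B / n := by
    rw [hq, one_sub_div hn0.ne']
    exact div_le_div_of_nonneg_right (by linarith) hn0.le
  have hterm : ∀ x, √(n : ℝ) * (B / n) * √(2 * (N * (W x / B)) / Real.pi)
      = √q * (√(2 / Real.pi) * √(W x)) := fun x => by
    have e1 : √(n : ℝ) * (B / n) = √(B ^ 2 / n) := by
      rw [Real.sqrt_div (by positivity), Real.sqrt_sq hB0.le, hnB']
    rw [e1, ← Real.sqrt_mul (by positivity), ← Real.sqrt_mul (by positivity),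
      ← Real.sqrt_mul (by positivity)]
    congr 1
    rw [hq]
    field_simp
  obtain ⟨S, hSd⟩ : ∃ S, S = ∑ x, √(2 / Real.pi) * √(W x) := ⟨_, rfl⟩
  have hS0 : 0 ≤ S := by
    rw [hSd]
    exact Finset.sum_nonneg fun x _ => mul_nonneg (Real.sqrt_nonneg _) (Real.sqrt_nonneg _)
  rw [← hSd] at hS
  -- q is the fraction of users in complete blocks; the remainder costs at most B/n of the leading
  -- term.
  have hqS : A - e - B * A / n ≤ √q * S := by
    have h1 : q ≤ √q := Real.le_sqrt_of_sq_le (by nlinarith)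
    have h2 := mul_le_mul_of_nonneg_right h1 hS0
    have h3 := mul_le_mul_of_nonneg_left hS hq0
    have h4 := mul_le_mul_of_nonneg_right hq2 hA
    have h5 := mul_le_mul_of_nonneg_right hq1 he
    have h6 : B * A / n = B / n * A := by ring
    rw [h6]
    linarith
  have hEn : √(n : ℝ) * (B / n) * (d * E) ≤ 2 * B * d * θ + B * d * K / √(n : ℝ) := by
    have h4 : √(N : ℝ) ≤ √(n : ℝ) := Real.sqrt_le_sqrt hNn
    have h5 := mul_le_mul_of_nonneg_left h4 (show 0 ≤ 2 * θ by positivity)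
    have h1 := mul_le_mul_of_nonneg_left (hE1.trans (add_le_add_left h5 K))
      (show 0 ≤ √(n : ℝ) * (B / n) * d by positivity)
    have h2 : √(n : ℝ) * (B / n) * d * (2 * θ * √(n : ℝ) + K)
        = 2 * B * d * θ + B * d * K / √(n : ℝ) := by
      rw [hnB']
      field_simp
    linarith
  have hfin := mul_le_mul_of_nonneg_left hmain hsn.le
  rw [Finset.sum_sub_distrib, mul_sub, mul_sub, ← mul_assoc, ← mul_assoc, Finset.mul_sum] at hfin
  simp only [hterm] at hfin
  simp only [Finset.sum_const, Finset.card_univ, Fintype.card_fin, nsmul_eq_mul] at hfin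
  rw [← Finset.mul_sum, ← hSd] at hfin
  linarith

theorem eventually_le_sqrt_mul_L1loss {d : ℕ} (hd : 1 ≤ d) {ε : ℝ} (hε : 0 < ε)
    (hdε : (d : ℝ) ≤ Real.exp ε + 1) {r : ℝ} (hr : 0 < r) :
    ∀ᶠ n : ℕ in atTop, ∀ (m : ℕ) (P : Matrix (Fin m) (Fin d) ℝ) (fhat : Estimator m d),
      IsMechanism P → IsLDP ε P → optL1const d ε - r ≤ √n * L1loss P fhat n := by
  rcases Nat.lt_or_ge d 2 with hd2 | hd2
  · obtain rfl : d = 1 := by omega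
    refine Eventually.of_forall fun n m P fhat hP _ => ?_
    have h1 : optL1const 1 ε = 0 := by simp [optL1const]
    have h2 : 0 ≤ L1loss P fhat n := Real.iSup_nonneg fun X =>
      expect_nonneg hP X fun o => Finset.sum_nonneg fun x _ => abs_nonneg _
    have := mul_nonneg (Real.sqrt_nonneg n) h2
    linarith
  have hd2' : (2 : ℝ) ≤ d := by exact_mod_cast hd2
  have hd0 : (0 : ℝ) < d := by linarith
  have hd1 : (0 : ℝ) < d - 1 := by linarith
  have hg : 1 < Real.exp ε := Real.one_lt_exp_iff.2 hε
  have hπ := Real.pi_pos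
  obtain ⟨κ, hκ, hsum⟩ := exists_le_sum_sqrt hd2 hε hdε
  have hopt := optL1const_eq_sqrt hd2 hε
  obtain ⟨y₀, hy₀⟩ : ∃ y₀, y₀ = ((Real.exp ε - 1) / (Real.exp ε + d - 1)) ^ 2 := ⟨_, rfl⟩
  rw [← hy₀] at hsum hopt
  obtain ⟨C, hC⟩ : ∃ C : ℝ, C = (1 - 1 / d) / d := ⟨_, rfl⟩
  have hy₀0 : 0 < y₀ := by
    have h1 : 0 < Real.exp ε - 1 := by linarith
    have h2 : 0 < Real.exp ε + d - 1 := by linarith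
    rw [hy₀]; positivity
  have hy₀1 : y₀ ≤ 1 := by
    rw [hy₀]
    refine pow_le_one₀ (div_nonneg (by linarith) (by linarith)) ?_
    rw [div_le_one (by linarith)]; linarith
  have hd1' : 1 / (d : ℝ) ≤ 1 := by rw [div_le_one hd0]; linarith
  have hC0 : 0 ≤ C := by rw [hC]; exact div_nonneg (by linarith) hd0.le
  obtain ⟨A, hA⟩ : ∃ A, A = √(2 / Real.pi) := ⟨_, rfl⟩
  have hA0 : 0 ≤ A := by rw [hA]; exact Real.sqrt_nonneg _
  rw [← hA, ← hC] at hopt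
  -- The parameters are fixed in the order η, s, B with its prior, θ, and finally n. None depends on
  -- the mechanism, so one threshold for n serves all mechanisms and estimators.
  obtain ⟨η, hη0, hηy, hη⟩ := exists_pos_le_mul_le (K := A * √C * d * κ) (r := r / 8) (y := y₀)
    (by positivity) (by positivity) hy₀0
  obtain ⟨s, hs0, -, hs⟩ := exists_pos_le_mul_le (K := A * d) (r := r / 8) (y := 1)
    (by positivity) (by positivity) one_pos
  obtain ⟨B, hB, μ, hμ0, hμ1, hμ⟩ := exists_good_prior hd2 (ζ := s ^ 2) (η := (d - 1) * η)
    (by positivity) (by positivity) (by nlinarith)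
  have hB0 : (0 : ℝ) < B := by positivity
  obtain ⟨θ, hθ0, -, hθ⟩ := exists_pos_le_mul_le (K := 2 * B * d) (r := r / 4) (y := 1)
    (by positivity) (by positivity) one_pos
  obtain ⟨K, hK⟩ : ∃ K, K = B * d * (1 / θ ^ 3 + 3 / θ ^ 2 * (1 + gaussThird)) := ⟨_, rfl⟩
  have hK0 : 0 ≤ K := by rw [hK]; have := gaussThird_nonneg; positivity
  have hlim : Tendsto (fun n : ℕ => B * optL1const d ε / n + K / √(n : ℝ)) atTop (𝓝 0) := by
    have h1 : Tendsto (fun n : ℕ => √(n : ℝ)) atTop atTop :=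
      Real.tendsto_sqrt_atTop.comp tendsto_natCast_atTop_atTop
    have h2 := (tendsto_const_nhds (x := B * optL1const d ε)).div_atTop
      (tendsto_natCast_atTop_atTop (R := ℝ))
    have h3 := (tendsto_const_nhds (x := K)).div_atTop h1
    simpa using h2.add h3
  filter_upwards [eventually_ge_atTop B, hlim.eventually_le_const (show 0 < r / 4 by positivity)]
    with n hnB hnlim m P fhat hP hL
  obtain ⟨V, hV⟩ : ∃ V : Fin d → ℝ, V = fun x =>
    C * ((d - 1) / max (chiSq P x) ((d - 1) * η) - 1) := ⟨_, rfl⟩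
  have hS : optL1const d ε - r / 4 ≤ ∑ x, A * √(V x - s ^ 2) := by
    have h1 : ∀ x, √(V x) - s ≤ √(V x - s ^ 2) := fun x => by
      have := sqrt_sub_le (V x - s ^ 2) (V x)
      rwa [sub_sub_cancel_left, abs_neg, abs_of_nonneg (sq_nonneg s), Real.sqrt_sq hs0.le] at this
    have h2 : ∀ x, √(V x) = √C * √((d - 1) / max (chiSq P x) ((d - 1) * η) - 1) := fun x => by
      rw [hV, Real.sqrt_mul hC0]
    have h3 := hsum η hη0 hηy m P hP hL
    have h4 := Finset.sum_le_sum fun x (_ : x ∈ Finset.univ) => h1 x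
    simp only [h2, Finset.sum_sub_distrib, ← Finset.mul_sum] at h4
    simp only [Finset.sum_const, Finset.card_univ, Fintype.card_fin, nsmul_eq_mul] at h4
    rw [← Finset.mul_sum, hopt]
    have h5 := mul_le_mul_of_nonneg_left h4 hA0
    have h6 := mul_le_mul_of_nonneg_left (mul_le_mul_of_nonneg_left h3 (Real.sqrt_nonneg C)) hA0
    linarith
  have hopt0 : 0 ≤ optL1const d ε := by rw [hopt]; positivity
  rw [hA] at hS
  have hfin := le_sqrt_mul_L1loss hd hP hB hnB hμ0 hμ1 (W := fun x => V x - s ^ 2)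
    (fun x h => by rw [hV, hC]; exact hμ m P hP x h) fhat hθ0 hopt0
    (show 0 ≤ r / 4 by positivity) hS
  rw [← hK] at hfin
  linarith

end LDPFreq

/-! ### The limit of the optimal L₁ loss and the final statement -/

namespace LDPFreq

theorem L1losses_nonneg {d : ℕ} {ε : ℝ} {n : ℕ} {L : ℝ} (hL : L ∈ L1losses d ε n) : 0 ≤ L := by
  obtain ⟨m, P, fhat, hP, -, -, rfl⟩ := hL
  exact Real.iSup_nonneg fun X =>
    expect_nonneg hP X fun o => Finset.sum_nonneg fun x _ => abs_nonneg _

theorem IsOSC.L1loss_mem {m d : ℕ} {ε : ℝ} {P : Matrix (Fin m) (Fin d) ℝ} {p : Fin m → ℝ}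
    {ps qs : ℝ} {k : ℕ} (h : IsOSC ε P p ps qs k) {n : ℕ} (hn : 1 ≤ n) :
    L1loss P (symEstimator ε P p ps qs) n ∈ L1losses d ε n :=
  ⟨m, P, _, h.mechanism, h.ldp, h.isUnbiased hn, rfl⟩

theorem IsOSC.eventually_sqrt_mul_L1loss_le {m d : ℕ} {ε : ℝ} {P : Matrix (Fin m) (Fin d) ℝ}
    {p : Fin m → ℝ} {ps qs : ℝ} (h : IsOSC ε P p ps qs 1) (hε : 0 < ε) (hd : 1 ≤ d) {r : ℝ}
    (hr : 0 < r) : ∀ᶠ n : ℕ in atTop,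
      √n * L1loss P (symEstimator ε P p ps qs) n ≤ optL1const d ε + r := by
  obtain ⟨κ, hκ⟩ := h.sqrt_mul_L1loss_le hε hd
  obtain ⟨η, hη0, -, hη⟩ := exists_pos_le_mul_le (K := (d : ℝ)) (r := r / 2) (y := 1)
    (by positivity) (by positivity) one_pos
  have hlim : Tendsto (fun n : ℕ => d * (κ / (η ^ 2 * √(n : ℝ)))) atTop (𝓝 0) := by
    have h1 : Tendsto (fun n : ℕ => √(n : ℝ)) atTop atTop :=
      Real.tendsto_sqrt_atTop.comp tendsto_natCast_atTop_atTop
    have h2 := (tendsto_const_nhds (x := κ)).div_atTop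
      (h1.const_mul_atTop (show 0 < η ^ 2 by positivity))
    simpa using h2.const_mul (d : ℝ)
  filter_upwards [eventually_ge_atTop 1, hlim.eventually_le_const (show 0 < r / 2 by positivity)]
    with n hn hn2
  have := hκ n hn η hη0
  linarith

end LDPFreq

open LDPFreq in
theorem corollary3p3 (d : ℕ) (hd : 1 ≤ d) (ε : ℝ) (hε : 0 < ε)
    (hdε : (d : ℝ) ≤ Real.exp ε + 1) :
    -- the minimum `L₂` loss, for every dataset size
    (∀ n : ℕ, 1 ≤ n → IsLeast (L2losses d ε n) (optL2 d ε n)) ∧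
    -- the asymptotic value of the minimum `L₁` loss
    Tendsto (fun n : ℕ => Real.sqrt n * sInf (L1losses d ε n)) atTop (𝓝 (optL1const d ε)) ∧
    -- optimal symmetric configurations with support size one exist
    (∃ (m : ℕ) (P : Matrix (Fin m) (Fin d) ℝ) (p : Fin m → ℝ) (ps qs : ℝ),
      IsOSC ε P p ps qs 1) ∧
    -- all of them are unbiased, attain the minimum `L₂` loss, and asymptotically the `L₁` loss
    (∀ (m : ℕ) (P : Matrix (Fin m) (Fin d) ℝ) (p : Fin m → ℝ) (ps qs : ℝ),
      IsOSC ε P p ps qs 1 →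
        (∀ n : ℕ, 1 ≤ n → IsUnbiased P (symEstimator ε P p ps qs) n ∧
          L2loss P (symEstimator ε P p ps qs) n = optL2 d ε n) ∧
        Tendsto (fun n : ℕ => Real.sqrt n * L1loss P (symEstimator ε P p ps qs) n) atTop
          (𝓝 (optL1const d ε))) ∧
    -- every other support size is strictly worse, unless there is just one input value
    (∀ (m : ℕ) (P : Matrix (Fin m) (Fin d) ℝ) (p : Fin m → ℝ) (ps qs : ℝ) (k : ℕ),
      2 ≤ d → k ≠ 1 → IsOSC ε P p ps qs k →
        ∀ n : ℕ, 1 ≤ n → optL2 d ε n < L2loss P (symEstimator ε P p ps qs) n) := by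
  have hlow := fun {r : ℝ} (hr : 0 < r) => eventually_le_sqrt_mul_L1loss hd hε hdε hr
  refine ⟨fun n hn => ⟨?_, ?_⟩, ?_, exists_isOSC_one hd hε, fun m P p ps qs h => ⟨fun n hn =>
    ⟨h.isUnbiased hn, h.L2loss_of_one hε hd hn⟩, ?_⟩,
    fun m P p ps qs k hd2 hk h n hn => h.optL2_lt hε hdε hd2 hk hn⟩
  · obtain ⟨m, P, p, ps, qs, h⟩ := exists_isOSC_one hd hε
    exact ⟨m, P, _, h.mechanism, h.ldp, h.isUnbiased hn, (h.L2loss_of_one hε hd hn).symm⟩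
  · rintro L ⟨m, P, fhat, hP, hL, hf, rfl⟩
    exact optL2_le_L2loss hd hε hdε hP hL hn hf
  · obtain ⟨m, P, p, ps, qs, h⟩ := exists_isOSC_one hd hε
    rw [tendsto_order]
    refine ⟨fun a ha => ?_, fun a ha => ?_⟩
    · filter_upwards [hlow (show 0 < (optL1const d ε - a) / 2 by linarith), eventually_gt_atTop 0]
        with n hn hn0
      have hsn : 0 < √(n : ℝ) := Real.sqrt_pos.2 (by exact_mod_cast hn0)
      -- The bound passes to the infimum because it holds at this n for all mechanisms at once;
      -- randomized response shows that the set of losses is nonempty.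
      have hle : (optL1const d ε - (optL1const d ε - a) / 2) / √(n : ℝ) ≤ sInf (L1losses d ε n) := by
        refine le_csInf ⟨_, h.L1loss_mem hn0⟩ ?_
        rintro L ⟨m', P', fhat, hP', hL', -, rfl⟩
        rw [div_le_iff₀' hsn]
        exact hn m' P' fhat hP' hL'
      rw [div_le_iff₀' hsn] at hle
      linarith
    · filter_upwards [h.eventually_sqrt_mul_L1loss_le hε hd
        (show 0 < (a - optL1const d ε) / 2 by linarith), eventually_gt_atTop 0] with n hn hn0
      have hle : sInf (L1losses d ε n) ≤ L1loss P (symEstimator ε P p ps qs) n :=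
        csInf_le ⟨0, fun L hL => L1losses_nonneg hL⟩ (h.L1loss_mem hn0)
      have := mul_le_mul_of_nonneg_left hle (Real.sqrt_nonneg n)
      linarith
  · rw [tendsto_order]
    refine ⟨fun a ha => ?_, fun a ha => ?_⟩
    · filter_upwards [hlow (show 0 < (optL1const d ε - a) / 2 by linarith)] with n hn
      have := hn m P (symEstimator ε P p ps qs) h.mechanism h.ldp
      linarith
    · filter_upwards [h.eventually_sqrt_mul_L1loss_le hε hd
        (show 0 < (a - optL1const d ε) / 2 by linarith)] with n hn
      linarith
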